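/- Let $\beta\in(-1,1)$. For $\delta\ge 0$ and $h>0$ let $P^h_\delta=-h^2\frac{d^2}{dx^2}+V_{\delta,\beta}$ on $L^2([-1,1])$, with domain $\{u: u,u''\in L^2([-1,1]),\ u(-1)=u(1)=0\}$, where $V_{\delta,\beta}(x)=ix^2+i\delta$ for $x>\beta$ and $V_{\delta,\beta}(x)=ix^2-i\delta$ for $x<\beta$. Let $\Lambda_\delta=\lim_h\mathrm{Sp}(P^h_\delta)$ be the set of all $E_0\in\mathbb C$ for which there are $h_j>0$, $h_j\to0$, and eigenvalues $E_j$ of $P^{h_j}_\delta$ with $E_j\to E_0$. Put $$\Gamma_{-1,\beta}=\Big\{E:\ \mathrm{Re}\int_{-1}^{\beta}\sqrt{it^2-i\delta-E}\,dt=0\Big\},\qquad \Gamma_{\beta,1}=\Big\{E:\ \mathrm{Re}\int_{\beta}^{1}\sqrt{it^2+i\delta-E}\,dt=0\Big\},$$ where the square root is a continuous branch along the interval of integration (if there is a zero of the radicand on the interval, the condition is to hold for some continuous branch). (a) For every $\delta\ge0$: 1. If $\delta>0$, then for all $E$ with $|E|$ large enough (depending on $\beta,\delta$), $E\in\Lambda_\delta$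 if and only if $E\in\Gamma_{-1,\beta}\cup\Gamma_{\beta,1}$. 2. $\Gamma_{-1,\beta}$ goes to infinity and is asymptotic to $\mathbb R+\frac i3(\beta^2-\beta+1)-i\delta$: there is $A>0$ such that the points of $\Gamma_{-1,\beta}$ with real part at least $A$ are exactly the points $a+ib(a)$, $a\ge A$, for a continuous real function $b$ with $b(a)=\frac13(\beta^2-\beta+1)-\delta+O(1/a)$ as $a\to+\infty$, and all points of $\Gamma_{-1,\beta}$ of large enough modulus have real part at least $A$. 3. In the same sense $\Gamma_{\beta,1}$ goes to infinity and is asymptotic to $\mathbb R+\frac i3(\beta^2+\beta+1)+i\delta$. 4. If $\beta\ne0$, the two curves are distinct near infinity: they have no common point of large enough modulus. (b) If $\beta\neq0$, the limit spectrum is unstable under the perturbation: there are $c>0$ and $\delta_0>0$ such that for every $\delta\in(0,\delta_0)$ there is $R$ such that $|E-E'|\ge c$ for all $E\in\Lambda_\delta$ with $|E|\ge R$ and all $E'\in\Lambda_0$, where $\Lambda_0$ is the limit spectrum of the unperturbed operator $-h^2\frac{d^2}{dx^2}+ix^2$. -/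

import Mathlib

open Set Filter Topology MeasureTheory

noncomputable section

/-- `u` lies in the domain `{u ∈ L², u'' ∈ L², u(-1) = u(1) = 0}` of the Dirichlet realization on
`[-1,1]`, with first derivative `v` and second (weak) derivative `w`. In one dimension `u` and `u''`
being in `L²` means that `u` (its continuous representative) is the primitive of a function `v`
which is itself the primitive of `w ∈ L²`. -/
structure InDirichletDomain (u v w : ℝ → ℂ) : Prop where
  memLp : MemLp w 2 (volume.restrict (Icc (-1 : ℝ) 1))
  deriv_primitive : ∀ x ∈ Icc (-1 : ℝ) 1, v x = v (-1) + ∫ s in (-1 : ℝ)..x, w s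
  primitive : ∀ x ∈ Icc (-1 : ℝ) 1, u x = u (-1) + ∫ s in (-1 : ℝ)..x, v s
  left : u (-1) = 0
  right : u 1 = 0

/-- The Dirichlet eigenvalues of `-h² d²/dx² + W` on `L²([-1,1])`: the `E` for which some nonzero
`u` in the domain satisfies `-h² u'' + W u = E u` almost everywhere. -/
def dirichletEigenvalues (W : ℝ → ℂ) (h : ℝ) : Set ℂ :=
  {E | ∃ u v w : ℝ → ℂ, InDirichletDomain u v w ∧ (∃ x ∈ Icc (-1 : ℝ) 1, u x ≠ 0) ∧
    ∀ᵐ x ∂(volume.restrict (Icc (-1 : ℝ) 1)), -(h : ℂ) ^ 2 * w x + W x * u x = E * u x}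

/-- The limit spectrum `lim_h Sp(-h² d²/dx² + W)`: all limits of sequences of eigenvalues `E_j`
for `h_j → 0`, `h_j > 0`. -/
def limitSpectrum (W : ℝ → ℂ) : Set ℂ :=
  {E₀ | ∃ (h : ℕ → ℝ) (E : ℕ → ℂ), (∀ j, 0 < h j) ∧ Tendsto h atTop (𝓝 0) ∧
    (∀ j, E j ∈ dirichletEigenvalues W (h j)) ∧ Tendsto E atTop (𝓝 E₀)}

/-- The potential `V(x) = i x²`. -/
def quadPotential (x : ℝ) : ℂ := Complex.I * (x : ℂ) ^ 2

/-- The perturbed potential: `V(x) + iδ` for `x > β` and `V(x) - iδ` for `x < β`. (The value at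
the single point `β` plays no role.) -/
def perturbedPotential (δ β : ℝ) (x : ℝ) : ℂ :=
  if β < x then quadPotential x + Complex.I * (δ : ℂ) else quadPotential x - Complex.I * (δ : ℂ)

/-- `{E : Re ∫_x^y (W(t) - E)^{1/2} dt = 0}`, where the square root is a continuous branch along
the segment from `x` to `y`. If `W - E` has no zero on the segment there are exactly two continuous
branches, which differ by a sign, so that the condition does not depend on the branch. -/
def actionCurve (W : ℝ → ℂ) (x y : ℝ) : Set ℂ :=
  {E | ∃ f : ℝ → ℂ, ContinuousOn f (uIcc x y) ∧ (∀ t ∈ uIcc x y, f t ^ 2 = W t - E) ∧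
    (∫ t in x..y, f t).re = 0}

/-- `Γ_{-1,β}`, for the potential `V - iδ` on `[-1,β]`. -/
def leftCurve (δ β : ℝ) : Set ℂ :=
  actionCurve (fun t => quadPotential t - Complex.I * (δ : ℂ)) (-1) β

/-- `Γ_{β,1}`, for the potential `V + iδ` on `[β,1]`. -/
def rightCurve (δ β : ℝ) : Set ℂ :=
  actionCurve (fun t => quadPotential t + Complex.I * (δ : ℂ)) β 1

/-- `Γ` goes to infinity and is asymptotic to the line `ℝ + i m` (in the direction `Re E → +∞`):
outside a bounded set `Γ` lies in a half plane `Re E ≥ A`, in which it is the graph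
`{a + i b(a) : a ≥ A}` of a continuous function with `b(a) = m + O(1/a)`. -/
def IsAsymptoticToLine (Γ : Set ℂ) (m : ℝ) : Prop :=
  ∃ (A R C : ℝ) (b : ℝ → ℝ), 0 < A ∧ ContinuousOn b (Ici A) ∧
    (∀ a, A ≤ a → ∀ y : ℝ, ((a : ℂ) + (y : ℂ) * Complex.I ∈ Γ ↔ y = b a)) ∧
    (∀ a, A ≤ a → |b a - m| ≤ C / a) ∧
    (∀ E ∈ Γ, R ≤ ‖E‖ → A ≤ E.re)

end

/-! The potential ix² is even, so translating E by ±iδ and reflecting the right part reduce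
everything to one object: the solution of -h²u'' + ix²u = Eu on [-1, b] with u(-1) = 0, u'(-1) = 1,
taken at energy E + iδ with b = β and at energy E - iδ with b = -β. A number E is an eigenvalue
exactly when the Wronskian `matching` of the two solutions at β vanishes
(`matching_eq_zero_of_eigenvalue`, `eigenvalue_of_matching_eq_zero`).

For |E| ≥ 1000 the turning points are far from the segment, and complex WKB holds with O(h) error
and constants uniform in E (`wkb_estimate`): up to a factor, the solution and its derivative at b
are h sinh(A/h) and p cosh(A/h), where A is the integral of √(iz² - E) over [-1, b] and p its
integrand at b. With x = exp(-2A₁/h), y = exp(-2A₂/h) and p, q the two end momenta, the normalized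
Wronskian is (p+q)(1-xy) + (p-q)(x-y) up to O(h) (`norm_normMatching_sub_le`). Here p² - q² = -2iδ,
so for δ > 0 neither p+q nor p-q vanishes. Take signs with Re A ≥ 0. Off both curves x and y tend to
0, the Wronskian is close to p+q ≠ 0, and there is no spectrum (`limitSpectrum_perturbed_subset`).
On exactly one curve, say Re A₁ = 0 < Re A₂, the equation becomes x ≈ -(p+q)/(p-q); since A₁ has
nonzero derivative in E, x winds on the scale h and a Rouché argument gives eigenvalues tending to
the point (`exists_matching_eq_zero_near`). The jump thus makes each half quantize by itself,
whereas for δ = 0 the limit spectrum near infinity lies on the curve of the action over the whole of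
[-1, 1].

The geometry of the curves is read off the single-valued function S = `sqAction`, with A² = -(b+1)²
S: the curve is where S is real and nonnegative. As S(E) = E - i m₁ + O(1/E), with m₁ the mean of t²
over [-1, b], the curve is near infinity a graph asymptotic to Im E = m₁. For β ≠ 0 the asymptotes
of the two shifted curves coincide when δ = -β/3, so disjointness requires one more order: the 1/a²
coefficients at β and -β differ (`curveCoeff_sub_neg_ne_zero`). Instability is the fact that m₁(±β)
differs from m₁(1) = 1/3 when β ≠ 0. -/

/-! ### Entire solutions of the equation, holomorphic in the energy. -/

/-- Coefficients of the power series `∑ c n z^(2n+e)` solving `y'' = (α z² + κ) y`. -/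
noncomputable def weberCoeff (e : ℕ) (α κ : ℂ) : ℕ → ℂ
  | 0 => 1
  | 1 => κ / ((2 + e) * (1 + e))
  | n + 2 => (κ * weberCoeff e α κ (n + 1) + α * weberCoeff e α κ n) /
      ((2 * n + 4 + e) * (2 * n + 3 + e))

/-- The recurrence has two steps, so the induction carries two consecutive bounds; the denominators
dominate (n+1)(n+2). The factorial decay, locally uniform in κ, makes the solutions entire both in z
and in the spectral parameter. -/
lemma norm_weberCoeff_le (e : ℕ) {α κ : ℂ} {M : ℝ} (hM : 1 ≤ M) (h : ‖α‖ + ‖κ‖ ≤ M) (n : ℕ) :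
    ‖weberCoeff e α κ n‖ ≤ M ^ n / n.factorial := by
  have hM0 : 0 < M := by linarith
  suffices H : ‖weberCoeff e α κ n‖ ≤ M ^ n / n.factorial ∧
      ‖weberCoeff e α κ (n + 1)‖ ≤ M ^ (n + 1) / (n + 1).factorial from H.1
  induction n with
  | zero =>
    refine ⟨by simp [weberCoeff], ?_⟩
    have h1 : ‖((2 + e : ℂ) * (1 + e))‖ = (2 + e : ℝ) * (1 + e) := by
      have : ((2 + e : ℂ) * (1 + e)) = (((2 + e : ℕ) * (1 + e : ℕ) : ℕ) : ℂ) := by push_cast; ring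
      rw [this, Complex.norm_natCast]; push_cast; ring
    have he : (0 : ℝ) ≤ e := Nat.cast_nonneg e
    simp only [weberCoeff, norm_div, h1]
    have hκ : ‖κ‖ ≤ M := by linarith [norm_nonneg α]
    simp only [zero_add, pow_one, Nat.factorial_one, Nat.cast_one, div_one]
    rw [div_le_iff₀ (by positivity)]
    nlinarith [norm_nonneg κ, mul_nonneg he he]
  | succ n ih =>
    obtain ⟨h0, h1⟩ := ih
    refine ⟨h1, ?_⟩
    have he : (0 : ℝ) ≤ e := Nat.cast_nonneg e
    have hn : (0 : ℝ) ≤ n := Nat.cast_nonneg n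
    have hd : ‖((2 * n + 4 + e : ℂ) * (2 * n + 3 + e))‖ = (2 * n + 4 + e : ℝ) * (2 * n + 3 + e) := by
      have : ((2 * n + 4 + e : ℂ) * (2 * n + 3 + e)) =
        (((2 * n + 4 + e : ℕ) * (2 * n + 3 + e : ℕ) : ℕ) : ℂ) := by push_cast; ring
      rw [this, Complex.norm_natCast]; push_cast; ring
    simp only [weberCoeff, norm_div, hd]
    set X : ℝ := M ^ (n + 1) / (n + 1).factorial with hX
    have hX0 : 0 ≤ X := by positivity
    have e1 : M ^ (n + 1 + 1) / (n + 1 + 1).factorial = X * M / (n + 2) := by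
      rw [hX, Nat.factorial_succ (n + 1)]; push_cast; field_simp; ring
    have e0 : M ^ n / n.factorial ≤ X * (n + 1) := by
      have : X * (n + 1) = M * (M ^ n / n.factorial) := by
        rw [hX, Nat.factorial_succ n]; push_cast; field_simp; ring
      rw [this]
      have : 0 ≤ M ^ n / n.factorial := by positivity
      nlinarith
    have hnum : ‖κ * weberCoeff e α κ (n + 1) + α * weberCoeff e α κ n‖ ≤ X * (n + 1) * M := by
      calc _ ≤ ‖κ‖ * ‖weberCoeff e α κ (n + 1)‖ + ‖α‖ * ‖weberCoeff e α κ n‖ := by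
            simpa using norm_add_le (κ * weberCoeff e α κ (n + 1)) (α * weberCoeff e α κ n)
        _ ≤ ‖κ‖ * (X * (n + 1)) + ‖α‖ * (X * (n + 1)) := by
            gcongr
            · exact h1.trans (by nlinarith)
            · exact h0.trans e0
        _ = X * (n + 1) * (‖α‖ + ‖κ‖) := by ring
        _ ≤ _ := by gcongr
    rw [e1, div_le_div_iff₀ (by positivity) (by positivity)]
    calc _ ≤ X * (n + 1) * M * (n + 2) := by gcongr
      _ = X * M * ((n + 1) * (n + 2)) := by ring
      _ ≤ _ := by
        gcongr ?_ * ?_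
        nlinarith [mul_nonneg hn hn, mul_nonneg hn he, mul_nonneg he he]

lemma differentiable_weberCoeff (e : ℕ) (α : ℂ) (n : ℕ) :
    Differentiable ℂ (fun κ => weberCoeff e α κ n) := by
  suffices H : Differentiable ℂ (fun κ => weberCoeff e α κ n) ∧
      Differentiable ℂ (fun κ => weberCoeff e α κ (n + 1)) from H.1
  induction n with
  | zero => exact ⟨by simp [weberCoeff], by simp only [weberCoeff]; fun_prop⟩
  | succ n ih =>
    obtain ⟨h0, h1⟩ := ih
    exact ⟨h1, by simp only [weberCoeff]; fun_prop⟩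

/-- The even (`e = 0`) or odd (`e = 1`) solution of `y'' = (α z² + κ) y`. -/
noncomputable def weberSol (e : ℕ) (α κ z : ℂ) : ℂ :=
  ∑' n, weberCoeff e α κ n * z ^ (2 * n + e)

/-- The derivative of `weberSol`. -/
noncomputable def weberSolDeriv (e : ℕ) (α κ z : ℂ) : ℂ :=
  ∑' n, weberCoeff e α κ n * (((2 * n + e : ℕ) : ℂ) * z ^ (2 * n + e - 1))

/-- Two differentiations of z^(2n+e) cost a factor at most (2n+e)², which the geometric part of the
majorant absorbs. One majorant then serves for the series, for its first two derivatives and for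
holomorphy in κ. -/
lemma two_mul_add_sq_le {e : ℕ} (he : e ≤ 1) (n : ℕ) : ((2 * n + e : ℕ) : ℝ) ^ 2 ≤ 9 ^ n := by
  have h : 2 * n + 1 ≤ 3 ^ n := by
    induction n with
    | zero => simp
    | succ n ih => rw [pow_succ]; omega
  have h2 : ((2 * n + e : ℕ) : ℝ) ≤ 3 ^ n := by exact_mod_cast (by omega : 2 * n + e ≤ 2 * n + 1).trans h
  calc _ ≤ ((3 : ℝ) ^ n) ^ 2 := by gcongr
    _ = 9 ^ n := by rw [← pow_mul, mul_comm, pow_mul]; norm_num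

lemma summable_weberMajorant (R M : ℝ) :
    Summable (fun n : ℕ => R * ((9 * M * R ^ 2) ^ n / n.factorial)) :=
  (Real.summable_pow_div_factorial _).mul_left R

lemma norm_weber_term_le {e : ℕ} (he : e ≤ 1) {α κ z : ℂ} {M R : ℝ} (hM : 1 ≤ M)
    (h : ‖α‖ + ‖κ‖ ≤ M) (hR : 1 ≤ R) (hz : ‖z‖ ≤ R) (n : ℕ) {s : ℂ} (hs : ‖s‖ ≤ 9 ^ n) {m : ℕ}
    (hm : m ≤ 2 * n + e) :
    ‖weberCoeff e α κ n * (s * z ^ m)‖ ≤ R * ((9 * M * R ^ 2) ^ n / n.factorial) := by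
  have hpow : ‖z ^ m‖ ≤ R * (R ^ 2) ^ n := by
    rw [norm_pow]
    calc ‖z‖ ^ m ≤ R ^ m := by gcongr
      _ ≤ R ^ (2 * n + 1) := pow_le_pow_right₀ hR (by omega)
      _ = _ := by rw [pow_succ, pow_mul]; ring
  have hM0 : 0 ≤ M := by linarith
  calc _ = ‖weberCoeff e α κ n‖ * (‖s‖ * ‖z ^ m‖) := by simp
    _ ≤ (M ^ n / n.factorial) * (9 ^ n * (R * (R ^ 2) ^ n)) := by
        gcongr
        exact norm_weberCoeff_le e hM h n
    _ = _ := by rw [mul_pow, mul_pow]; ring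

lemma norm_cast_mul_le {e : ℕ} (he : e ≤ 1) (n : ℕ) :
    ‖((2 * n + e : ℕ) : ℂ)‖ ≤ 9 ^ n := by
  rw [Complex.norm_natCast]
  refine le_trans ?_ (two_mul_add_sq_le he n)
  have : ((2 * n + e : ℕ) : ℝ) = 0 ∨ (1 : ℝ) ≤ ((2 * n + e : ℕ) : ℝ) := by
    rcases Nat.eq_zero_or_pos (2 * n + e) with h | h
    · left; exact_mod_cast h
    · right; exact_mod_cast h
  rcases this with h | h <;> nlinarith

lemma norm_cast_mul_cast_le {e : ℕ} (he : e ≤ 1) (n : ℕ) :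
    ‖((2 * n + e : ℕ) : ℂ) * ((2 * n + e - 1 : ℕ) : ℂ)‖ ≤ 9 ^ n := by
  rw [norm_mul, Complex.norm_natCast, Complex.norm_natCast]
  refine le_trans ?_ (two_mul_add_sq_le he n)
  rw [sq]
  gcongr
  omega

lemma hasDerivAt_weberSol {e : ℕ} (he : e ≤ 1) (α κ z : ℂ) :
    HasDerivAt (weberSol e α κ) (weberSolDeriv e α κ z) z := by
  set M := 1 + (‖α‖ + ‖κ‖)
  have hM : 1 ≤ M := by simp only [M]; linarith [norm_nonneg α, norm_nonneg κ]
  set R := 1 + ‖z‖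
  have hR : 1 ≤ R := by simp only [R]; linarith [norm_nonneg z]
  have hz : z ∈ Metric.ball (0 : ℂ) R := by simp [R]
  refine hasDerivAt_tsum_of_isPreconnected (summable_weberMajorant R M) Metric.isOpen_ball
    (convex_ball _ _).isPreconnected (g := fun n z => weberCoeff e α κ n * z ^ (2 * n + e))
    (g' := fun n z => weberCoeff e α κ n * (((2 * n + e : ℕ) : ℂ) * z ^ (2 * n + e - 1)))
    ?_ ?_ hz ?_ hz
  · intro n y _
    exact (hasDerivAt_pow _ _).const_mul _
  · intro n y hy
    exact norm_weber_term_le he hM (by simp [M]) hR (by simpa using (mem_ball_zero_iff.1 hy).le) n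
      (norm_cast_mul_le he n) (by omega)
  · refine Summable.of_norm_bounded (summable_weberMajorant R M) fun n => ?_
    have := norm_weber_term_le he hM (α := α) (κ := κ) (by simp [M]) hR (mem_ball_zero_iff.1 hz).le n
      (s := 1) (m := 2 * n + e) (by simpa using one_le_pow₀ (by norm_num)) le_rfl
    simpa using this

lemma summable_weberSol {e : ℕ} (he : e ≤ 1) (α κ z : ℂ) :
    Summable (fun n => weberCoeff e α κ n * z ^ (2 * n + e)) := by
  refine Summable.of_norm_bounded (summable_weberMajorant (1 + ‖z‖) (1 + (‖α‖ + ‖κ‖))) fun n => ?_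
  have := norm_weber_term_le he (α := α) (κ := κ) (z := z) (M := 1 + (‖α‖ + ‖κ‖)) (R := 1 + ‖z‖)
    (by linarith [norm_nonneg α, norm_nonneg κ]) (by simp) (by linarith [norm_nonneg z]) (by simp) n
    (s := 1) (m := 2 * n + e) (by simpa using one_le_pow₀ (by norm_num)) le_rfl
  simpa using this

lemma hasDerivAt_weberSolDeriv {e : ℕ} (he : e ≤ 1) (α κ z : ℂ) :
    HasDerivAt (weberSolDeriv e α κ) ((α * z ^ 2 + κ) * weberSol e α κ z) z := by
  set M := 1 + (‖α‖ + ‖κ‖)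
  have hM : 1 ≤ M := by simp only [M]; linarith [norm_nonneg α, norm_nonneg κ]
  set R := 1 + ‖z‖
  have hR : 1 ≤ R := by simp only [R]; linarith [norm_nonneg z]
  have hz : z ∈ Metric.ball (0 : ℂ) R := by simp [R]
  set g'' : ℕ → ℂ → ℂ := fun n z => weberCoeff e α κ n *
    (((2 * n + e : ℕ) : ℂ) * ((2 * n + e - 1 : ℕ) : ℂ) * z ^ (2 * n + e - 1 - 1)) with hg''
  have hb : ∀ n, ∀ y ∈ Metric.ball (0 : ℂ) R, ‖g'' n y‖ ≤ R * ((9 * M * R ^ 2) ^ n / n.factorial) :=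
    fun n y hy => norm_weber_term_le he hM (by simp [M]) hR (by simpa using (mem_ball_zero_iff.1 hy).le)
      n (norm_cast_mul_cast_le he n) (by omega)
  have key : ∑' n, g'' n z = (α * z ^ 2 + κ) * weberSol e α κ z := by
    have hs : Summable (fun n => g'' n z) :=
      Summable.of_norm_bounded (summable_weberMajorant R M) fun n => hb n z hz
    have hS := summable_weberSol he α κ z
    -- The exponent is a truncated subtraction for n = 0, but since e ≤ 1 the numerical factor is
    -- then zero.
    have h0 : g'' 0 z = 0 := by interval_cases e <;> simp [hg'']
    have hstep : ∀ n, g'' (n + 1 + 1) z = κ * (weberCoeff e α κ (n + 1) * z ^ (2 * (n + 1) + e)) +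
        α * z ^ 2 * (weberCoeff e α κ n * z ^ (2 * n + e)) := by
      intro n
      simp only [hg'', weberCoeff]
      have h1 : (2 * n + 4 + e : ℂ) ≠ 0 := by
        have : (2 * n + 4 + e : ℂ) = ((2 * n + 4 + e : ℕ) : ℂ) := by push_cast; ring
        rw [this, Nat.cast_ne_zero]; omega
      have h2 : (2 * n + 3 + e : ℂ) ≠ 0 := by
        have : (2 * n + 3 + e : ℂ) = ((2 * n + 3 + e : ℕ) : ℂ) := by push_cast; ring
        rw [this, Nat.cast_ne_zero]; omega
      rw [show 2 * (n + 1 + 1) + e - 1 = 2 * n + 3 + e by omega,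
        show 2 * n + 3 + e - 1 = 2 * n + e + 2 by omega, show 2 * (n + 1) + e = 2 * n + e + 2 by omega]
      push_cast
      field_simp
      ring
    have h1 : g'' 1 z = κ * (weberCoeff e α κ 0 * z ^ (2 * 0 + e)) := by
      simp only [hg'', weberCoeff]
      have h1 : (2 + e : ℂ) ≠ 0 := by
        have : (2 + e : ℂ) = ((2 + e : ℕ) : ℂ) := by push_cast; ring
        rw [this, Nat.cast_ne_zero]; omega
      have h2 : (1 + e : ℂ) ≠ 0 := by
        have : (1 + e : ℂ) = ((1 + e : ℕ) : ℂ) := by push_cast; ring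
        rw [this, Nat.cast_ne_zero]; omega
      rw [show 2 * 1 + e - 1 = 1 + e by omega, show 1 + e - 1 = e by omega]
      push_cast
      field_simp
      simp
    have hS1 := (summable_nat_add_iff 1).2 hS
    rw [hs.tsum_eq_zero_add, ((summable_nat_add_iff 1).2 hs).tsum_eq_zero_add, h0, zero_add]
    simp only [zero_add, hstep, h1]
    rw [(hS1.mul_left κ).tsum_add (hS.mul_left _), tsum_mul_left, tsum_mul_left, add_mul,
      weberSol]
    have := hS.tsum_eq_zero_add
    linear_combination (-κ) * this
  rw [← key]
  refine hasDerivAt_tsum_of_isPreconnected (summable_weberMajorant R M) Metric.isOpen_ball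
    (convex_ball _ _).isPreconnected
    (g := fun n z => weberCoeff e α κ n * (((2 * n + e : ℕ) : ℂ) * z ^ (2 * n + e - 1)))
    (g' := g'') ?_ hb hz ?_ hz
  · intro n y _
    have := ((hasDerivAt_pow (2 * n + e - 1) y).const_mul ((2 * n + e : ℕ) : ℂ)).const_mul
      (weberCoeff e α κ n)
    simpa only [hg'', mul_assoc] using this
  · exact Summable.of_norm_bounded (summable_weberMajorant R M) fun n =>
      norm_weber_term_le he hM (by simp [M]) hR (mem_ball_zero_iff.1 hz).le n (norm_cast_mul_le he n)
        (by omega)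

lemma differentiable_weber_param {e : ℕ} (he : e ≤ 1) (α z : ℂ) (s : ℕ → ℂ) (m : ℕ → ℕ)
    (hs : ∀ n, ‖s n‖ ≤ 9 ^ n) (hm : ∀ n, m n ≤ 2 * n + e) :
    Differentiable ℂ (fun κ => ∑' n, weberCoeff e α κ n * (s n * z ^ m n)) := by
  intro κ₀
  have hz : ‖z‖ ≤ 1 + ‖z‖ := by linarith
  refine (Complex.differentiableOn_tsum_of_summable_norm
    (summable_weberMajorant (1 + ‖z‖) (1 + (‖α‖ + (1 + ‖κ₀‖)))) (fun n => ?_)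
    (Metric.isOpen_ball (x := (0 : ℂ)) (ε := 1 + ‖κ₀‖)) (fun n κ hκ => ?_)).differentiableAt
    (Metric.isOpen_ball.mem_nhds (by simp))
  · exact ((differentiable_weberCoeff e α n).mul_const _).differentiableOn
  · have := (mem_ball_zero_iff.1 hκ).le
    exact norm_weber_term_le he (by linarith [norm_nonneg α, norm_nonneg κ₀]) (by linarith)
      (by linarith [norm_nonneg z]) hz n (hs n) (hm n)

lemma differentiable_weberSol {e : ℕ} (he : e ≤ 1) (α z : ℂ) :
    Differentiable ℂ (fun κ => weberSol e α κ z) := by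
  have := differentiable_weber_param he α z (fun _ => 1) (fun n => 2 * n + e)
    (fun n => by simpa using one_le_pow₀ (by norm_num)) (fun _ => le_rfl)
  simpa [weberSol] using this

lemma differentiable_weberSolDeriv {e : ℕ} (he : e ≤ 1) (α z : ℂ) :
    Differentiable ℂ (fun κ => weberSolDeriv e α κ z) :=
  differentiable_weber_param he α z (fun n => ((2 * n + e : ℕ) : ℂ)) (fun n => 2 * n + e - 1)
    (norm_cast_mul_le he) (fun _ => by omega)

/-- The equation has no first-order term, so the Wronskian is constant and is read off at 0. Its
value 1 makes the even and odd solutions a basis for every parameter. -/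
lemma weber_wronskian (α κ z : ℂ) :
    weberSol 0 α κ z * weberSolDeriv 1 α κ z - weberSolDeriv 0 α κ z * weberSol 1 α κ z = 1 := by
  have h : ∀ z, HasDerivAt (fun z => weberSol 0 α κ z * weberSolDeriv 1 α κ z -
      weberSolDeriv 0 α κ z * weberSol 1 α κ z) 0 z := fun z => by
    have := ((hasDerivAt_weberSol zero_le_one α κ z).mul
      (hasDerivAt_weberSolDeriv le_rfl α κ z)).sub
      ((hasDerivAt_weberSolDeriv zero_le_one α κ z).mul (hasDerivAt_weberSol le_rfl α κ z))
    convert! this using 1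
    ring
  have hc := is_const_of_deriv_eq_zero (fun z => (h z).differentiableAt) (fun z => (h z).deriv) z 0
  have e0 : weberSol 0 α κ 0 = 1 := by
    rw [weberSol, tsum_eq_single 0]
    · simp [weberCoeff]
    · intro n hn
      simp [hn]
  have e1 : weberSol 1 α κ 0 = 0 := by simp [weberSol]
  have e2 : weberSolDeriv 1 α κ 0 = 1 := by
    rw [weberSolDeriv, tsum_eq_single 0]
    · simp [weberCoeff]
    · intro n hn
      simp [hn]
  rw [hc, e0, e1, e2]
  ring

/-- The solution of `y'' = (α z² + κ) y` with `y (-1) = 0` and `y' (-1) = 1`. -/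
noncomputable def leftSol (α κ z : ℂ) : ℂ :=
  weberSol 0 α κ (-1) * weberSol 1 α κ z - weberSol 1 α κ (-1) * weberSol 0 α κ z

/-- The derivative of `leftSol`. -/
noncomputable def leftSolDeriv (α κ z : ℂ) : ℂ :=
  weberSol 0 α κ (-1) * weberSolDeriv 1 α κ z - weberSol 1 α κ (-1) * weberSolDeriv 0 α κ z

lemma leftSol_neg_one (α κ : ℂ) : leftSol α κ (-1) = 0 := by rw [leftSol]; ring

lemma leftSolDeriv_neg_one (α κ : ℂ) : leftSolDeriv α κ (-1) = 1 := by
  rw [leftSolDeriv]; linear_combination weber_wronskian α κ (-1)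

lemma hasDerivAt_leftSol (α κ z : ℂ) : HasDerivAt (leftSol α κ) (leftSolDeriv α κ z) z :=
  ((hasDerivAt_weberSol le_rfl α κ z).const_mul _).sub
    ((hasDerivAt_weberSol zero_le_one α κ z).const_mul _)

lemma hasDerivAt_leftSolDeriv (α κ z : ℂ) :
    HasDerivAt (leftSolDeriv α κ) ((α * z ^ 2 + κ) * leftSol α κ z) z := by
  have := ((hasDerivAt_weberSolDeriv le_rfl α κ z).const_mul (weberSol 0 α κ (-1))).sub
    ((hasDerivAt_weberSolDeriv zero_le_one α κ z).const_mul (weberSol 1 α κ (-1)))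
  convert! this using 1
  rw [leftSol]; ring

lemma differentiable_leftSol (α z : ℂ) : Differentiable ℂ (fun κ => leftSol α κ z) :=
  ((differentiable_weberSol zero_le_one α _).mul (differentiable_weberSol le_rfl α _)).sub
    ((differentiable_weberSol le_rfl α _).mul (differentiable_weberSol zero_le_one α _))

lemma differentiable_leftSolDeriv (α z : ℂ) : Differentiable ℂ (fun κ => leftSolDeriv α κ z) :=
  ((differentiable_weberSol zero_le_one α _).mul (differentiable_weberSolDeriv le_rfl α _)).sub
    ((differentiable_weberSol le_rfl α _).mul (differentiable_weberSolDeriv zero_le_one α _))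

/-! ### Perturbation of `F'' = lam² F` by a bounded potential. -/

lemma norm_cosh_mul_le {lam : ℂ} {s : ℝ} (hs : 0 ≤ s) :
    ‖Complex.cosh (lam * s)‖ ≤ Real.exp (|lam.re| * s) := by
  have h1 : ‖Complex.exp (lam * s)‖ ≤ Real.exp (|lam.re| * s) := by
    rw [Complex.norm_exp]; simp only [Complex.re_mul_ofReal]; gcongr; exact le_abs_self _
  have h2 : ‖Complex.exp (-(lam * s))‖ ≤ Real.exp (|lam.re| * s) := by
    rw [Complex.norm_exp, Complex.neg_re, Complex.re_mul_ofReal, ← neg_mul]; gcongr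
    exact neg_le_abs _
  rw [Complex.cosh, norm_div, RCLike.norm_ofNat, div_le_iff₀ (by norm_num)]
  linarith [norm_add_le (Complex.exp (lam * s)) (Complex.exp (-(lam * s)))]

lemma norm_sinh_mul_le {lam : ℂ} {s : ℝ} (hs : 0 ≤ s) :
    ‖Complex.sinh (lam * s)‖ ≤ Real.exp (|lam.re| * s) := by
  have h1 : ‖Complex.exp (lam * s)‖ ≤ Real.exp (|lam.re| * s) := by
    rw [Complex.norm_exp]; simp only [Complex.re_mul_ofReal]; gcongr; exact le_abs_self _
  have h2 : ‖Complex.exp (-(lam * s))‖ ≤ Real.exp (|lam.re| * s) := by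
    rw [Complex.norm_exp, Complex.neg_re, Complex.re_mul_ofReal, ← neg_mul]; gcongr
    exact neg_le_abs _
  rw [Complex.sinh, norm_div, RCLike.norm_ofNat, div_le_iff₀ (by norm_num)]
  linarith [norm_sub_le (Complex.exp (lam * s)) (Complex.exp (-(lam * s)))]

section Volterra

variable {lam : ℂ} {F F' g : ℝ → ℂ}

/-- Duhamel estimate for `F'' = (lam² + g) F`, `F 0 = 0`. -/
lemma norm_sub_sinh_le (hlam : lam ≠ 0) (hF : ∀ t ∈ Icc (0 : ℝ) 1, HasDerivWithinAt F (F' t) (Icc 0 1) t)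
    (hF' : ∀ t ∈ Icc (0 : ℝ) 1, HasDerivWithinAt F' ((lam ^ 2 + g t) * F t) (Icc 0 1) t)
    (hg : ∀ t ∈ Icc (0 : ℝ) 1, ‖g t‖ ≤ 1) (h0 : F 0 = 0) {M : ℝ} (hM0 : 0 ≤ M)
    (hM : ∀ t ∈ Icc (0 : ℝ) 1, ‖F t‖ ≤ M * Real.exp (|lam.re| * t)) {x : ℝ} (hx : x ∈ Icc (0 : ℝ) 1) :
    ‖F x - F' 0 * Complex.sinh (lam * x) / lam‖ ≤ M * Real.exp (|lam.re| * x) / ‖lam‖ := by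
  -- Variation of constants: `H` interpolates between the free evolution of the data at 0 and `F x`,
  -- and only `g` survives in its derivative. The mean value inequality then replaces the Duhamel
  -- integral.
  set H : ℝ → ℂ := fun s => Complex.sinh (lam * (x - s)) / lam * F' s +
    Complex.cosh (lam * (x - s)) * F s with hH
  have hsub : Icc 0 x ⊆ Icc (0 : ℝ) 1 := Icc_subset_Icc_right hx.2
  have hd : ∀ s ∈ Icc (0 : ℝ) x, HasDerivWithinAt H
      (Complex.sinh (lam * (x - s)) / lam * (g s * F s)) (Icc 0 x) s := by
    intro s hs
    have hl : HasDerivAt (fun s : ℝ => lam * ((x : ℂ) - s)) (-lam) s := by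
      have := ((Complex.ofRealCLM.hasDerivAt (x := s)).const_sub (x : ℂ)).const_mul lam
      simpa using this
    have h1 := (((Complex.hasDerivAt_sinh _).comp s hl).div_const lam).hasDerivWithinAt.mul ((hF' s (hsub hs)).mono hsub)
    have h2 := ((Complex.hasDerivAt_cosh _).comp s hl).hasDerivWithinAt.mul ((hF s (hsub hs)).mono hsub)
    convert! h1.add h2 using 1
    simp only [Function.comp_apply]
    field_simp
    ring
  have hb : ∀ s ∈ Icc (0 : ℝ) x, ‖Complex.sinh (lam * (x - s)) / lam * (g s * F s)‖ ≤
      M * Real.exp (|lam.re| * x) / ‖lam‖ := by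
    intro s hs
    have e1 : ‖Complex.sinh (lam * (x - s))‖ ≤ Real.exp (|lam.re| * (x - s)) := by
      have := norm_sinh_mul_le (lam := lam) (s := x - s) (by linarith [hs.2])
      simpa using this
    have e2 : Real.exp (|lam.re| * x) = Real.exp (|lam.re| * (x - s)) * Real.exp (|lam.re| * s) := by
      rw [← Real.exp_add]; ring_nf
    rw [norm_mul, norm_div, norm_mul, e2]
    calc _ ≤ Real.exp (|lam.re| * (x - s)) / ‖lam‖ * (1 * (M * Real.exp (|lam.re| * s))) := by
          gcongr
          · exact hg s (hsub hs)
          · exact hM s (hsub hs)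
      _ = _ := by ring
  have key := (convex_Icc 0 x).norm_image_sub_le_of_norm_hasDerivWithin_le hd hb
    (left_mem_Icc.2 hx.1) (right_mem_Icc.2 hx.1)
  have e1 : H x - H 0 = F x - F' 0 * Complex.sinh (lam * x) / lam := by
    simp only [hH, h0]; simp; ring
  rw [e1] at key
  refine key.trans ?_
  rw [sub_zero, Real.norm_of_nonneg hx.1]
  exact mul_le_of_le_one_right (by positivity) hx.2

/-- The same device with the Duhamel kernel differentiated at the endpoint 1. The factor 1/|lam| of
the kernel is lost, but it reappears in the bound on M found below. -/
lemma norm_deriv_sub_cosh_le (hF : ∀ t ∈ Icc (0 : ℝ) 1, HasDerivWithinAt F (F' t) (Icc 0 1) t)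
    (hF' : ∀ t ∈ Icc (0 : ℝ) 1, HasDerivWithinAt F' ((lam ^ 2 + g t) * F t) (Icc 0 1) t)
    (hg : ∀ t ∈ Icc (0 : ℝ) 1, ‖g t‖ ≤ 1) (h0 : F 0 = 0) {M : ℝ}
    (hM : ∀ t ∈ Icc (0 : ℝ) 1, ‖F t‖ ≤ M * Real.exp (|lam.re| * t)) :
    ‖F' 1 - F' 0 * Complex.cosh lam‖ ≤ M * Real.exp |lam.re| := by
  set H : ℝ → ℂ := fun s => Complex.cosh (lam * (1 - s)) * F' s +
    lam * Complex.sinh (lam * (1 - s)) * F s with hH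
  have hd : ∀ s ∈ Icc (0 : ℝ) 1, HasDerivWithinAt H
      (Complex.cosh (lam * (1 - s)) * (g s * F s)) (Icc 0 1) s := by
    intro s hs
    have hl : HasDerivAt (fun s : ℝ => lam * ((1 : ℂ) - s)) (-lam) s := by
      have := ((Complex.ofRealCLM.hasDerivAt (x := s)).const_sub (1 : ℂ)).const_mul lam
      simpa using this
    have h1 := ((Complex.hasDerivAt_cosh _).comp s hl).hasDerivWithinAt.mul (hF' s hs)
    have h2 := (((Complex.hasDerivAt_sinh _).comp s hl).const_mul lam).hasDerivWithinAt.mul (hF s hs)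
    convert! h1.add h2 using 1
    simp only [Function.comp_apply]
    ring
  have hb : ∀ s ∈ Icc (0 : ℝ) 1, ‖Complex.cosh (lam * (1 - s)) * (g s * F s)‖ ≤
      M * Real.exp |lam.re| := by
    intro s hs
    have e1 : ‖Complex.cosh (lam * (1 - s))‖ ≤ Real.exp (|lam.re| * (1 - s)) := by
      have := norm_cosh_mul_le (lam := lam) (s := 1 - s) (by linarith [hs.2])
      simpa using this
    have e2 : Real.exp |lam.re| = Real.exp (|lam.re| * (1 - s)) * Real.exp (|lam.re| * s) := by
      rw [← Real.exp_add]; ring_nf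
    rw [norm_mul, norm_mul, e2]
    calc _ ≤ Real.exp (|lam.re| * (1 - s)) * (1 * (M * Real.exp (|lam.re| * s))) := by
          gcongr
          · exact hg s hs
          · exact hM s hs
      _ = _ := by ring
  have key := (convex_Icc (0 : ℝ) 1).norm_image_sub_le_of_norm_hasDerivWithin_le hd hb
    (left_mem_Icc.2 zero_le_one) (right_mem_Icc.2 zero_le_one)
  have e1 : H 1 - H 0 = F' 1 - F' 0 * Complex.cosh lam := by
    simp only [hH, h0]; simp; ring
  rw [e1] at key
  simpa using key

/-- For the best M, the maximum of |F(t)| exp(-|Re lam| t), the Duhamel estimate at the maximum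
point gives M ≤ |F'(0)|/|lam| + M/|lam|, and |lam| ≥ 2 absorbs the last term. Both errors are then
of relative size 1/|lam|, which is O(h) in the application. -/
lemma volterra_estimate (hlam : 2 ≤ ‖lam‖) (hF : ∀ t ∈ Icc (0 : ℝ) 1, HasDerivWithinAt F (F' t) (Icc 0 1) t)
    (hF' : ∀ t ∈ Icc (0 : ℝ) 1, HasDerivWithinAt F' ((lam ^ 2 + g t) * F t) (Icc 0 1) t)
    (hg : ∀ t ∈ Icc (0 : ℝ) 1, ‖g t‖ ≤ 1) (h0 : F 0 = 0) :
    ‖F 1 * lam - F' 0 * Complex.sinh lam‖ ≤ 2 * ‖F' 0‖ * Real.exp |lam.re| / ‖lam‖ ∧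
    ‖F' 1 - F' 0 * Complex.cosh lam‖ ≤ 2 * ‖F' 0‖ * Real.exp |lam.re| / ‖lam‖ := by
  have hl0 : 0 < ‖lam‖ := by linarith
  have hlne : lam ≠ 0 := norm_pos_iff.1 hl0
  have hcont : ContinuousOn (fun t => ‖F t‖ * Real.exp (-(|lam.re| * t))) (Icc (0 : ℝ) 1) := by
    have : ContinuousOn F (Icc (0 : ℝ) 1) := fun t ht => (hF t ht).continuousWithinAt
    fun_prop
  obtain ⟨x, hx, hmax⟩ := isCompact_Icc.exists_isMaxOn (nonempty_Icc.2 zero_le_one) hcont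
  set M := ‖F x‖ * Real.exp (-(|lam.re| * x)) with hMdef
  have hM0 : 0 ≤ M := by positivity
  have hM : ∀ t ∈ Icc (0 : ℝ) 1, ‖F t‖ ≤ M * Real.exp (|lam.re| * t) := by
    intro t ht
    have := hmax ht
    simp only [mem_ofPred_eq] at this
    calc ‖F t‖ = ‖F t‖ * Real.exp (-(|lam.re| * t)) * Real.exp (|lam.re| * t) := by
          rw [mul_assoc, ← Real.exp_add]; simp
      _ ≤ _ := by gcongr
  have hFx : ‖F x‖ = M * Real.exp (|lam.re| * x) := by
    rw [hMdef, mul_assoc, ← Real.exp_add]; simp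
  have hMle : M ≤ 2 * ‖F' 0‖ / ‖lam‖ := by
    have h1 := norm_sub_sinh_le hlne hF hF' hg h0 hM0 hM hx
    have h2 := norm_sinh_mul_le (lam := lam) hx.1
    set X := Real.exp (|lam.re| * x) with hX
    have hX0 : 0 < X := Real.exp_pos _
    have h3 : ‖F x‖ ≤ ‖F' 0‖ * X / ‖lam‖ + M * X / ‖lam‖ := by
      calc ‖F x‖ = ‖F' 0 * Complex.sinh (lam * x) / lam + (F x - F' 0 * Complex.sinh (lam * x) / lam)‖ := by
            congr 1; ring
        _ ≤ _ := (norm_add_le _ _).trans (by rw [norm_div, norm_mul]; gcongr)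
    rw [hFx] at h3
    have h4 : M ≤ ‖F' 0‖ / ‖lam‖ + M / ‖lam‖ := by
      have : M * X ≤ (‖F' 0‖ / ‖lam‖ + M / ‖lam‖) * X := by
        calc _ ≤ _ := h3
          _ = _ := by ring
      exact le_of_mul_le_mul_right this hX0
    have h5 : M / ‖lam‖ ≤ M / 2 := by gcongr
    have h6 : 2 * ‖F' 0‖ / ‖lam‖ = 2 * (‖F' 0‖ / ‖lam‖) := by ring
    rw [h6]; linarith
  constructor
  · have := norm_sub_sinh_le hlne hF hF' hg h0 hM0 hM (right_mem_Icc.2 zero_le_one)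
    simp only [Complex.ofReal_one, mul_one] at this
    have e : F 1 * lam - F' 0 * Complex.sinh lam = (F 1 - F' 0 * Complex.sinh lam / lam) * lam := by
      field_simp
    rw [e, norm_mul]
    calc _ ≤ M * Real.exp |lam.re| / ‖lam‖ * ‖lam‖ := by gcongr
      _ = M * Real.exp |lam.re| := by field_simp
      _ ≤ 2 * ‖F' 0‖ / ‖lam‖ * Real.exp |lam.re| := by gcongr
      _ = _ := by ring
  · refine (norm_deriv_sub_cosh_le hF hF' hg h0 hM).trans ?_
    calc _ ≤ 2 * ‖F' 0‖ / ‖lam‖ * Real.exp |lam.re| := by gcongr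
      _ = _ := by ring

end Volterra

/-! ### Momentum, amplitude and the complex path with linear phase. -/

/-- The normalized radicand `1 - i z² / E`, so that `i z² - E = -E * radicand E z`. -/
noncomputable def radicand (E z : ℂ) : ℂ := 1 - Complex.I * z ^ 2 / E

/-- The normalized momentum. -/
noncomputable def momentum (E z : ℂ) : ℂ := radicand E z ^ (1 / 2 : ℂ)

/-- The square root of the normalized momentum. -/
noncomputable def amplitude (E z : ℂ) : ℂ := radicand E z ^ (1 / 4 : ℂ)

/-- The normalized action integral over `[-1, b]`. -/
noncomputable def action (b : ℝ) (E : ℂ) : ℂ := ∫ t in (-1 : ℝ)..b, momentum E t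

/-- The deviation is at most 8²/1000. In the disc of radius 8 there is hence no turning point, and
the principal powers of the radicand are holomorphic. -/
lemma norm_radicand_sub_one_le {E z : ℂ} (hE : 1000 ≤ ‖E‖) (hz : ‖z‖ ≤ 8) :
    ‖radicand E z - 1‖ ≤ 8 / 125 := by
  have : radicand E z - 1 = -(Complex.I * z ^ 2 / E) := by rw [radicand]; ring
  rw [this, norm_neg, norm_div, norm_mul, Complex.norm_I, one_mul, norm_pow,
    div_le_iff₀ (by linarith)]
  nlinarith [norm_nonneg z]

lemma radicand_mem_slitPlane {E z : ℂ} (hE : 1000 ≤ ‖E‖) (hz : ‖z‖ ≤ 8) :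
    radicand E z ∈ Complex.slitPlane := by
  left
  have := (Complex.abs_re_le_norm _).trans (norm_radicand_sub_one_le hE hz)
  rw [Complex.sub_re, Complex.one_re, abs_le] at this
  linarith [this.1]

lemma radicand_ne_zero {E z : ℂ} (hE : 1000 ≤ ‖E‖) (hz : ‖z‖ ≤ 8) : radicand E z ≠ 0 :=
  Complex.slitPlane_ne_zero (radicand_mem_slitPlane hE hz)

lemma le_norm_radicand {E z : ℂ} (hE : 1000 ≤ ‖E‖) (hz : ‖z‖ ≤ 8) : 9 / 10 ≤ ‖radicand E z‖ := by
  have h := norm_radicand_sub_one_le hE hz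
  have := norm_sub_norm_le (1 : ℂ) (1 - radicand E z)
  rw [sub_sub_cancel, norm_one, norm_sub_rev] at this
  linarith

lemma momentum_sq (E z : ℂ) : momentum E z ^ 2 = radicand E z := by
  rw [momentum, ← Complex.cpow_nat_mul]; simp

lemma amplitude_sq (E z : ℂ) : amplitude E z ^ 2 = momentum E z := by
  rw [amplitude, momentum, ← Complex.cpow_nat_mul]; norm_num

lemma amplitude_ne_zero {E z : ℂ} (hE : 1000 ≤ ‖E‖) (hz : ‖z‖ ≤ 8) : amplitude E z ≠ 0 := by
  intro h
  apply radicand_ne_zero hE hz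
  rw [← momentum_sq, ← amplitude_sq, h]; simp

lemma momentum_ne_zero {E z : ℂ} (hE : 1000 ≤ ‖E‖) (hz : ‖z‖ ≤ 8) : momentum E z ≠ 0 := by
  rw [← amplitude_sq]; exact pow_ne_zero _ (amplitude_ne_zero hE hz)

lemma cpow_half_re_nonneg (w : ℂ) : 0 ≤ (w ^ (1 / 2 : ℂ)).re := by
  rcases eq_or_ne w 0 with rfl | hw
  · simp
  · rw [Complex.cpow_def_of_ne_zero hw, Complex.exp_re]
    refine mul_nonneg (Real.exp_pos _).le ?_
    have h : (Complex.log w * (1 / 2)).im = w.arg / 2 := by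
      rw [show Complex.log w * (1 / 2) = Complex.log w / 2 by ring]
      simp [Complex.log_im]
    rw [h]
    exact Real.cos_nonneg_of_neg_pi_div_two_le_of_le (by linarith [Complex.neg_pi_lt_arg w])
      (by linarith [Complex.arg_le_pi w])

/-- Factor m² - 1 = (m-1)(m+1); the principal root has nonnegative real part, so |m+1| ≥ 1. -/
lemma norm_momentum_sub_one_le_radicand (E z : ℂ) :
    ‖momentum E z - 1‖ ≤ ‖radicand E z - 1‖ := by
  have h1 : radicand E z - 1 = (momentum E z - 1) * (momentum E z + 1) := by
    rw [← momentum_sq]; ring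
  rw [h1, norm_mul]
  have h2 : 1 ≤ ‖momentum E z + 1‖ := by
    refine le_trans ?_ (Complex.re_le_norm _)
    rw [Complex.add_re, Complex.one_re]
    have : 0 ≤ (momentum E z).re := cpow_half_re_nonneg _
    linarith
  exact le_mul_of_one_le_right (norm_nonneg _) h2

lemma norm_momentum_sub_one_le {E z : ℂ} (hE : 1000 ≤ ‖E‖) (hz : ‖z‖ ≤ 8) :
    ‖momentum E z - 1‖ ≤ 1 / 10 :=
  (norm_momentum_sub_one_le_radicand E z).trans
    ((norm_radicand_sub_one_le hE hz).trans (by norm_num))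

lemma hasDerivAt_radicand (E z : ℂ) :
    HasDerivAt (radicand E) (-(2 * Complex.I * z / E)) z := by
  have := (((hasDerivAt_pow 2 z).const_mul Complex.I).div_const E).const_sub 1
  convert! this using 1
  push_cast; ring

lemma differentiableAt_momentum {E z : ℂ} (hE : 1000 ≤ ‖E‖) (hz : ‖z‖ ≤ 8) :
    DifferentiableAt ℂ (momentum E) z :=
  ((hasDerivAt_radicand E z).cpow_const (radicand_mem_slitPlane hE hz)).differentiableAt

/-- The logarithmic derivative of the amplitude. -/
noncomputable def amplitudeLog (E z : ℂ) : ℂ := -(Complex.I * z / (2 * E)) / radicand E z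

lemma hasDerivAt_amplitude {E z : ℂ} (hE : 1000 ≤ ‖E‖) (hz : ‖z‖ ≤ 8) :
    HasDerivAt (amplitude E) (amplitudeLog E z * amplitude E z) z := by
  have h0 := radicand_ne_zero hE hz
  have := (hasDerivAt_radicand E z).cpow_const (c := 1 / 4) (radicand_mem_slitPlane hE hz)
  convert! this using 1
  rw [Complex.cpow_sub _ _ h0, Complex.cpow_one, ← amplitude, amplitudeLog]
  ring

lemma hasDerivAt_amplitudeLog {E z : ℂ} (hE : 1000 ≤ ‖E‖) (hz : ‖z‖ ≤ 8) :
    HasDerivAt (amplitudeLog E) (-(Complex.I / (2 * E)) / radicand E z +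
      z ^ 2 / (E ^ 2 * radicand E z ^ 2)) z := by
  have h0 := radicand_ne_zero hE hz
  have hE0 : E ≠ 0 := norm_pos_iff.1 (by linarith)
  have h1 : HasDerivAt (fun z : ℂ => -(Complex.I * z / (2 * E))) (-(Complex.I / (2 * E))) z := by
    have := (((hasDerivAt_id' z).const_mul Complex.I).div_const (2 * E)).neg
    rw [mul_one] at this
    exact this
  convert! h1.div (hasDerivAt_radicand E z) h0 using 1
  field_simp
  linear_combination (2 * z ^ 2) * Complex.I_sq

lemma norm_amplitudeLog_le {E z : ℂ} (hE : 1000 ≤ ‖E‖) (hz : ‖z‖ ≤ 8) :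
    ‖amplitudeLog E z‖ ≤ 1 / 100 := by
  have h := le_norm_radicand hE hz
  rw [amplitudeLog, norm_div, norm_neg, norm_div, norm_mul, norm_mul, Complex.norm_I, one_mul,
    RCLike.norm_ofNat, div_le_iff₀ (by linarith), div_le_iff₀ (by linarith)]
  nlinarith

/-- A path along which the action grows linearly. -/
lemma exists_action_path {E : ℂ} (hE : 1000 ≤ ‖E‖) {b : ℝ} (hb : b ∈ Ioc (-1 : ℝ) 1) :
    ‖action b E - (b + 1)‖ ≤ 1 / 10 * (b + 1) ∧ ∃ z : ℝ → ℂ, z 0 = -1 ∧ z 1 = b ∧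
      ∀ t ∈ Icc (0 : ℝ) 1, ‖z t‖ ≤ 8 ∧ HasDerivAt z (action b E / momentum E (z t)) t := by
  have hball : ∀ z ∈ Metric.ball (0 : ℂ) 8, ‖z‖ ≤ 8 := fun z hz => (mem_ball_zero_iff.1 hz).le
  have hdiff : DifferentiableOn ℂ (momentum E) (Metric.ball 0 8) := fun z hz =>
    (differentiableAt_momentum hE (hball z hz)).differentiableWithinAt
  obtain ⟨S, hS0, hS⟩ := hdiff.isExactOn_ball.with_val_at (-1) 0
  have hreal : ∀ t ∈ Icc (-1 : ℝ) 1, (t : ℂ) ∈ Metric.ball (0 : ℂ) 8 := fun t ht => by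
    rw [mem_ball_zero_iff, Complex.norm_real, Real.norm_eq_abs]
    exact (abs_le.2 ht).trans_lt (by norm_num)
  have hSb : S b = action b E := by
    have hsub : uIcc (-1) b ⊆ Icc (-1 : ℝ) 1 := by
      rw [uIcc_of_le hb.1.le]; exact Icc_subset_Icc_right hb.2
    rw [action, intervalIntegral.integral_eq_sub_of_hasDerivAt (f := fun t : ℝ => S t)]
    · simp [hS0]
    · intro t ht
      exact (hS _ (hreal t (hsub ht))).comp_ofReal
    · apply ContinuousOn.intervalIntegrable
      intro t ht
      exact ((differentiableAt_momentum hE (hball _ (hreal t (hsub ht)))).continuousAt.comp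
        Complex.continuous_ofReal.continuousAt).continuousWithinAt
  -- The momentum is within 1/10 of 1, so its primitive S is a perturbation of the identity and can
  -- be inverted. The path is the preimage of the straight segment from 0 to the action; along it
  -- the phase is linear, so the transformed equation has a constant `lam` and no monotonicity of
  -- the phase on the real segment is required.
  have happ : ApproximatesLinearOn S (ContinuousLinearEquiv.refl ℂ ℂ : ℂ →L[ℂ] ℂ)
      (Metric.ball 0 8) (1 / 10) := by
    intro x hx y hy
    have hd : ∀ w ∈ Metric.ball (0 : ℂ) 8,
        HasDerivWithinAt (fun w => S w - w) (momentum E w - 1) (Metric.ball 0 8) w :=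
      fun w hw => ((hS w hw).sub (hasDerivAt_id w)).hasDerivWithinAt
    have := (convex_ball (0 : ℂ) 8).norm_image_sub_le_of_norm_hasDerivWithin_le hd
      (fun w hw => norm_momentum_sub_one_le hE (hball w hw)) hy hx
    convert! this using 2
    · simp; ring
  have hbmem := hreal b ⟨hb.1.le, hb.2⟩
  have hmmem : (-1 : ℂ) ∈ Metric.ball (0 : ℂ) 8 := by
    simp
  have hnorm : ‖action b E - (b + 1)‖ ≤ 1 / 10 * (b + 1) := by
    have := happ b hbmem (-1) hmmem
    rw [hSb, hS0] at this
    have e : ‖(b : ℂ) - -1‖ = b + 1 := by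
      rw [sub_neg_eq_add, ← Complex.ofReal_one, ← Complex.ofReal_add, Complex.norm_real,
        Real.norm_of_nonneg (by linarith [hb.1])]
    rw [e] at this
    rw [sub_zero, sub_neg_eq_add] at this
    simpa using this
  refine ⟨hnorm, ?_⟩
  have hc : Subsingleton ℂ ∨ (1 / 10 : NNReal) <
      ‖((ContinuousLinearEquiv.refl ℂ ℂ).symm : ℂ →L[ℂ] ℂ)‖₊⁻¹ := by
    right
    have : ‖((ContinuousLinearEquiv.refl ℂ ℂ).symm : ℂ →L[ℂ] ℂ)‖₊ = 1 := by
      rw [ContinuousLinearEquiv.refl_symm, ContinuousLinearEquiv.coe_refl]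
      exact ContinuousLinearMap.nnnorm_id
    rw [this]
    rw [← NNReal.coe_lt_coe]
    norm_num
  set e := happ.toOpenPartialHomeomorph S (Metric.ball 0 8) hc Metric.isOpen_ball with he
  -- The radii are chosen so that the disc of radius 6 about -1 lies in the disc of radius 8, while
  -- its image contains the disc of radius (1 - 1/10)·6 about 0; this exceeds 3, a bound for the
  -- action.
  have hcb : Metric.closedBall (-1 : ℂ) 6 ⊆ Metric.ball 0 8 := by
    intro x hx
    rw [mem_closedBall_iff_norm] at hx
    rw [mem_ball_zero_iff]
    calc ‖x‖ = ‖(x - -1) + -1‖ := by congr 1; ring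
      _ ≤ ‖x - -1‖ + ‖(-1 : ℂ)‖ := norm_add_le _ _
      _ < 8 := by rw [norm_neg, norm_one]; linarith
  have htarget : ∀ t ∈ Icc (0 : ℝ) 1, (t : ℂ) * action b E ∈ e.target := by
    intro t ht
    apply happ.closedBall_subset_target hc Metric.isOpen_ball (by norm_num : (0 : ℝ) ≤ 6) hcb
    have : ‖((ContinuousLinearEquiv.refl ℂ ℂ).symm : ℂ →L[ℂ] ℂ)‖₊ = 1 := by
      rw [ContinuousLinearEquiv.refl_symm, ContinuousLinearEquiv.coe_refl]
      exact ContinuousLinearMap.nnnorm_id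
    rw [hS0, this, mem_closedBall_zero_iff, norm_mul, Complex.norm_real, Real.norm_of_nonneg ht.1]
    have h2 : ‖action b E‖ ≤ 3 := by
      have e : ‖((b : ℂ) + 1)‖ = b + 1 := by
        rw [← Complex.ofReal_one, ← Complex.ofReal_add, Complex.norm_real,
          Real.norm_of_nonneg (by linarith [hb.1])]
      have := norm_le_norm_sub_add (action b E) (b + 1)
      linarith [hb.2]
    calc t * ‖action b E‖ ≤ 1 * 3 := mul_le_mul ht.2 h2 (norm_nonneg _) zero_le_one
      _ ≤ _ := by norm_num
  refine ⟨fun t => e.symm (t * action b E), ?_, ?_, fun t ht => ?_⟩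
  · have : e.symm (e (-1)) = -1 := e.left_inv hmmem
    rw [← this]
    rw [he, ApproximatesLinearOn.toOpenPartialHomeomorph_coe, hS0]
    simp
  · have : e.symm (e b) = b := e.left_inv hbmem
    rw [← this]
    rw [he, ApproximatesLinearOn.toOpenPartialHomeomorph_coe, hSb]
    simp
  · have hmem : e.symm (t * action b E) ∈ Metric.ball (0 : ℂ) 8 := e.map_target (htarget t ht)
    refine ⟨hball _ hmem, ?_⟩
    have h1 : HasDerivAt e.symm (momentum E (e.symm (t * action b E)))⁻¹ (t * action b E) :=
      e.hasDerivAt_symm (htarget t ht) (momentum_ne_zero hE (hball _ hmem)) (hS _ hmem)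
    have h2 : HasDerivAt (fun t : ℝ => (t : ℂ) * action b E) (action b E) t := by
      simpa using (Complex.ofRealCLM.hasDerivAt (x := t)).mul_const (action b E)
    have := h1.comp t h2
    convert! this using 1
    rw [div_eq_mul_inv, mul_comm]

lemma norm_real_add_one {b : ℝ} (hb : -1 < b) : ‖((b : ℂ) + 1)‖ = b + 1 := by
  rw [← Complex.ofReal_one, ← Complex.ofReal_add, Complex.norm_real,
    Real.norm_of_nonneg (by linarith)]

lemma norm_action_le {E : ℂ} (hE : 1000 ≤ ‖E‖) {b : ℝ} (hb : b ∈ Ioc (-1 : ℝ) 1) :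
    ‖action b E‖ ≤ 11 / 10 * (b + 1) := by
  have h := (exists_action_path hE hb).1
  have := norm_le_norm_sub_add (action b E) (b + 1)
  rw [norm_real_add_one hb.1] at this
  linarith

lemma le_norm_action {E : ℂ} (hE : 1000 ≤ ‖E‖) {b : ℝ} (hb : b ∈ Ioc (-1 : ℝ) 1) :
    9 / 10 * (b + 1) ≤ ‖action b E‖ := by
  have h := (exists_action_path hE hb).1
  have := norm_sub_norm_le ((b : ℂ) + 1) (action b E)
  rw [norm_real_add_one hb.1, norm_sub_rev] at this
  linarith

/-- This is the extra potential produced by the Liouville transformation; each of its terms carries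
a power of 1/E. The bound 1/100 survives multiplication by the squared action, which is at most 9.
-/
lemma norm_liouville_potential_le {E z : ℂ} (hE : 1000 ≤ ‖E‖) (hz : ‖z‖ ≤ 8) :
    ‖(-(Complex.I / (2 * E)) / radicand E z + z ^ 2 / (E ^ 2 * radicand E z ^ 2)
      - amplitudeLog E z ^ 2) / radicand E z‖ ≤ 1 / 100 := by
  have hw := le_norm_radicand hE hz
  have hm := norm_amplitudeLog_le hE hz
  have hm2 : ‖amplitudeLog E z‖ ^ 2 ≤ 1 / 10000 := by nlinarith [norm_nonneg (amplitudeLog E z)]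
  rw [norm_div, div_le_iff₀ (by linarith)]
  have h1 : ‖-(Complex.I / (2 * E)) / radicand E z‖ ≤ 1 / 1000 := by
    rw [norm_div, norm_neg, norm_div, norm_mul, Complex.norm_I, RCLike.norm_ofNat, div_div,
      div_le_div_iff₀ (by positivity) (by norm_num)]
    nlinarith
  have h2 : ‖z ^ 2 / (E ^ 2 * radicand E z ^ 2)‖ ≤ 1 / 1000 := by
    rw [norm_div, norm_mul, norm_pow, norm_pow, norm_pow,
      div_le_div_iff₀ (by positivity) (by norm_num)]
    have a1 : ‖z‖ ^ 2 ≤ 64 := by nlinarith [norm_nonneg z]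
    have a2 : 1000000 ≤ ‖E‖ ^ 2 := by nlinarith
    have a3 : 1 / 2 ≤ ‖radicand E z‖ ^ 2 := by nlinarith
    nlinarith
  have h3 : ‖-(Complex.I / (2 * E)) / radicand E z + z ^ 2 / (E ^ 2 * radicand E z ^ 2)
      - amplitudeLog E z ^ 2‖ ≤ 1 / 1000 + 1 / 1000 + 1 / 10000 := by
    refine (norm_sub_le _ _).trans (add_le_add ((norm_add_le _ _).trans (add_le_add h1 h2)) ?_)
    rwa [norm_pow]
  linarith

/-! ### WKB approximation of the Dirichlet solution, uniform in the energy. -/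

/-- The normalization factor of the Dirichlet solution in the WKB approximation. -/
noncomputable def wkbNormal (b : ℝ) (E k : ℂ) : ℂ :=
  Complex.I * k * amplitude E (-1) * amplitude E b

/-- The solution of `-h² u'' + i x² u = E u`, `u (-1) = 0`, `u' (-1) = 1`. -/
noncomputable def shootSol (h : ℝ) (E z : ℂ) : ℂ :=
  leftSol (Complex.I / (h : ℂ) ^ 2) (-E / (h : ℂ) ^ 2) z

/-- The derivative of `shootSol`. -/
noncomputable def shootDeriv (h : ℝ) (E z : ℂ) : ℂ :=
  leftSolDeriv (Complex.I / (h : ℂ) ^ 2) (-E / (h : ℂ) ^ 2) z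

/-- In the variable t of the linear-phase path, amplitude times solution satisfies `F'' = (lam² + g)
F` with `lam` = ikJ/h and |g| ≤ 1, so `volterra_estimate` applies. The condition on h ensures |lam|
≥ 2, because |J| ≥ (9/10)(b+1). -/
lemma wkb_estimate {E k : ℂ} (hE : 1000 ≤ ‖E‖) {b : ℝ} (hb : b ∈ Ioc (-1 : ℝ) 1) (hk : k ^ 2 = E)
    {h : ℝ} (h0 : 0 < h) (hh : h ≤ (b + 1) / 4) :
    ‖wkbNormal b E k * shootSol h E b / h - Complex.sinh (Complex.I * k * action b E / h)‖ ≤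
      4 / (b + 1) * h * Real.exp |(Complex.I * k * action b E / h).re| ∧
    ‖wkbNormal b E k * shootDeriv h E b -
      Complex.I * k * momentum E b * Complex.cosh (Complex.I * k * action b E / h)‖ ≤
      8 / (b + 1) * h * Real.exp |(Complex.I * k * action b E / h).re| := by
  obtain ⟨-, z, hz0, hz1, hz⟩ := exists_action_path hE hb
  have hb1 : 0 < b + 1 := by linarith [hb.1]
  have hJ1 := norm_action_le hE hb
  have hJ2 := le_norm_action hE hb
  set J := action b E with hJ
  have hJ0 : J ≠ 0 := norm_pos_iff.1 (by linarith)
  have hE0 : E ≠ 0 := norm_pos_iff.1 (by linarith)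
  have hhc : (h : ℂ) ≠ 0 := by exact_mod_cast h0.ne'
  have hkn : 1 ≤ ‖k‖ := by
    have : ‖k‖ ^ 2 = ‖E‖ := by rw [← norm_pow, hk]
    nlinarith [norm_nonneg k]
  have hk0 : k ≠ 0 := norm_pos_iff.1 (by linarith)
  set lam := Complex.I * k * J / h with hlam
  have hlamn : ‖lam‖ = ‖k‖ * ‖J‖ / h := by
    rw [hlam, norm_div, norm_mul, norm_mul, Complex.norm_I, Complex.norm_real,
      Real.norm_of_nonneg h0.le, one_mul]
  have hlam2 : 2 ≤ ‖lam‖ := by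
    rw [hlamn, le_div_iff₀ h0]; nlinarith
  set e := Real.exp |lam.re| with he
  have he0 : 0 < e := Real.exp_pos _
  -- Since dz/dt = J/momentum and the momentum is the square of the amplitude, this factor removes
  -- the first-order term of the transformed equation.
  set F : ℝ → ℂ := fun t => amplitude E (z t) * shootSol h E (z t) with hF
  set F' : ℝ → ℂ := fun t => J *
    ((amplitudeLog E (z t) * shootSol h E (z t) + shootDeriv h E (z t)) / amplitude E (z t)) with hF'
  set g : ℝ → ℂ := fun t => J ^ 2 * ((-(Complex.I / (2 * E)) / radicand E (z t) +
      z t ^ 2 / (E ^ 2 * radicand E (z t) ^ 2) - amplitudeLog E (z t) ^ 2) / radicand E (z t)) with hg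
  have hsol : ∀ y, HasDerivAt (shootSol h E) (shootDeriv h E y) y := fun y => hasDerivAt_leftSol _ _ y
  have hsol' : ∀ y, HasDerivAt (shootDeriv h E)
      (-(E / (h : ℂ) ^ 2) * radicand E y * shootSol h E y) y := fun y => by
    have := hasDerivAt_leftSolDeriv (Complex.I / (h : ℂ) ^ 2) (-E / (h : ℂ) ^ 2) y
    convert! this using 1
    rw [radicand, shootSol]; field_simp; ring
  have hd1 : ∀ t ∈ Icc (0 : ℝ) 1, HasDerivWithinAt F (F' t) (Icc 0 1) t := by
    intro t ht
    obtain ⟨hzt, hzd⟩ := hz t ht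
    have hq0 := amplitude_ne_zero hE hzt
    have := (((hasDerivAt_amplitude hE hzt).mul (hsol (z t))).comp t hzd).hasDerivWithinAt (s := Icc 0 1)
    convert! this using 1
    simp only [hF', ← amplitude_sq]
    field_simp
  have hd2 : ∀ t ∈ Icc (0 : ℝ) 1, HasDerivWithinAt F' ((lam ^ 2 + g t) * F t) (Icc 0 1) t := by
    intro t ht
    obtain ⟨hzt, hzd⟩ := hz t ht
    have hq0 := amplitude_ne_zero hE hzt
    have hr0 := radicand_ne_zero hE hzt
    have := (((((hasDerivAt_amplitudeLog hE hzt).mul (hsol (z t))).add (hsol' (z t))).div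
      (hasDerivAt_amplitude hE hzt) hq0).const_mul J).comp t hzd |>.hasDerivWithinAt (s := Icc 0 1)
    convert! this using 1
    have hw : radicand E (z t) = amplitude E (z t) ^ 4 := by
      rw [← momentum_sq, ← amplitude_sq]; ring
    have hlam' : lam ^ 2 = -(E / (h : ℂ) ^ 2) * J ^ 2 := by
      rw [hlam, ← hk, div_pow, mul_pow, mul_pow, Complex.I_sq]; ring
    simp only [hF, hg, hlam', hw, ← amplitude_sq, Pi.add_apply, Pi.mul_apply]
    field_simp
    ring
  have hgle : ∀ t ∈ Icc (0 : ℝ) 1, ‖g t‖ ≤ 1 := by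
    intro t ht
    have := norm_liouville_potential_le hE (hz t ht).1
    simp only [hg]
    rw [norm_mul, norm_pow]
    have hJ3 : ‖J‖ ≤ 3 := by linarith [hb.2]
    have hJ4 : ‖J‖ ^ 2 ≤ 9 := by nlinarith [norm_nonneg J]
    calc _ ≤ 9 * (1 / 100 : ℝ) := by gcongr
      _ ≤ 1 := by norm_num
  have hF0 : F 0 = 0 := by simp [hF, hz0, shootSol, leftSol_neg_one]
  have hbn : ‖(b : ℂ)‖ ≤ 8 := by simpa [hz1] using (hz 1 (by norm_num)).1
  have hmn : ‖(-1 : ℂ)‖ ≤ 8 := by norm_num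
  have hq1 := amplitude_ne_zero hE hmn
  have hqb := amplitude_ne_zero hE hbn
  have hF'0 : F' 0 = J / amplitude E (-1) := by
    simp [hF', hz0, shootSol, shootDeriv, leftSol_neg_one, leftSolDeriv_neg_one, div_eq_mul_inv]
  obtain ⟨v1, v2⟩ := volterra_estimate hlam2 hd1 hd2 hgle hF0
  have hF'0n : 0 < ‖F' 0‖ := by rw [hF'0]; exact norm_pos_iff.2 (div_ne_zero hJ0 hq1)
  have c1 : ‖wkbNormal b E k * shootSol h E b / h - Complex.sinh lam‖ ≤ 2 * e / ‖lam‖ := by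
    have e1 : F 1 * lam - F' 0 * Complex.sinh lam =
        F' 0 * (wkbNormal b E k * shootSol h E b / h - Complex.sinh lam) := by
      simp only [hF, hz1, hF'0, hlam, wkbNormal]
      field_simp
    rw [e1, norm_mul] at v1
    refine le_of_mul_le_mul_left (v1.trans (le_of_eq ?_)) hF'0n
    ring
  have c2 : ‖amplitude E (-1) * ((amplitudeLog E b * shootSol h E b + shootDeriv h E b) /
      amplitude E b) - Complex.cosh lam‖ ≤ 2 * e / ‖lam‖ := by
    have e1 : F' 1 - F' 0 * Complex.cosh lam =
        F' 0 * (amplitude E (-1) * ((amplitudeLog E b * shootSol h E b + shootDeriv h E b) /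
      amplitude E b) - Complex.cosh lam) := by
      simp only [hF'0]
      simp only [hF', hz1]
      field_simp
    rw [e1, norm_mul] at v2
    refine le_of_mul_le_mul_left (v2.trans (le_of_eq ?_)) hF'0n
    ring
  -- The factor 1/|k| is kept because the derivative estimate multiplies this error by the end
  -- momentum, which is of size |k|; the final constants then do not depend on E.
  have hinv : 2 * e / ‖lam‖ ≤ 3 / (b + 1) * h * e / ‖k‖ := by
    rw [hlamn]
    have hJp : 0 < ‖J‖ := by linarith
    have hkp : 0 < ‖k‖ := by linarith
    rw [show 2 * e / (‖k‖ * ‖J‖ / h) = 2 / ‖J‖ * (h * e / ‖k‖) by field_simp,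
      show 3 / (b + 1) * h * e / ‖k‖ = 3 / (b + 1) * (h * e / ‖k‖) by ring]
    gcongr ?_ * _
    rw [div_le_div_iff₀ hJp hb1]
    linarith
  have hhe : 0 ≤ h * e / (b + 1) := by positivity
  have hinv' : 3 / (b + 1) * h * e / ‖k‖ ≤ 3 * (h * e / (b + 1)) := by
    rw [show 3 / (b + 1) * h * e / ‖k‖ = 3 * (h * e / (b + 1)) / ‖k‖ by ring]
    exact div_le_self (by positivity) hkn
  constructor
  · calc _ ≤ 2 * e / ‖lam‖ := c1
      _ ≤ 3 * (h * e / (b + 1)) := hinv.trans hinv'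
      _ ≤ 4 * (h * e / (b + 1)) := by linarith
      _ = _ := by ring
  · have hsinh : ‖Complex.sinh lam‖ ≤ e := by
      simpa using norm_sinh_mul_le (lam := lam) (s := 1) zero_le_one
    have hle : 2 * e / ‖lam‖ ≤ e := by
      rw [div_le_iff₀ (by linarith)]; nlinarith
    have hX : ‖wkbNormal b E k * shootSol h E b / h‖ ≤ 2 * e := by
      have := norm_le_norm_sub_add (wkbNormal b E k * shootSol h E b / h) (Complex.sinh lam)
      linarith
    have hmb := norm_amplitudeLog_le hE hbn
    have hrb : ‖momentum E b‖ ≤ 11 / 10 := by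
      have := norm_le_norm_sub_add (momentum E b) 1
      have h2 := norm_momentum_sub_one_le hE hbn
      rw [norm_one] at this; linarith
    -- The last term comes from the derivative of the amplitude; it carries an explicit h and is
    -- part of the error.
    have e3 : wkbNormal b E k * shootDeriv h E b - Complex.I * k * momentum E b * Complex.cosh lam =
        Complex.I * k * momentum E b * (amplitude E (-1) * ((amplitudeLog E b * shootSol h E b +
          shootDeriv h E b) / amplitude E b) - Complex.cosh lam) -
        h * amplitudeLog E b * (wkbNormal b E k * shootSol h E b / h) := by
      simp only [wkbNormal, ← amplitude_sq]
      field_simp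
      ring
    rw [e3]
    have t1 : ‖Complex.I * k * momentum E b * (amplitude E (-1) * ((amplitudeLog E b * shootSol h E b +
          shootDeriv h E b) / amplitude E b) - Complex.cosh lam)‖ ≤ 11 / 10 * (3 * (h * e / (b + 1))) := by
      rw [norm_mul, norm_mul, norm_mul, Complex.norm_I, one_mul]
      have hkp : 0 < ‖k‖ := by linarith
      calc _ ≤ ‖k‖ * (11 / 10) * (3 / (b + 1) * h * e / ‖k‖) := by
            gcongr
            exact c2.trans hinv
        _ = _ := by field_simp
    have t2 : ‖h * amplitudeLog E b * (wkbNormal b E k * shootSol h E b / h)‖ ≤ h * e / (b + 1) := by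
      rw [norm_mul, norm_mul, Complex.norm_real, Real.norm_of_nonneg h0.le]
      calc _ ≤ h * (1 / 100) * (2 * e) := by gcongr
        _ = (h * e) * (1 / 50) := by ring
        _ ≤ (h * e) * (1 / (b + 1)) := by
          gcongr
          linarith [hb.2]
        _ = _ := by ring
    calc _ ≤ 11 / 10 * (3 * (h * e / (b + 1))) + h * e / (b + 1) := (norm_sub_le _ _).trans (add_le_add t1 t2)
      _ ≤ 8 * (h * e / (b + 1)) := by linarith
      _ = _ := by ring

/-! ### Action curves as preimages of a half line under a holomorphic map. -/

lemma norm_ofReal_le_eight {b t : ℝ} (hb : b ∈ Ioc (-1 : ℝ) 1) (ht : t ∈ uIcc (-1) b) :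
    ‖(t : ℂ)‖ ≤ 8 := by
  rw [uIcc_of_le hb.1.le] at ht
  rw [Complex.norm_real, Real.norm_eq_abs]
  exact (abs_le.2 ⟨ht.1, ht.2.trans hb.2⟩).trans (by norm_num)

lemma norm_ofReal_le_one {b t : ℝ} (hb : b ∈ Ioc (-1 : ℝ) 1)
    (ht : t ∈ uIcc (-1) b) : ‖(t : ℂ)‖ ≤ 1 := by
  rw [uIcc_of_le hb.1.le] at ht
  rw [Complex.norm_real, Real.norm_eq_abs]
  exact abs_le.2 ⟨ht.1, ht.2.trans hb.2⟩

lemma continuousOn_momentum_ofReal {E : ℂ} (hE : 1000 ≤ ‖E‖) {b : ℝ} (hb : b ∈ Ioc (-1 : ℝ) 1) :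
    ContinuousOn (fun t : ℝ => momentum E t) (uIcc (-1) b) := fun _ ht =>
  ((differentiableAt_momentum hE (norm_ofReal_le_eight hb ht)).continuousAt.comp
    Complex.continuous_ofReal.continuousAt).continuousWithinAt

/-- On a connected segment where the radicand has no zero, any continuous square root is ± the WKB
one, and the sign does not affect whether the real part vanishes. -/
lemma mem_actionCurve_iff {E k : ℂ} (hE : 1000 ≤ ‖E‖) {b : ℝ} (hb : b ∈ Ioc (-1 : ℝ) 1)
    (hk : k ^ 2 = E) :
    E ∈ actionCurve quadPotential (-1) b ↔ (Complex.I * k * action b E).re = 0 := by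
  have hE0 : E ≠ 0 := norm_pos_iff.1 (by linarith)
  have hk0 : k ≠ 0 := by rintro rfl; simp at hk; exact hE0 hk.symm
  set g : ℝ → ℂ := fun t => Complex.I * k * momentum E t with hg
  have hgc : ContinuousOn g (uIcc (-1) b) :=
    continuousOn_const.mul (continuousOn_momentum_ofReal hE hb)
  have hgsq : ∀ t : ℝ, g t ^ 2 = quadPotential t - E := by
    intro t
    simp only [hg, mul_pow, momentum_sq, Complex.I_sq, hk, radicand, quadPotential]
    field_simp
    ring
  have hgne : ∀ t ∈ uIcc (-1) b, g t ≠ 0 := fun t ht =>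
    mul_ne_zero (mul_ne_zero Complex.I_ne_zero hk0) (momentum_ne_zero hE (norm_ofReal_le_eight hb ht))
  have hgint : ∫ t in (-1 : ℝ)..b, g t = Complex.I * k * action b E := by
    rw [action, ← intervalIntegral.integral_const_mul]
  constructor
  · rintro ⟨f, hfc, hfsq, hre⟩
    have hcongr : ∀ F : ℝ → ℂ, EqOn f F (uIcc (-1) b) →
        ∫ t in (-1 : ℝ)..b, f t = ∫ t in (-1 : ℝ)..b, F t :=
      fun _ hF => intervalIntegral.integral_congr hF
    have := isPreconnected_uIcc.eq_or_eq_neg_of_sq_eq hfc hgc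
      (fun t ht => by simp only [Pi.pow_apply]; rw [hfsq t ht, hgsq])
      (fun {t} ht => hgne t ht)
    rcases this with h | h
    · rw [hcongr _ h, hgint] at hre; exact hre
    · rw [hcongr _ h] at hre
      simp only [Pi.neg_apply, intervalIntegral.integral_neg, hgint, Complex.neg_re] at hre
      linarith
  · intro h
    exact ⟨g, hgc, fun t _ => hgsq t, by rw [hgint]; exact h⟩

/-- The square of the action, normalized so as to be asymptotic to `E`. -/
noncomputable def sqAction (b : ℝ) (E : ℂ) : ℂ := E * (action b E / (b + 1)) ^ 2

/-- Up to a positive factor the action is iy with y² = `sqAction`, and Re(iy) = 0 means that y is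
real, that is, y² ≥ 0. The right side no longer depends on the choice of root k. -/
lemma re_action_eq_zero_iff {E k : ℂ} {b : ℝ} (hb : b ∈ Ioc (-1 : ℝ) 1) (hk : k ^ 2 = E) :
    (Complex.I * k * action b E).re = 0 ↔ (sqAction b E).im = 0 ∧ 0 ≤ (sqAction b E).re := by
  have hb1 : 0 < b + 1 := by linarith [hb.1]
  set y := k * (action b E / (b + 1)) with hy
  have h1 : sqAction b E = y ^ 2 := by rw [sqAction, hy, ← hk]; ring
  have h2 : Complex.I * k * action b E = ((b + 1 : ℝ) : ℂ) * (Complex.I * y) := by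
    have : ((b : ℂ) + 1) ≠ 0 := by exact_mod_cast hb1.ne'
    rw [hy]; push_cast; field_simp
  rw [h1, h2, Complex.re_ofReal_mul]
  simp only [sq, Complex.mul_im, Complex.mul_re, Complex.I_re, Complex.I_im]
  constructor
  · intro h
    have : y.im = 0 := by
      rcases mul_eq_zero.1 h with h | h
      · exact absurd h hb1.ne'
      · linarith
    rw [this]; constructor
    · ring
    · nlinarith [mul_self_nonneg y.re]
  · rintro ⟨h3, h4⟩
    have h5 : y.re * y.im = 0 := by linarith
    have : y.im = 0 := by
      rcases mul_eq_zero.1 h5 with h | h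
      · rw [h] at h4; nlinarith [mul_self_nonneg y.im]
      · exact h
    rw [this]; ring

lemma mem_actionCurve_iff_sqAction {E : ℂ} (hE : 1000 ≤ ‖E‖) {b : ℝ} (hb : b ∈ Ioc (-1 : ℝ) 1) :
    E ∈ actionCurve quadPotential (-1) b ↔ (sqAction b E).im = 0 ∧ 0 ≤ (sqAction b E).re := by
  obtain ⟨k, hk⟩ := IsAlgClosed.exists_pow_nat_eq E (n := 2) (by norm_num)
  rw [mem_actionCurve_iff hE hb hk, re_action_eq_zero_iff hb hk]

lemma hasDerivAt_radicand_energy {E : ℂ} (hE : E ≠ 0) (z : ℂ) :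
    HasDerivAt (fun E => radicand E z) (Complex.I * z ^ 2 / E ^ 2) E := by
  have := ((hasDerivAt_inv hE).const_mul (Complex.I * z ^ 2)).const_sub 1
  simp only [radicand, div_eq_mul_inv]
  convert! this using 1
  ring

lemma hasDerivAt_momentum_energy {E z : ℂ} (hE : 1000 ≤ ‖E‖) (hz : ‖z‖ ≤ 8) :
    HasDerivAt (fun E => momentum E z)
      (1 / 2 * (momentum E z / radicand E z) * (Complex.I * z ^ 2 / E ^ 2)) E := by
  have hE0 : E ≠ 0 := norm_pos_iff.1 (by linarith)
  have h0 := radicand_ne_zero hE hz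
  have := (hasDerivAt_radicand_energy hE0 z).cpow_const (c := 1 / 2) (radicand_mem_slitPlane hE hz)
  convert! this using 1
  rw [Complex.cpow_sub _ _ h0, Complex.cpow_one, ← momentum]

lemma differentiableAt_amplitude_energy {E z : ℂ} (hE : 1000 ≤ ‖E‖) (hz : ‖z‖ ≤ 8) :
    DifferentiableAt ℂ (fun E => amplitude E z) E := by
  have hE0 : E ≠ 0 := norm_pos_iff.1 (by linarith)
  exact ((hasDerivAt_radicand_energy hE0 z).cpow_const
    (radicand_mem_slitPlane hE hz)).differentiableAt

lemma differentiableAt_action {E : ℂ} (hE : 1000 < ‖E‖) {b : ℝ} (hb : b ∈ Ioc (-1 : ℝ) 1) :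
    DifferentiableAt ℂ (action b) E := by
  have hopen : IsOpen {E : ℂ | 1000 < ‖E‖} := isOpen_lt continuous_const continuous_norm
  have hmeas : ∀ E : ℂ, 1000 < ‖E‖ → ContinuousOn (fun t : ℝ => momentum E t) (uIcc (-1) b) :=
    fun E hE => continuousOn_momentum_ofReal hE.le hb
  refine (intervalIntegral.hasDerivAt_integral_of_dominated_loc_of_deriv_le
    (F := fun E (t : ℝ) => momentum E t) (bound := fun _ => 1)
    (F' := fun E (t : ℝ) => 1 / 2 * (momentum E t / radicand E t) * (Complex.I * (t : ℂ) ^ 2 / E ^ 2))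
    (hopen.mem_nhds hE) ?_ (hmeas E hE).intervalIntegrable ?_ ?_ intervalIntegrable_const
    ?_).2.differentiableAt
  · filter_upwards [hopen.mem_nhds hE] with E' hE'
    exact ((hmeas E' hE').mono uIoc_subset_uIcc).aestronglyMeasurable measurableSet_uIoc
  · refine ContinuousOn.aestronglyMeasurable ?_ measurableSet_uIoc
    have h1 := (hmeas E hE).mono (uIoc_subset_uIcc (a := (-1 : ℝ)) (b := b))
    have h2 : ContinuousOn (fun t : ℝ => radicand E t) (uIoc (-1) b) := by
      unfold radicand; fun_prop
    have h3 : ContinuousOn (fun t : ℝ => Complex.I * (t : ℂ) ^ 2 / E ^ 2) (uIoc (-1) b) := by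
      fun_prop
    exact (continuousOn_const.mul (h1.div h2 fun t ht =>
      radicand_ne_zero hE.le (norm_ofReal_le_eight hb (uIoc_subset_uIcc ht)))).mul h3
  · refine Eventually.of_forall fun t ht E' hE' => ?_
    have hE'' : 1000 < ‖E'‖ := hE'
    have ht' := uIoc_subset_uIcc ht
    have hz := norm_ofReal_le_eight hb ht'
    have hr : ‖momentum E' t‖ ≤ 11 / 10 := by
      have := norm_le_norm_sub_add (momentum E' t) 1
      have h2 := norm_momentum_sub_one_le hE''.le hz
      rw [norm_one] at this; linarith
    have hw := le_norm_radicand hE''.le hz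
    have h1 := norm_ofReal_le_one hb ht'
    rw [norm_mul, norm_mul, norm_div, norm_div, norm_div, norm_mul, Complex.norm_I, norm_pow, norm_pow,
      norm_one, RCLike.norm_ofNat, one_mul]
    have a1 : ‖momentum E' t‖ / ‖radicand E' t‖ ≤ 2 := by
      rw [div_le_iff₀ (by linarith)]; linarith
    have a2 : ‖(t : ℂ)‖ ^ 2 / ‖E'‖ ^ 2 ≤ 1 := by
      rw [← div_pow]
      refine pow_le_one₀ (by positivity) ?_
      rw [div_le_one (by linarith)]; linarith
    calc _ ≤ 1 / 2 * 2 * (1 : ℝ) := by gcongr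
      _ = 1 := by norm_num
  · refine Eventually.of_forall fun t ht E' hE' => ?_
    exact hasDerivAt_momentum_energy (le_of_lt hE') (norm_ofReal_le_eight hb (uIoc_subset_uIcc ht))

/-! ### Expansion of the squared action at infinity. -/

/-- The moments of `t²` for the uniform distribution on `[-1, b]`. -/
noncomputable def moment₁ (b : ℝ) : ℝ := (b ^ 2 - b + 1) / 3
/-- The second moment of `t²` for the uniform distribution on `[-1, b]`. -/
noncomputable def moment₂ (b : ℝ) : ℝ := (b ^ 4 - b ^ 3 + b ^ 2 - b + 1) / 5
/-- The third moment of `t²` for the uniform distribution on `[-1, b]`. -/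
noncomputable def moment₃ (b : ℝ) : ℝ := (b ^ 6 - b ^ 5 + b ^ 4 - b ^ 3 + b ^ 2 - b + 1) / 7

lemma moment_bounds {b : ℝ} (hb : b ∈ Ioc (-1 : ℝ) 1) :
    |moment₁ b| ≤ 1 ∧ |moment₂ b| ≤ 1 ∧ |moment₃ b| ≤ 1 := by
  have h : |b| ≤ 1 := abs_le.2 ⟨hb.1.le, hb.2⟩
  have hp : ∀ n : ℕ, |b ^ n| ≤ 1 := fun n => by rw [abs_pow]; exact pow_le_one₀ (abs_nonneg _) h
  have h1 := abs_le.1 h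
  have h2 := abs_le.1 (hp 2)
  have h3 := abs_le.1 (hp 3)
  have h4 := abs_le.1 (hp 4)
  have h5 := abs_le.1 (hp 5)
  have h6 := abs_le.1 (hp 6)
  refine ⟨abs_le.2 ?_, abs_le.2 ?_, abs_le.2 ?_⟩ <;>
  simp only [moment₁, moment₂, moment₃] <;> constructor <;> linarith

/-- The third order Taylor polynomial of `√(1 - x)`. -/
noncomputable def sqrtTaylor (x : ℂ) : ℂ := 1 - x / 2 - x ^ 2 / 8 - x ^ 3 / 16

/-- With m = √(1-x) and T the Taylor polynomial, (m-T)(m+T) = 1-x-T² is explicitly O(x⁴), while m+T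
has real part at least 1/2. No Taylor remainder theorem is involved. -/
lemma norm_momentum_sub_taylor_le {E z : ℂ} (hE : 1000 ≤ ‖E‖) (hz : ‖z‖ ≤ 1) :
    ‖momentum E z - sqrtTaylor (Complex.I * z ^ 2 / E)‖ ≤ 1 / ‖E‖ ^ 4 := by
  set x := Complex.I * z ^ 2 / E with hx
  have hxn : ‖x‖ ≤ 1 / ‖E‖ := by
    rw [hx, norm_div, norm_mul, Complex.norm_I, one_mul, norm_pow]
    gcongr
    exact pow_le_one₀ (norm_nonneg _) hz
  have hxn' : ‖x‖ ≤ 1 / 1000 := hxn.trans (one_div_le_one_div_of_le (by norm_num) hE)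
  have hfac : (momentum E z - sqrtTaylor x) * (momentum E z + sqrtTaylor x) =
      -(x ^ 4 * (5 / 64 + x / 64 + x ^ 2 / 256)) := by
    have : momentum E z ^ 2 = 1 - x := by rw [momentum_sq, radicand]
    rw [sqrtTaylor]
    linear_combination this
  have hre : 1 / 2 ≤ (sqrtTaylor x).re := by
    have h1 : ‖x / 2 + x ^ 2 / 8 + x ^ 3 / 16‖ ≤ 1 / 2 := by
      have a2 : ‖x‖ ^ 2 ≤ 1 := pow_le_one₀ (norm_nonneg _) (by linarith)
      have a3 : ‖x‖ ^ 3 ≤ 1 := pow_le_one₀ (norm_nonneg _) (by linarith)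
      refine (norm_add₃_le).trans ?_
      simp only [norm_div, norm_pow, RCLike.norm_ofNat]
      linarith
    have h2 := (Complex.abs_re_le_norm _).trans h1
    have h3 : sqrtTaylor x = 1 - (x / 2 + x ^ 2 / 8 + x ^ 3 / 16) := by rw [sqrtTaylor]; ring
    rw [h3, Complex.sub_re, Complex.one_re]
    linarith [(abs_le.1 h2).2]
  have hge : 1 / 2 ≤ ‖momentum E z + sqrtTaylor x‖ := by
    refine le_trans ?_ (Complex.re_le_norm _)
    have : 0 ≤ (momentum E z).re := cpow_half_re_nonneg _
    rw [Complex.add_re]; linarith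
  have hle : ‖-(x ^ 4 * (5 / 64 + x / 64 + x ^ 2 / 256))‖ ≤ 1 / ‖E‖ ^ 4 * (1 / 2) := by
    have a2 : ‖x‖ ^ 2 ≤ 1 := pow_le_one₀ (norm_nonneg _) (by linarith)
    have h1 : ‖(5 / 64 + x / 64 + x ^ 2 / 256)‖ ≤ 1 / 2 := by
      refine (norm_add₃_le).trans ?_
      simp only [norm_div, norm_pow, RCLike.norm_ofNat]
      linarith
    rw [norm_neg, norm_mul, norm_pow]
    gcongr
    calc ‖x‖ ^ 4 ≤ (1 / ‖E‖) ^ 4 := by gcongr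
      _ = _ := by rw [div_pow, one_pow]
  rw [← hfac, norm_mul] at hle
  have hpos : 0 ≤ ‖momentum E z - sqrtTaylor x‖ := norm_nonneg _
  nlinarith

lemma norm_action_sub_taylor_le {E : ℂ} (hE : 1000 ≤ ‖E‖) {b : ℝ} (hb : b ∈ Ioc (-1 : ℝ) 1) :
    ‖action b E / (b + 1) - (1 - Complex.I * moment₁ b / (2 * E) + moment₂ b / (8 * E ^ 2) +
      Complex.I * moment₃ b / (16 * E ^ 3))‖ ≤ 1 / ‖E‖ ^ 4 := by
  have hb1 : 0 < b + 1 := by linarith [hb.1]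
  have hbc : ((b : ℂ) + 1) ≠ 0 := by exact_mod_cast hb1.ne'
  have hE0 : E ≠ 0 := norm_pos_iff.1 (by linarith)
  have hT : ∫ t in (-1 : ℝ)..b, sqrtTaylor (Complex.I * (t : ℂ) ^ 2 / E) =
      ((b : ℂ) + 1) * (1 - Complex.I * moment₁ b / (2 * E) + moment₂ b / (8 * E ^ 2) +
      Complex.I * moment₃ b / (16 * E ^ 3)) := by
    have hd : ∀ t ∈ uIcc (-1) b, HasDerivAt (fun t : ℝ => (t : ℂ) - Complex.I * (t : ℂ) ^ 3 / (6 * E) +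
        (t : ℂ) ^ 5 / (40 * E ^ 2) + Complex.I * (t : ℂ) ^ 7 / (112 * E ^ 3))
        (sqrtTaylor (Complex.I * (t : ℂ) ^ 2 / E)) t := by
      intro t _
      have h : HasDerivAt (fun t : ℂ => t - Complex.I * t ^ 3 / (6 * E) +
        t ^ 5 / (40 * E ^ 2) + Complex.I * t ^ 7 / (112 * E ^ 3))
        (sqrtTaylor (Complex.I * (t : ℂ) ^ 2 / E)) t := by
        have := (((hasDerivAt_id' (t : ℂ)).sub
          (((hasDerivAt_pow 3 (t : ℂ)).const_mul Complex.I).div_const (6 * E))).add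
          ((hasDerivAt_pow 5 (t : ℂ)).div_const (40 * E ^ 2))).add
          (((hasDerivAt_pow 7 (t : ℂ)).const_mul Complex.I).div_const (112 * E ^ 3))
        convert! this using 1
        rw [sqrtTaylor, div_pow, div_pow, mul_pow, mul_pow, Complex.I_pow_three, Complex.I_sq]
        push_cast
        field_simp
        ring
      exact h.comp_ofReal
    rw [intervalIntegral.integral_eq_sub_of_hasDerivAt hd]
    · simp only [moment₁, moment₂, moment₃]
      push_cast
      field_simp
      ring
    · apply Continuous.intervalIntegrable
      unfold sqrtTaylor; fun_prop
  have hdiff : ‖action b E - ∫ t in (-1 : ℝ)..b, sqrtTaylor (Complex.I * (t : ℂ) ^ 2 / E)‖ ≤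
      1 / ‖E‖ ^ 4 * (b + 1) := by
    rw [action, ← intervalIntegral.integral_sub (continuousOn_momentum_ofReal hE hb).intervalIntegrable
      (by apply Continuous.intervalIntegrable; unfold sqrtTaylor; fun_prop)]
    have := intervalIntegral.norm_integral_le_of_norm_le_const (a := (-1 : ℝ)) (b := b)
      (C := 1 / ‖E‖ ^ 4)
      (f := fun t : ℝ => momentum E t - sqrtTaylor (Complex.I * (t : ℂ) ^ 2 / E)) (fun t ht =>
        norm_momentum_sub_taylor_le hE (norm_ofReal_le_one hb (uIoc_subset_uIcc ht)))
    rwa [sub_neg_eq_add, abs_of_pos hb1] at this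
  rw [hT] at hdiff
  rw [div_sub' hbc, norm_div, norm_real_add_one hb.1, div_le_iff₀ hb1]
  exact hdiff

/-- The term of order 1/E² has to be kept: like the imaginary part of the 1/E term, it moves the
curve at order 1/a², the order that separates two curves with the same asymptote. -/
lemma norm_sqAction_sub_le {E : ℂ} (hE : 1000 ≤ ‖E‖) {b : ℝ} (hb : b ∈ Ioc (-1 : ℝ) 1) :
    ‖sqAction b E - (E - Complex.I * moment₁ b + (moment₂ b - moment₁ b ^ 2) / (4 * E) +
      Complex.I * (moment₃ b - moment₁ b * moment₂ b) / (8 * E ^ 2))‖ ≤ 12 / ‖E‖ ^ 3 := by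
  have hE0 : E ≠ 0 := norm_pos_iff.1 (by linarith)
  have hEp : 0 < ‖E‖ := by linarith
  obtain ⟨m1, m2, m3⟩ := moment_bounds hb
  have h := norm_action_sub_taylor_le hE hb
  set P : ℂ := 1 - Complex.I * moment₁ b / (2 * E) + moment₂ b / (8 * E ^ 2) +
      Complex.I * moment₃ b / (16 * E ^ 3) with hP
  set d := action b E / (b + 1) - P with hd
  have hX : 1 / ‖E‖ ≤ 1 := by rw [div_le_one hEp]; linarith
  have hXp : 0 < 1 / ‖E‖ := by positivity
  have n1 : ‖(moment₁ b : ℂ)‖ ≤ 1 := by simpa using m1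
  have n2 : ‖(moment₂ b : ℂ)‖ ≤ 1 := by simpa using m2
  have n3 : ‖(moment₃ b : ℂ)‖ ≤ 1 := by simpa using m3
  have hPn : ‖P‖ ≤ 2 := by
    have e : P = 1 - Complex.I * moment₁ b * (1 / E) / 2 + moment₂ b * (1 / E) ^ 2 / 8 +
      Complex.I * moment₃ b * (1 / E) ^ 3 / 16 := by rw [hP]; field_simp
    rw [e]
    refine (norm_add_le _ _).trans ((add_le_add ((norm_add_le _ _).trans
      (add_le_add (norm_sub_le _ _) le_rfl)) le_rfl).trans ?_)
    simp only [norm_mul, norm_div, norm_pow, Complex.norm_I, norm_one, RCLike.norm_ofNat, one_mul]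
    have a1 : ‖(moment₁ b : ℂ)‖ * (1 / ‖E‖) ≤ 1 := mul_le_one₀ n1 hXp.le hX
    have a2 : ‖(moment₂ b : ℂ)‖ * (1 / ‖E‖) ^ 2 ≤ 1 :=
      mul_le_one₀ n2 (by positivity) (pow_le_one₀ hXp.le hX)
    have a3 : ‖(moment₃ b : ℂ)‖ * (1 / ‖E‖) ^ 3 ≤ 1 :=
      mul_le_one₀ n3 (by positivity) (pow_le_one₀ hXp.le hX)
    linarith
  have key : sqAction b E - (E - Complex.I * moment₁ b + (moment₂ b - moment₁ b ^ 2) / (4 * E) +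
      Complex.I * (moment₃ b - moment₁ b * moment₂ b) / (8 * E ^ 2)) =
      (E * (2 * P * d) + E * d ^ 2) +
      ((moment₁ b * moment₃ b / 16 + moment₂ b ^ 2 / 64) / E ^ 3 +
        Complex.I * moment₂ b * moment₃ b / 64 / E ^ 4 + (-(moment₃ b ^ 2 / 256) / E ^ 5)) := by
    have e1 : action b E / (b + 1) = P + d := by rw [hd]; ring
    rw [sqAction, e1]
    have e2 : E * (P + d) ^ 2 = (E * (2 * P * d) + E * d ^ 2) + E * P ^ 2 := by ring
    rw [e2, hP]
    field_simp
    ring_nf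
    simp only [Complex.I_sq]
    ring
  rw [key]
  have b1 : ‖E * (2 * P * d)‖ ≤ 4 / ‖E‖ ^ 3 := by
    rw [norm_mul, norm_mul, norm_mul, RCLike.norm_ofNat]
    calc _ ≤ ‖E‖ * (2 * 2 * (1 / ‖E‖ ^ 4)) := by gcongr
      _ = _ := by field_simp; norm_num
  have b2 : ‖E * d ^ 2‖ ≤ 1 / ‖E‖ ^ 3 := by
    have hd1 : ‖d‖ ≤ 1 := h.trans (by rw [div_le_one (by positivity)]; exact one_le_pow₀ (by linarith))
    rw [norm_mul, norm_pow]
    calc ‖E‖ * ‖d‖ ^ 2 = ‖E‖ * (‖d‖ * ‖d‖) := by ring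
      _ ≤ ‖E‖ * ((1 / ‖E‖ ^ 4) * 1) := by gcongr
      _ = _ := by field_simp
  have b3 : ‖(moment₁ b * moment₃ b / 16 + moment₂ b ^ 2 / 64 : ℂ) / E ^ 3‖ ≤ 1 / ‖E‖ ^ 3 := by
    rw [norm_div, norm_pow]
    gcongr
    refine (norm_add_le _ _).trans ?_
    simp only [norm_mul, norm_div, norm_pow, RCLike.norm_ofNat]
    have := mul_le_one₀ n1 (norm_nonneg _) n3
    have := pow_le_one₀ (n := 2) (norm_nonneg _) n2
    linarith
  have b4 : ‖Complex.I * moment₂ b * moment₃ b / 64 / E ^ 4‖ ≤ 1 / ‖E‖ ^ 3 := by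
    simp only [norm_mul, norm_div, norm_pow, RCLike.norm_ofNat, Complex.norm_I, one_mul]
    have := mul_le_one₀ n2 (norm_nonneg _) n3
    gcongr
    · linarith
    · linarith
    · norm_num
  have b5 : ‖-(moment₃ b ^ 2 / 256 : ℂ) / E ^ 5‖ ≤ 1 / ‖E‖ ^ 3 := by
    simp only [norm_div, norm_neg, norm_pow, RCLike.norm_ofNat]
    have := pow_le_one₀ (n := 2) (norm_nonneg _) n3
    gcongr
    · linarith
    · linarith
    · norm_num
  calc _ ≤ (4 / ‖E‖ ^ 3 + 1 / ‖E‖ ^ 3) + (1 / ‖E‖ ^ 3 + 1 / ‖E‖ ^ 3 + 1 / ‖E‖ ^ 3) :=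
        (norm_add_le _ _).trans (add_le_add ((norm_add_le _ _).trans (add_le_add b1 b2))
          (norm_add₃_le.trans (add_le_add (add_le_add b3 b4) b5)))
    _ = 8 / ‖E‖ ^ 3 := by ring
    _ ≤ _ := by gcongr; norm_num

/-- The deviation of `sqAction` from its asymptote. -/
noncomputable def sqActionError (b : ℝ) (E : ℂ) : ℂ := sqAction b E - (E - Complex.I * moment₁ b)

lemma norm_sqActionError_le {E : ℂ} (hE : 1000 ≤ ‖E‖) {b : ℝ} (hb : b ∈ Ioc (-1 : ℝ) 1) :
    ‖sqActionError b E‖ ≤ 1 / ‖E‖ := by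
  have hE0 : E ≠ 0 := norm_pos_iff.1 (by linarith)
  have hEp : 0 < ‖E‖ := by linarith
  obtain ⟨m1, m2, m3⟩ := moment_bounds hb
  have h := norm_sqAction_sub_le hE hb
  have n1 : ‖(moment₁ b : ℂ)‖ ≤ 1 := by simpa using m1
  have n2 : ‖(moment₂ b : ℂ)‖ ≤ 1 := by simpa using m2
  have n3 : ‖(moment₃ b : ℂ)‖ ≤ 1 := by simpa using m3
  have e : sqActionError b E = (sqAction b E - (E - Complex.I * moment₁ b +
      (moment₂ b - moment₁ b ^ 2) / (4 * E) +
      Complex.I * (moment₃ b - moment₁ b * moment₂ b) / (8 * E ^ 2))) +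
      (moment₂ b - moment₁ b ^ 2) / (4 * E) +
      Complex.I * (moment₃ b - moment₁ b * moment₂ b) / (8 * E ^ 2) := by
    rw [sqActionError]; ring
  have hX : 1 / ‖E‖ ≤ 1 / 1000 := one_div_le_one_div_of_le (by norm_num) hE
  have hXp : 0 < 1 / ‖E‖ := by positivity
  have b1 : 12 / ‖E‖ ^ 3 ≤ 1 / 10 * (1 / ‖E‖) := by
    rw [show 12 / ‖E‖ ^ 3 = 12 * (1 / ‖E‖) ^ 2 * (1 / ‖E‖) by field_simp]
    gcongr
    nlinarith
  have b2 : ‖(moment₂ b - moment₁ b ^ 2 : ℂ) / (4 * E)‖ ≤ 1 / 2 * (1 / ‖E‖) := by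
    rw [norm_div, norm_mul, RCLike.norm_ofNat,
      show ‖(moment₂ b - moment₁ b ^ 2 : ℂ)‖ / (4 * ‖E‖) =
        ‖(moment₂ b - moment₁ b ^ 2 : ℂ)‖ / 4 * (1 / ‖E‖) by field_simp]
    gcongr ?_ * _
    have := norm_sub_le (moment₂ b : ℂ) (moment₁ b ^ 2 : ℂ)
    rw [norm_pow] at this
    have := pow_le_one₀ (n := 2) (norm_nonneg _) n1
    linarith
  have b3 : ‖Complex.I * (moment₃ b - moment₁ b * moment₂ b : ℂ) / (8 * E ^ 2)‖ ≤
      1 / 10 * (1 / ‖E‖) := by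
    have := norm_sub_le (moment₃ b : ℂ) (moment₁ b * moment₂ b : ℂ)
    rw [norm_mul] at this
    have := mul_le_one₀ n1 (norm_nonneg _) n2
    rw [norm_div, norm_mul, norm_mul, RCLike.norm_ofNat, norm_pow, Complex.norm_I, one_mul,
      show ‖(moment₃ b - moment₁ b * moment₂ b : ℂ)‖ / (8 * ‖E‖ ^ 2) =
        ‖(moment₃ b - moment₁ b * moment₂ b : ℂ)‖ / 8 * (1 / ‖E‖) * (1 / ‖E‖) by field_simp]
    gcongr
    calc _ ≤ 2 / 8 * (1 / 1000 : ℝ) := by gcongr; linarith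
      _ ≤ _ := by norm_num
  rw [e]
  refine norm_add₃_le.trans ?_
  linarith

lemma differentiableAt_sqAction {E : ℂ} (hE : 1000 < ‖E‖) {b : ℝ} (hb : b ∈ Ioc (-1 : ℝ) 1) :
    DifferentiableAt ℂ (sqAction b) E :=
  differentiableAt_id.mul (((differentiableAt_action hE hb).div_const _).pow 2)

lemma differentiableAt_sqActionError {E : ℂ} (hE : 1000 < ‖E‖) {b : ℝ} (hb : b ∈ Ioc (-1 : ℝ) 1) :
    DifferentiableAt ℂ (sqActionError b) E :=
  (differentiableAt_sqAction hE hb).sub (differentiableAt_id.sub_const _)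

/-- Cauchy's estimate on a disc of radius 2000, which stays in |E| ≥ 2000, where the error is at
most 1. -/
lemma norm_deriv_sqActionError_le {E : ℂ} (hE : 4000 ≤ ‖E‖) {b : ℝ} (hb : b ∈ Ioc (-1 : ℝ) 1) :
    ‖deriv (sqActionError b) E‖ ≤ 1 / 2 := by
  have hball : ∀ z ∈ Metric.closedBall E 2000, 2000 ≤ ‖z‖ := by
    intro z hz
    rw [mem_closedBall_iff_norm'] at hz
    have := norm_sub_norm_le E z
    linarith
  have h : DiffContOnCl ℂ (sqActionError b) (Metric.ball E 2000) := by
    refine DifferentiableOn.diffContOnCl fun z hz => ?_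
    rw [closure_ball _ (by norm_num)] at hz
    exact (differentiableAt_sqActionError (by linarith [hball z hz]) hb).differentiableWithinAt
  refine (Complex.norm_deriv_le_of_forall_mem_sphere_norm_le (by norm_num) h (C := 1) ?_).trans
    (by norm_num)
  intro z hz
  have h1 := hball z (Metric.sphere_subset_closedBall hz)
  refine (norm_sqActionError_le (by linarith) hb).trans ?_
  rw [div_le_one (by linarith)]
  linarith

/-! ### The curves as graphs over the real axis near infinity. -/

lemma le_norm_of_le_re {a : ℝ} {E : ℂ} (h : a ≤ E.re) : a ≤ ‖E‖ :=
  h.trans (Complex.re_le_norm _)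

lemma norm_sqActionError_sub_le {b : ℝ} (hb : b ∈ Ioc (-1 : ℝ) 1) {E E' : ℂ} (hE : 4000 ≤ E.re)
    (hE' : 4000 ≤ E'.re) : ‖sqActionError b E - sqActionError b E'‖ ≤ 1 / 2 * ‖E - E'‖ :=
  (convex_halfSpace_re_ge (4000 : ℝ)).norm_image_sub_le_of_norm_deriv_le
    (fun z hz => differentiableAt_sqActionError (by linarith [le_norm_of_le_re hz]) hb)
    (fun _ hz => norm_deriv_sqActionError_le (le_norm_of_le_re hz) hb) hE' hE

lemma sqAction_eq (b : ℝ) (E : ℂ) : sqAction b E = E - Complex.I * moment₁ b + sqActionError b E := by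
  rw [sqActionError]; ring

lemma sqAction_im (b : ℝ) (E : ℂ) :
    (sqAction b E).im = E.im - moment₁ b + (sqActionError b E).im := by
  rw [sqAction_eq]; simp

lemma sqAction_re (b : ℝ) (E : ℂ) : (sqAction b E).re = E.re + (sqActionError b E).re := by
  rw [sqAction_eq]; simp

lemma re_mul_I (a y : ℝ) : ((a : ℂ) + (y : ℂ) * Complex.I).re = a := by simp

lemma im_mul_I (a y : ℝ) : ((a : ℂ) + (y : ℂ) * Complex.I).im = y := by simp

lemma mem_actionCurve_iff_of_le_re {b : ℝ} (hb : b ∈ Ioc (-1 : ℝ) 1) {E : ℂ} (hE : 4000 ≤ E.re) :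
    E ∈ actionCurve quadPotential (-1) b ↔ E.im - moment₁ b + (sqActionError b E).im = 0 := by
  have hn := le_norm_of_le_re hE
  rw [mem_actionCurve_iff_sqAction (by linarith) hb, sqAction_im, and_iff_left]
  rw [sqAction_re]
  have h1 := norm_sqActionError_le (by linarith : 1000 ≤ ‖E‖) hb
  have h2 : 1 / ‖E‖ ≤ 1 := by rw [div_le_one (by linarith)]; linarith
  have h3 := Complex.abs_re_le_norm (sqActionError b E)
  linarith [(abs_le.1 (h3.trans (h1.trans h2))).1]

/-- Intermediate value theorem on a vertical line: the error is at most 1, so the sign changes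
between heights m₁ - 1 and m₁ + 1. -/
lemma exists_mem_actionCurve {b : ℝ} (hb : b ∈ Ioc (-1 : ℝ) 1) {a : ℝ} (ha : 4000 ≤ a) :
    ∃ y : ℝ, (a : ℂ) + (y : ℂ) * Complex.I ∈ actionCurve quadPotential (-1) b := by
  set f : ℝ → ℝ := fun y => y - moment₁ b + (sqActionError b ((a : ℂ) + (y : ℂ) * Complex.I)).im with hf
  have hn : ∀ y : ℝ, 4000 ≤ ‖(a : ℂ) + (y : ℂ) * Complex.I‖ := fun y =>
    le_norm_of_le_re (by rw [re_mul_I]; exact ha)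
  have hcont : Continuous f := by
    have : Continuous fun y : ℝ => sqActionError b ((a : ℂ) + (y : ℂ) * Complex.I) := by
      rw [continuous_iff_continuousAt]
      intro y
      exact ContinuousAt.comp
        (differentiableAt_sqActionError (by linarith [hn y]) hb).continuousAt
        (f := fun y : ℝ => (a : ℂ) + (y : ℂ) * Complex.I) (by fun_prop)
    exact (continuous_id.sub continuous_const).add (Complex.continuous_im.comp this)
  have hbd : ∀ y : ℝ, |(sqActionError b ((a : ℂ) + (y : ℂ) * Complex.I)).im| ≤ 1 := fun y => by
    refine (Complex.abs_im_le_norm _).trans ((norm_sqActionError_le (by linarith [hn y]) hb).trans ?_)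
    rw [div_le_one (by linarith [hn y])]; linarith [hn y]
  have h1 : f (moment₁ b - 1) ≤ 0 := by
    simp only [hf]; linarith [(abs_le.1 (hbd (moment₁ b - 1))).2]
  have h2 : 0 ≤ f (moment₁ b + 1) := by
    simp only [hf]; linarith [(abs_le.1 (hbd (moment₁ b + 1))).1]
  obtain ⟨y, -, hy⟩ := intermediate_value_Icc (by linarith : moment₁ b - 1 ≤ moment₁ b + 1)
    hcont.continuousOn ⟨h1, h2⟩
  refine ⟨y, (mem_actionCurve_iff_of_le_re hb (by rw [re_mul_I]; exact ha)).2 ?_⟩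
  rw [im_mul_I]; exact hy

/-- The error is 1/2-Lipschitz, so |Δy| ≤ (|Δa| + |Δy|)/2. This gives at once uniqueness of the
point on each vertical line and continuity of the graph. -/
lemma abs_im_sub_le_of_mem_actionCurve {b : ℝ} (hb : b ∈ Ioc (-1 : ℝ) 1) {E E' : ℂ}
    (hE : 4000 ≤ E.re) (hE' : 4000 ≤ E'.re) (h : E ∈ actionCurve quadPotential (-1) b)
    (h' : E' ∈ actionCurve quadPotential (-1) b) : |E.im - E'.im| ≤ |E.re - E'.re| := by
  rw [mem_actionCurve_iff_of_le_re hb hE] at h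
  rw [mem_actionCurve_iff_of_le_re hb hE'] at h'
  have h1 := (Complex.abs_im_le_norm _).trans (norm_sqActionError_sub_le hb hE hE')
  have h2 : E.im - E'.im = -(sqActionError b E - sqActionError b E').im := by
    rw [Complex.sub_im]; linarith
  have h3 := Complex.norm_le_abs_re_add_abs_im (E - E')
  rw [Complex.sub_re, Complex.sub_im] at h3
  rw [← abs_neg, ← h2] at h1
  linarith

lemma abs_im_sub_moment_le {b : ℝ} (hb : b ∈ Ioc (-1 : ℝ) 1) {E : ℂ} (hE : 1000 ≤ ‖E‖)
    (h : E ∈ actionCurve quadPotential (-1) b) : |E.im - moment₁ b| ≤ 1 / ‖E‖ := by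
  rw [mem_actionCurve_iff_sqAction hE hb, sqAction_im] at h
  have h1 := (Complex.abs_im_le_norm _).trans (norm_sqActionError_le hE hb)
  rw [show E.im - moment₁ b = -(sqActionError b E).im by linarith [h.1], abs_neg]
  exact h1

/-- Im E is bounded on the curve, so |Re E| is large; the left end is excluded because the squared
action, close to E, must have nonnegative real part. -/
lemma le_re_of_mem_actionCurve {b : ℝ} (hb : b ∈ Ioc (-1 : ℝ) 1) {R : ℝ} (hR : 1000 ≤ R) {E : ℂ}
    (hE : R + 2 ≤ ‖E‖) (h : E ∈ actionCurve quadPotential (-1) b) : R ≤ E.re := by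
  have h1 := abs_im_sub_moment_le hb (by linarith) h
  rw [mem_actionCurve_iff_sqAction (by linarith) hb, sqAction_re] at h
  have h0 := norm_sqActionError_le (by linarith : 1000 ≤ ‖E‖) hb
  have h2 := (abs_le.1 ((Complex.abs_re_le_norm _).trans h0)).2
  have h3 : 1 / ‖E‖ ≤ 1 / 1000 := one_div_le_one_div_of_le (by norm_num) (by linarith)
  have h4 := abs_le.1 (moment_bounds hb).1
  have h5 := abs_le.1 h1
  have h6 : |E.im| ≤ 1 + 1 / 1000 := abs_le.2 ⟨by linarith, by linarith⟩
  have h7 := Complex.norm_le_abs_re_add_abs_im E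
  have h8 : R + 1 / 2 ≤ |E.re| := by linarith
  rcases le_abs.1 h8 with h9 | h9
  · linarith
  · linarith [h.2]

lemma isAsymptoticToLine_actionCurve_shift {b : ℝ} (hb : b ∈ Ioc (-1 : ℝ) 1) (s : ℝ) :
    IsAsymptoticToLine {E | E + s * Complex.I ∈ actionCurve quadPotential (-1) b}
      (moment₁ b - s) := by
  have hex : ∀ a : ℝ, ∃ y : ℝ, 4000 ≤ a →
      (a : ℂ) + (y : ℂ) * Complex.I ∈ actionCurve quadPotential (-1) b := fun a => by
    by_cases ha : 4000 ≤ a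
    · obtain ⟨y, hy⟩ := exists_mem_actionCurve hb ha
      exact ⟨y, fun _ => hy⟩
    · exact ⟨0, fun h => absurd h ha⟩
  choose f hf using hex
  refine ⟨4000, 4002 + |s|, 1, fun a => f a - s, by norm_num, ?_, ?_, ?_, ?_⟩
  · refine ContinuousOn.sub (LipschitzOnWith.continuousOn (K := 1) ?_) continuousOn_const
    refine LipschitzOnWith.of_dist_le_mul fun a ha a' ha' => ?_
    have := abs_im_sub_le_of_mem_actionCurve hb (by rw [re_mul_I]; exact ha)
      (by rw [re_mul_I]; exact ha') (hf a ha) (hf a' ha')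
    simpa [Real.dist_eq] using this
  · intro a ha y
    have e : (a : ℂ) + (y : ℂ) * Complex.I + s * Complex.I =
        (a : ℂ) + ((y + s : ℝ) : ℂ) * Complex.I := by push_cast; ring
    rw [mem_ofPred_eq, e]
    constructor
    · intro h
      have := abs_im_sub_le_of_mem_actionCurve hb (by rw [re_mul_I]; exact ha)
        (by rw [re_mul_I]; exact ha) h (hf a ha)
      simp only [re_mul_I, im_mul_I, sub_self, abs_zero] at this
      linarith [abs_nonpos_iff.1 this]
    · rintro rfl
      rw [sub_add_cancel]
      exact hf a ha
  · intro a ha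
    have hn := le_norm_of_le_re (a := a) (E := (a : ℂ) + (f a : ℂ) * Complex.I) (by rw [re_mul_I])
    have := abs_im_sub_moment_le hb (by linarith) (hf a ha)
    rw [im_mul_I] at this
    rw [sub_sub_sub_cancel_right]
    exact this.trans (one_div_le_one_div_of_le (by linarith) hn)
  · intro E hE hn
    have h1 : 4000 + 2 ≤ ‖E + s * Complex.I‖ := by
      have := norm_sub_le (E + s * Complex.I) (s * Complex.I)
      rw [add_sub_cancel_right, norm_mul, Complex.norm_I, mul_one, Complex.norm_real,
        Real.norm_eq_abs] at this
      linarith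
    have := le_re_of_mem_actionCurve hb (by norm_num) h1 hE
    simpa using this

/-! ### Second-order asymptotics and disjointness of the two curves. -/

/-- The coefficient of `1 / a²` in the expansion of the action curve. -/
noncomputable def curveCoeff (b : ℝ) : ℝ :=
  (moment₂ b - moment₁ b ^ 2) * moment₁ b / 4 - (moment₃ b - moment₁ b * moment₂ b) / 8

/-- Take the imaginary part of the expansion of `sqAction` at E = a + iy. To leading order 1/E
contributes -y/a² and i/E² contributes 1/a²; then y is replaced by m₁ at a cost of O(1/a) times
1/a². -/
lemma abs_im_sub_curveCoeff_le {b : ℝ} (hb : b ∈ Ioc (-1 : ℝ) 1) {E : ℂ} (hE : 4000 ≤ E.re)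
    (h : E ∈ actionCurve quadPotential (-1) b) :
    |E.im - moment₁ b - curveCoeff b / E.re ^ 2| ≤ 30 / E.re ^ 3 := by
  have hn := le_norm_of_le_re hE
  have hE0 : E ≠ 0 := norm_pos_iff.1 (by linarith)
  have h1 := abs_im_sub_moment_le hb (by linarith) h
  rw [mem_actionCurve_iff_sqAction (by linarith) hb] at h
  have hexp := norm_sqAction_sub_le (by linarith : 1000 ≤ ‖E‖) hb
  obtain ⟨m1, m2, m3⟩ := moment_bounds hb
  set a := E.re with ha
  set y := E.im with hy
  have ha0 : 0 < a := by linarith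
  have hEn : a ≤ ‖E‖ := Complex.re_le_norm E
  have hyb : |y| ≤ 2 := by
    have : 1 / ‖E‖ ≤ 1 := by rw [div_le_one (by linarith)]; linarith
    have := abs_sub_abs_le_abs_sub y (moment₁ b)
    linarith
  have hac : (a : ℂ) ≠ 0 := by exact_mod_cast ha0.ne'
  have hEe : E = a + y * Complex.I := (Complex.re_add_im E).symm
  set σ : ℝ := moment₂ b - moment₁ b ^ 2 with hσ
  set τ : ℝ := moment₃ b - moment₁ b * moment₂ b with hτ
  have hσb : |σ| ≤ 2 := by
    have h1 := abs_le.1 m1; have h2 := abs_le.1 m2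
    rw [abs_le]; constructor <;> nlinarith
  have hτb : |τ| ≤ 2 := by
    have h1 := abs_sub (moment₃ b) (moment₁ b * moment₂ b)
    rw [abs_mul] at h1
    have := mul_le_one₀ m1 (abs_nonneg _) m2
    linarith
  -- Exact identities, valid at every E with a ≠ 0, which isolate the terms of order a⁻³ as explicit
  -- remainders.
  have e1 : 1 / E = 1 / (a : ℂ) - y * Complex.I / a ^ 2 - y ^ 2 / (a ^ 2 * E) := by
    field_simp
    rw [hEe]
    linear_combination ((y : ℂ) ^ 2) * Complex.I_sq
  have e2 : 1 / E ^ 2 = 1 / (a : ℂ) ^ 2 + (y ^ 2 - 2 * y * a * Complex.I) / (a ^ 2 * E ^ 2) := by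
    field_simp
    rw [hEe]
    linear_combination (-(y : ℂ) ^ 2) * Complex.I_sq
  have r1 : ‖(y : ℂ) ^ 2 / (a ^ 2 * E)‖ ≤ 4 / a ^ 3 := by
    rw [norm_div, norm_mul, norm_pow, norm_pow, Complex.norm_real, Complex.norm_real,
      Real.norm_eq_abs, Real.norm_of_nonneg ha0.le]
    calc |y| ^ 2 / (a ^ 2 * ‖E‖) ≤ 2 ^ 2 / (a ^ 2 * a) := by gcongr
      _ = _ := by ring
  have r2 : ‖((y : ℂ) ^ 2 - 2 * y * a * Complex.I) / (a ^ 2 * E ^ 2)‖ ≤ 8 / a ^ 3 := by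
    rw [norm_div, norm_mul, norm_pow, norm_pow, Complex.norm_real, Real.norm_of_nonneg ha0.le]
    have : ‖((y : ℂ) ^ 2 - 2 * y * a * Complex.I)‖ ≤ 8 * a := by
      refine (norm_sub_le _ _).trans ?_
      rw [norm_pow, norm_mul, norm_mul, norm_mul, RCLike.norm_ofNat, Complex.norm_I,
        Complex.norm_real, Complex.norm_real, Real.norm_eq_abs, Real.norm_of_nonneg ha0.le]
      have : |y| ^ 2 ≤ 2 ^ 2 := by gcongr
      nlinarith [abs_nonneg y]
    calc _ ≤ 8 * a / (a ^ 2 * a ^ 2) := by gcongr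
      _ = _ := by field_simp
  set X : ℂ := sqAction b E - (E - Complex.I * moment₁ b + (moment₂ b - moment₁ b ^ 2) / (4 * E) +
      Complex.I * (moment₃ b - moment₁ b * moment₂ b) / (8 * E ^ 2)) with hX
  have hXn : ‖X‖ ≤ 12 / a ^ 3 := hexp.trans (by gcongr)
  have key : sqAction b E = X + ((a + σ / (4 * a) : ℝ) : ℂ) +
      ((y - moment₁ b - σ * y / (4 * a ^ 2) + τ / (8 * a ^ 2) : ℝ) : ℂ) * Complex.I
      - (σ / 4 : ℝ) * (y ^ 2 / (a ^ 2 * E)) +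
      (τ / 8 : ℝ) * (Complex.I * ((y ^ 2 - 2 * y * a * Complex.I) / (a ^ 2 * E ^ 2))) := by
    have s1 : (moment₂ b - moment₁ b ^ 2 : ℂ) / (4 * E) = (σ / 4 : ℝ) * (1 / E) := by
      rw [hσ]; push_cast; ring
    have s2 : Complex.I * (moment₃ b - moment₁ b * moment₂ b : ℂ) / (8 * E ^ 2) =
        (τ / 8 : ℝ) * (Complex.I * (1 / E ^ 2)) := by
      rw [hτ]; push_cast; ring
    have : sqAction b E = X + (E - Complex.I * moment₁ b + (moment₂ b - moment₁ b ^ 2) / (4 * E) +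
      Complex.I * (moment₃ b - moment₁ b * moment₂ b) / (8 * E ^ 2)) := by rw [hX]; ring
    rw [this, s1, s2, e1, e2]
    push_cast
    linear_combination hEe
  have him : y - moment₁ b - σ * y / (4 * a ^ 2) + τ / (8 * a ^ 2) =
      -X.im + (σ / 4) * ((y : ℂ) ^ 2 / (a ^ 2 * E)).im -
      (τ / 8) * (Complex.I * (((y : ℂ) ^ 2 - 2 * y * a * Complex.I) / (a ^ 2 * E ^ 2))).im := by
    have h0 := h.1
    rw [key] at h0
    simp only [Complex.add_im, Complex.sub_im, Complex.im_ofReal_mul, Complex.ofReal_im,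
      Complex.I_im] at h0
    linarith
  have t1 := (Complex.abs_im_le_norm X).trans hXn
  have t2 := (Complex.abs_im_le_norm ((y : ℂ) ^ 2 / (a ^ 2 * E))).trans r1
  have t3 : |(Complex.I * (((y : ℂ) ^ 2 - 2 * y * a * Complex.I) / (a ^ 2 * E ^ 2))).im| ≤
      8 / a ^ 3 := by
    refine (Complex.abs_im_le_norm _).trans ?_
    rwa [norm_mul, Complex.norm_I, one_mul]
  set v := (Complex.I * (((y : ℂ) ^ 2 - 2 * y * a * Complex.I) / (a ^ 2 * E ^ 2))).im
  set u := ((y : ℂ) ^ 2 / (a ^ 2 * E)).im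
  have hfin : y - moment₁ b - curveCoeff b / a ^ 2 =
      -X.im + (σ / 4) * u - (τ / 8) * v + σ * ((y - moment₁ b) / a ^ 2) / 4 := by
    rw [← him, curveCoeff, ← hσ, ← hτ]
    ring
  have t4 : |(y - moment₁ b) / a ^ 2| ≤ 1 / a ^ 3 := by
    rw [abs_div, abs_of_pos (by positivity : 0 < a ^ 2)]
    calc _ ≤ 1 / a / a ^ 2 := by
          gcongr
          exact h1.trans (one_div_le_one_div_of_le ha0 hEn)
      _ = _ := by field_simp
  have p2 : |σ * u| ≤ 2 * (4 / a ^ 3) := by rw [abs_mul]; gcongr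
  have p3 : |τ * v| ≤ 2 * (8 / a ^ 3) := by rw [abs_mul]; gcongr
  have p4 : |σ * ((y - moment₁ b) / a ^ 2)| ≤ 2 * (1 / a ^ 3) := by rw [abs_mul]; gcongr
  have hA : 0 < 1 / a ^ 3 := by positivity
  rw [show 12 / a ^ 3 = 12 * (1 / a ^ 3) by ring] at t1
  rw [show 4 / a ^ 3 = 4 * (1 / a ^ 3) by ring] at p2
  rw [show 8 / a ^ 3 = 8 * (1 / a ^ 3) by ring] at p3
  rw [hfin, show 30 / a ^ 3 = 30 * (1 / a ^ 3) by ring]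
  have q1 := abs_le.1 t1
  have q2 := abs_le.1 p2
  have q3 := abs_le.1 p3
  have q4 := abs_le.1 p4
  rw [abs_le]
  constructor <;> linarith [q1.1, q1.2, q2.1, q2.2, q3.1, q3.2, q4.1, q4.2]

/-- The difference is b times a quadratic in b² with negative discriminant; 29/33 is the minimum of
that quadratic. -/
lemma curveCoeff_sub_neg_ne_zero {b : ℝ} (hb : b ≠ 0) : curveCoeff b - curveCoeff (-b) ≠ 0 := by
  have h : curveCoeff b - curveCoeff (-b) = -b / 3780 * (33 - 58 * b ^ 2 + 33 * b ^ 4) := by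
    simp only [curveCoeff, moment₁, moment₂, moment₃]; ring
  rw [h]
  refine mul_ne_zero (div_ne_zero (neg_ne_zero.2 hb) (by norm_num)) (ne_of_gt ?_)
  nlinarith [sq_nonneg (b ^ 2 - 29 / 33)]

/-- At a common point with real part a, the difference of the two expansions gives m + c/a² =
O(a⁻³). The asymptotes may coincide (m = 0), but if b ≠ 0 then c ≠ 0, and if b = 0 then m = -2s ≠ 0;
either way a is bounded. -/
lemma disjoint_actionCurve_shift {b s : ℝ} (hb : b ∈ Ioo (-1 : ℝ) 1) (h : b ≠ 0 ∨ s ≠ 0) :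
    ∃ R : ℝ, ∀ E : ℂ, R ≤ ‖E‖ → ¬ (E + s * Complex.I ∈ actionCurve quadPotential (-1) b ∧
      E - s * Complex.I ∈ actionCurve quadPotential (-1) ((-b : ℝ) : ℝ)) := by
  have hb1 : b ∈ Ioc (-1 : ℝ) 1 := ⟨hb.1, hb.2.le⟩
  have hb2 : -b ∈ Ioc (-1 : ℝ) 1 := ⟨by linarith [hb.2], by linarith [hb.1]⟩
  set m := moment₁ b - s - (moment₁ (-b) + s) with hm
  set c := curveCoeff b - curveCoeff (-b) with hc
  have hmc : m ≠ 0 ∨ c ≠ 0 := by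
    by_cases hb0 : b = 0
    · left
      have hs := h.resolve_left (not_not.2 hb0)
      rw [hm, hb0, neg_zero]
      intro h0
      apply hs
      linarith
    · exact Or.inr (curveCoeff_sub_neg_ne_zero hb0)
  have main : ∀ E : ℂ, 4000 ≤ E.re → E + s * Complex.I ∈ actionCurve quadPotential (-1) b →
      E - s * Complex.I ∈ actionCurve quadPotential (-1) ((-b : ℝ) : ℝ) →
      |m + c / E.re ^ 2| ≤ 60 / E.re ^ 3 := by
    intro E hE h1 h2
    have k1 := abs_im_sub_curveCoeff_le hb1 (by simpa using hE) h1
    have k2 := abs_im_sub_curveCoeff_le hb2 (by simpa using hE) h2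
    simp only [Complex.add_im, Complex.sub_im, Complex.add_re, Complex.sub_re, Complex.re_ofReal_mul,
      Complex.im_ofReal_mul, Complex.I_re, Complex.I_im, mul_zero, mul_one, add_zero, sub_zero] at k1 k2
    rw [show m + c / E.re ^ 2 = (E.im - s - moment₁ (-b) - curveCoeff (-b) / E.re ^ 2) -
      (E.im + s - moment₁ b - curveCoeff b / E.re ^ 2) by rw [hm, hc]; ring]
    refine (abs_sub _ _).trans ?_
    rw [show 60 / E.re ^ 3 = 30 / E.re ^ 3 + 30 / E.re ^ 3 by ring]
    exact add_le_add k2 k1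
  -- If m = 0, the c/a² term beats 60/a³ once a|c| > 60; otherwise m beats both once a|m| > |c| +
  -- 60.
  have hlim : ∃ A : ℝ, 4000 ≤ A ∧ ∀ a : ℝ, A ≤ a → ¬ |m + c / a ^ 2| ≤ 60 / a ^ 3 := by
    by_cases hm0 : m = 0
    · have hc0 := hmc.resolve_left (not_not.2 hm0)
      have hcp : 0 < |c| := abs_pos.2 hc0
      refine ⟨max 4000 (61 / |c|), le_max_left _ _, fun a ha => ?_⟩
      have ha1 : 4000 ≤ a := (le_max_left _ _).trans ha
      have ha2 := (le_max_right _ _).trans ha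
      rw [div_le_iff₀ hcp] at ha2
      rw [hm0, zero_add, abs_div, abs_of_pos (by positivity : 0 < a ^ 2), not_le,
        div_lt_div_iff₀ (by positivity) (by positivity)]
      have : 0 < a ^ 2 := by positivity
      nlinarith
    · have hmp : 0 < |m| := abs_pos.2 hm0
      refine ⟨max 4000 ((|c| + 61) / |m|), le_max_left _ _, fun a ha => ?_⟩
      have ha1 : 4000 ≤ a := (le_max_left _ _).trans ha
      have ha2 := (le_max_right _ _).trans ha
      rw [div_le_iff₀ hmp] at ha2
      intro hle
      have h1 := abs_sub_abs_le_abs_sub m (-(c / a ^ 2))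
      rw [sub_neg_eq_add, abs_neg, abs_div, abs_of_pos (by positivity : 0 < a ^ 2)] at h1
      have h2 : |c| / a ^ 2 ≤ |c| / a := by gcongr; nlinarith
      have h3 : 60 / a ^ 3 ≤ 60 / a := by gcongr; nlinarith [sq_nonneg a, mul_self_nonneg a]
      have h4 : |m| ≤ (|c| + 60) / a := by rw [add_div]; linarith
      rw [le_div_iff₀ (by linarith)] at h4
      linarith
  obtain ⟨A, hA, hA'⟩ := hlim
  refine ⟨A + 2 + |s|, fun E hE ⟨h1, h2⟩ => ?_⟩
  have hn : A + 2 ≤ ‖E + s * Complex.I‖ := by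
    have := norm_sub_norm_le E (-(s * Complex.I))
    rw [norm_neg, norm_mul, Complex.norm_I, mul_one, Complex.norm_real, Real.norm_eq_abs,
      sub_neg_eq_add] at this
    linarith
  have hre := le_re_of_mem_actionCurve hb1 (by linarith) hn h1
  have hre' : A ≤ E.re := by simpa using hre
  exact hA' E.re hre' (main E (hA.trans hre') h1 h2)

/-! ### Regularity and uniqueness for functions of the Dirichlet domain. -/

lemma hasDerivAt_shootSol (h : ℝ) (E : ℂ) (x : ℝ) :
    HasDerivAt (fun x : ℝ => shootSol h E x) (shootDeriv h E x) x :=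
  (hasDerivAt_leftSol _ _ (x : ℂ)).comp_ofReal

lemma hasDerivAt_shootDeriv (h : ℝ) (E : ℂ) (x : ℝ) :
    HasDerivAt (fun x : ℝ => shootDeriv h E x)
      ((Complex.I * (x : ℂ) ^ 2 - E) / (h : ℂ) ^ 2 * shootSol h E x) x := by
  have := (hasDerivAt_leftSolDeriv (Complex.I / (h : ℂ) ^ 2) (-E / (h : ℂ) ^ 2) (x : ℂ)).comp_ofReal
  convert! this using 1
  rw [shootSol]; ring

lemma hasDerivAt_shootSol_neg (h : ℝ) (E : ℂ) (x : ℝ) :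
    HasDerivAt (fun x : ℝ => shootSol h E (-x)) (-shootDeriv h E (-x)) x := by
  have := (hasDerivAt_leftSol (Complex.I / (h : ℂ) ^ 2) (-E / (h : ℂ) ^ 2) (-(x : ℂ)))
  have h2 := (this.comp (x : ℂ) (hasDerivAt_neg (x : ℂ))).comp_ofReal
  convert! h2 using 1
  rw [shootDeriv]; ring

lemma hasDerivAt_shootDeriv_neg (h : ℝ) (E : ℂ) (x : ℝ) :
    HasDerivAt (fun x : ℝ => -shootDeriv h E (-x))
      ((Complex.I * (x : ℂ) ^ 2 - E) / (h : ℂ) ^ 2 * shootSol h E (-x)) x := by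
  have := (hasDerivAt_leftSolDeriv (Complex.I / (h : ℂ) ^ 2) (-E / (h : ℂ) ^ 2) (-(x : ℂ)))
  have h2 := (this.comp (x : ℂ) (hasDerivAt_neg (x : ℂ))).comp_ofReal.neg
  convert! h2 using 1
  rw [shootSol]; ring

section Domain

variable {u v w : ℝ → ℂ}

lemma InDirichletDomain.intervalIntegrable (hd : InDirichletDomain u v w) {c d : ℝ}
    (hc : c ∈ Icc (-1 : ℝ) 1) (hd' : d ∈ Icc (-1 : ℝ) 1) : IntervalIntegrable w volume c d := by
  have h : IntegrableOn w (Icc (-1) 1) volume := hd.memLp.integrable (by norm_num)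
  exact (h.mono_set (uIcc_subset_Icc hc hd')).intervalIntegrable

lemma InDirichletDomain.continuousOn_deriv (hd : InDirichletDomain u v w) :
    ContinuousOn v (Icc (-1) 1) := by
  have h : IntegrableOn w (Icc (-1) 1) volume := hd.memLp.integrable (by norm_num)
  have h1 := intervalIntegral.continuousOn_primitive_interval (a := -1) (b := 1) (f := w)
    (by rwa [uIcc_of_le (by norm_num)])
  rw [uIcc_of_le (by norm_num)] at h1
  exact (continuousOn_const.add h1).congr fun x hx => hd.deriv_primitive x hx

lemma InDirichletDomain.hasDerivAt (hd : InDirichletDomain u v w) {x : ℝ}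
    (hx : x ∈ Ioo (-1 : ℝ) 1) : HasDerivAt u (v x) x := by
  have hv := hd.continuousOn_deriv
  have hmem : Icc (-1 : ℝ) 1 ∈ 𝓝 x := Icc_mem_nhds hx.1 hx.2
  have h1 : HasDerivAt (fun x => ∫ s in (-1 : ℝ)..x, v s) (v x) x := by
    refine intervalIntegral.integral_hasDerivAt_right ?_ ?_ (hv.continuousAt hmem)
    · refine (hv.mono ?_).intervalIntegrable
      exact uIcc_subset_Icc (by norm_num) ⟨hx.1.le, hx.2.le⟩
    · exact hv.stronglyMeasurableAtFilter_nhdsWithin measurableSet_Icc x |>.filter_mono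
        (by rw [nhdsWithin_eq_nhds.2 hmem])
  refine (h1.const_add (u (-1))).congr_of_eventuallyEq ?_
  filter_upwards [hmem] with y hy using hd.primitive y hy

lemma InDirichletDomain.continuousOn (hd : InDirichletDomain u v w) : ContinuousOn u (Icc (-1) 1) := by
  have hv := hd.continuousOn_deriv
  have h1 := intervalIntegral.continuousOn_primitive_interval (a := -1) (b := 1) (f := v) (μ := volume)
    (by rw [uIcc_of_le (by norm_num)]; exact hv.integrableOn_Icc)
  rw [uIcc_of_le (by norm_num)] at h1
  exact (continuousOn_const.add h1).congr fun x hx => hd.primitive x hx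

variable {c d : ℝ} {K : ℝ → ℂ}

/-- On a subinterval where the weak second derivative agrees almost everywhere with a continuous
function, its primitive is classically differentiable. The subinterval matters because the perturbed
potential jumps at β. -/
lemma InDirichletDomain.hasDerivAt_deriv (hd : InDirichletDomain u v w) (hc : -1 ≤ c) (hd' : d ≤ 1)
    (hK : Continuous K)
    (hw : ∀ᵐ x ∂(volume.restrict (Icc (-1 : ℝ) 1)), x ∈ Ioo c d → w x = K x * u x) {x : ℝ}
    (hx : x ∈ Ioo c d) : HasDerivAt v (K x * u x) x := by
  have hxm : x ∈ Ioo (-1 : ℝ) 1 := ⟨hc.trans_lt hx.1, hx.2.trans_le hd'⟩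
  have hsub : Ioo c d ⊆ Icc (-1 : ℝ) 1 := fun y hy => ⟨hc.trans hy.1.le, hy.2.le.trans hd'⟩
  have hmem : Ioo c d ∈ 𝓝 x := Ioo_mem_nhds hx.1 hx.2
  have hcont : ContinuousOn (fun y => K y * u y) (Ioo c d) :=
    hK.continuousOn.mul (hd.continuousOn.mono hsub)
  have h1 : HasDerivAt (fun y => ∫ s in x..y, K s * u s) (K x * u x) x := by
    refine intervalIntegral.integral_hasDerivAt_right (by simp) ?_ (hcont.continuousAt hmem)
    exact hcont.stronglyMeasurableAtFilter isOpen_Ioo x hx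
  refine (h1.const_add (v x)).congr_of_eventuallyEq ?_
  filter_upwards [hmem] with y hy
  have hxI : x ∈ Icc (-1 : ℝ) 1 := hsub hx
  have hyI := hsub hy
  have e : ∫ s in x..y, K s * u s = ∫ s in x..y, w s := by
    refine intervalIntegral.integral_congr_ae ?_
    rw [ae_restrict_iff' measurableSet_Icc] at hw
    filter_upwards [hw] with s hs hsm
    have : s ∈ Ioo c d := by
      have := uIoc_subset_uIcc hsm
      exact (ordConnected_Ioo.uIcc_subset hx hy) this
    exact (hs (hsub this) this).symm
  rw [e, hd.deriv_primitive y hyI, hd.deriv_primitive x hxI, add_assoc,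
    intervalIntegral.integral_add_adjacent_intervals (hd.intervalIntegrable (by norm_num) hxI)
    (hd.intervalIntegrable hxI hyI)]

/-- The equation is used only inside (c, d), but continuity of u and v carries the identity to the
closed interval, so that the values at β and at ±1 can be compared. -/
lemma InDirichletDomain.wronskian_const (hd : InDirichletDomain u v w) (hc : -1 ≤ c) (hd' : d ≤ 1)
    (hK : Continuous K)
    (hw : ∀ᵐ x ∂(volume.restrict (Icc (-1 : ℝ) 1)), x ∈ Ioo c d → w x = K x * u x)
    {y y' : ℝ → ℂ} (hy : ∀ x, HasDerivAt y (y' x) x) (hy' : ∀ x, HasDerivAt y' (K x * y x) x)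
    {p q : ℝ} (hp : p ∈ Icc c d) (hq : q ∈ Icc c d) :
    u p * y' p - v p * y p = u q * y' q - v q * y q := by
  have hyc : Continuous y := continuous_iff_continuousAt.2 fun x => (hy x).continuousAt
  have hyc' : Continuous y' := continuous_iff_continuousAt.2 fun x => (hy' x).continuousAt
  wlog hpq : p ≤ q generalizing p q
  · exact (this hq hp (le_of_not_ge hpq)).symm
  have hsub : Icc p q ⊆ Icc (-1 : ℝ) 1 := Icc_subset_Icc (hc.trans hp.1) (hq.2.trans hd')
  have := intervalIntegral.integral_eq_sub_of_hasDerivAt_of_le hpq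
    (f := fun x => u x * y' x - v x * y x) (f' := fun _ => 0) ?_ (fun x hx => ?_)
    intervalIntegrable_const
  · simp only [intervalIntegral.integral_zero] at this
    exact (sub_eq_zero.1 this.symm).symm
  · exact ((hd.continuousOn.mono hsub).mul hyc'.continuousOn).sub
      ((hd.continuousOn_deriv.mono hsub).mul hyc.continuousOn)
  · have hxcd : x ∈ Ioo c d := ⟨hp.1.trans_lt hx.1, hx.2.trans_le hq.2⟩
    have h1 := hd.hasDerivAt (x := x) ⟨hc.trans_lt hxcd.1, hxcd.2.trans_le hd'⟩
    have h2 := hd.hasDerivAt_deriv hc hd' hK hw hxcd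
    have := (h1.mul (hy' x)).sub (h2.mul (hy x))
    convert! this using 1
    ring

/-- The Wronskians of u with the even and the odd solution vanish at p, hence at q; as those two
solutions have Wronskian 1, u(q) can be solved for. -/
lemma InDirichletDomain.eq_zero_of_cauchy (hd : InDirichletDomain u v w) (hc : -1 ≤ c) (hd' : d ≤ 1)
    {α κ : ℂ}
    (hw : ∀ᵐ x ∂(volume.restrict (Icc (-1 : ℝ) 1)), x ∈ Ioo c d → w x = (α * (x : ℂ) ^ 2 + κ) * u x)
    {p q : ℝ} (hp : p ∈ Icc c d) (hq : q ∈ Icc c d) (hu : u p = 0) (hv : v p = 0) : u q = 0 := by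
  have key : ∀ e ≤ 1, u q * weberSolDeriv e α κ q = v q * weberSol e α κ q := by
    intro e he
    have := hd.wronskian_const hc hd' (K := fun x : ℝ => α * (x : ℂ) ^ 2 + κ) (by fun_prop) hw
      (y := fun x => weberSol e α κ x) (y' := fun x => weberSolDeriv e α κ x)
      (fun x => (hasDerivAt_weberSol he α κ (x : ℂ)).comp_ofReal)
      (fun x => (hasDerivAt_weberSolDeriv he α κ (x : ℂ)).comp_ofReal) hp hq
    rw [hu, hv] at this
    linear_combination -this
  linear_combination (-u q) * weber_wronskian α κ q + weberSol 0 α κ q * key 1 le_rfl -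
    weberSol 1 α κ q * key 0 zero_le_one

end Domain

/-! ### Eigenvalues as zeros of the matching function. -/

/-- The Wronskian at the junction of the two Dirichlet solutions; `E₁, b₁` are the energy and the
junction for the left part, `E₂, b₂` those of the reflected right part. -/
noncomputable def matching (h : ℝ) (E₁ : ℂ) (b₁ : ℝ) (E₂ : ℂ) (b₂ : ℝ) : ℂ :=
  shootSol h E₁ b₁ * shootDeriv h E₂ b₂ + shootDeriv h E₁ b₁ * shootSol h E₂ b₂

lemma matching_comm (h : ℝ) (E₁ : ℂ) (b₁ : ℝ) (E₂ : ℂ) (b₂ : ℝ) :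
    matching h E₁ b₁ E₂ b₂ = matching h E₂ b₂ E₁ b₁ := by
  rw [matching, matching]; ring

lemma shootSol_eq_zero_of_eigenvalue {h : ℝ} (h0 : 0 < h) {E : ℂ}
    (hE : E ∈ dirichletEigenvalues quadPotential h) : shootSol h E (1 : ℝ) = 0 := by
  obtain ⟨u, v, w, hd, ⟨x, hx, hux⟩, hode⟩ := hE
  have hhc : (h : ℂ) ≠ 0 := by exact_mod_cast h0.ne'
  have hw : ∀ᵐ x ∂(volume.restrict (Icc (-1 : ℝ) 1)), x ∈ Ioo (-1 : ℝ) 1 →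
      w x = (Complex.I / (h : ℂ) ^ 2 * (x : ℂ) ^ 2 + -E / (h : ℂ) ^ 2) * u x := by
    filter_upwards [hode] with x hx _
    rw [quadPotential] at hx
    field_simp
    linear_combination -hx
  have hW := hd.wronskian_const le_rfl le_rfl (by fun_prop) hw
    (y := fun x => shootSol h E x) (y' := fun x => shootDeriv h E x)
    (hasDerivAt_shootSol h E) (fun x => by
      convert! hasDerivAt_shootDeriv h E x using 1; ring) (p := -1) (q := 1) (by norm_num) (by norm_num)
  rw [hd.left, hd.right] at hW
  have h1 : shootSol h E ((-1 : ℝ) : ℂ) = 0 := by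
    rw [shootSol]; push_cast; exact leftSol_neg_one _ _
  rw [h1] at hW
  have h2 : v 1 * shootSol h E (1 : ℝ) = 0 := by linear_combination hW
  rcases mul_eq_zero.1 h2 with hv | h3
  · exact absurd (hd.eq_zero_of_cauchy le_rfl le_rfl hw (p := 1) (by norm_num) hx hd.right hv) hux
  · exact h3

/-- On each side u has zero Wronskian with the solution vanishing at that end. If the two solutions
were independent at β, both u(β) and v(β) would vanish, and uniqueness would give u = 0. -/
lemma matching_eq_zero_of_eigenvalue {h δ β : ℝ} (h0 : 0 < h) (hβ : β ∈ Ioo (-1 : ℝ) 1) {E : ℂ}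
    (hE : E ∈ dirichletEigenvalues (perturbedPotential δ β) h) :
    matching h (E + δ * Complex.I) β (E - δ * Complex.I) ((-β : ℝ)) = 0 := by
  obtain ⟨u, v, w, hd, ⟨x, hx, hux⟩, hode⟩ := hE
  have hhc : (h : ℂ) ≠ 0 := by exact_mod_cast h0.ne'
  set El := E + δ * Complex.I with hEl
  set Er := E - δ * Complex.I with hEr
  have hwl : ∀ᵐ x ∂(volume.restrict (Icc (-1 : ℝ) 1)), x ∈ Ioo (-1 : ℝ) β →
      w x = (Complex.I / (h : ℂ) ^ 2 * (x : ℂ) ^ 2 + -El / (h : ℂ) ^ 2) * u x := by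
    filter_upwards [hode] with x hx hx1
    rw [perturbedPotential, if_neg (not_lt.2 hx1.2.le), quadPotential] at hx
    rw [hEl]
    field_simp
    linear_combination -hx
  have hwr : ∀ᵐ x ∂(volume.restrict (Icc (-1 : ℝ) 1)), x ∈ Ioo β 1 →
      w x = (Complex.I / (h : ℂ) ^ 2 * (x : ℂ) ^ 2 + -Er / (h : ℂ) ^ 2) * u x := by
    filter_upwards [hode] with x hx hx1
    rw [perturbedPotential, if_pos hx1.1, quadPotential] at hx
    rw [hEr]
    field_simp
    linear_combination -hx
  have hWl := hd.wronskian_const le_rfl hβ.2.le (by fun_prop) hwl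
    (y := fun x => shootSol h El x) (y' := fun x => shootDeriv h El x)
    (hasDerivAt_shootSol h El) (fun x => by
      convert! hasDerivAt_shootDeriv h El x using 1; ring) (p := -1) (q := β)
      ⟨le_rfl, hβ.1.le⟩ ⟨hβ.1.le, le_rfl⟩
  have hWr := hd.wronskian_const hβ.1.le le_rfl (by fun_prop) hwr
    (y := fun x => shootSol h Er (-x)) (y' := fun x => -shootDeriv h Er (-x))
    (hasDerivAt_shootSol_neg h Er) (fun x => by
      convert! hasDerivAt_shootDeriv_neg h Er x using 1; ring) (p := 1) (q := β)
      ⟨hβ.2.le, le_rfl⟩ ⟨le_rfl, hβ.2.le⟩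
  have e1 : ∀ E, shootSol h E ((-1 : ℝ) : ℂ) = 0 := fun E => by
    rw [shootSol]; push_cast; exact leftSol_neg_one _ _
  have e2 : shootSol h Er (-((1 : ℝ) : ℂ)) = 0 := by
    rw [← Complex.ofReal_neg]; exact e1 Er
  simp only [hd.left, hd.right, e1, e2] at hWl hWr
  rw [matching, Complex.ofReal_neg]
  -- Cramer's rule for the homogeneous system of the two Wronskian relations in the unknowns u(β),
  -- v(β).
  have k1 : u β * matching h El β Er ((-β : ℝ)) = 0 := by
    rw [matching, Complex.ofReal_neg]
    linear_combination (-shootSol h Er (-β)) * hWl + shootSol h El β * hWr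
  have k2 : v β * matching h El β Er ((-β : ℝ)) = 0 := by
    rw [matching, Complex.ofReal_neg]
    linear_combination shootDeriv h Er (-β) * hWl + shootDeriv h El β * hWr
  rw [matching, Complex.ofReal_neg] at k1 k2
  by_contra hne
  have hu := (mul_eq_zero.1 k1).resolve_right hne
  have hv := (mul_eq_zero.1 k2).resolve_right hne
  apply hux
  rcases le_total x β with hxb | hxb
  · exact hd.eq_zero_of_cauchy le_rfl hβ.2.le hwl (p := β) ⟨hβ.1.le, le_rfl⟩ ⟨hx.1, hxb⟩ hu hv
  · exact hd.eq_zero_of_cauchy hβ.1.le le_rfl hwr (p := β) ⟨le_rfl, hβ.2.le⟩ ⟨hxb, hx.2⟩ hu hv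

/-- A continuous gluing of two `C¹` functions is a primitive of the glued derivatives. -/
lemma ite_eq_add_integral {f g f' g' : ℝ → ℂ} (hf : ∀ x, HasDerivAt f (f' x) x)
    (hg : ∀ x, HasDerivAt g (g' x) x) (hf' : Continuous f') (hg' : Continuous g') {β : ℝ}
    (hfg : f β = g β) (a x : ℝ) :
    (if x ≤ β then f x else g x) = (if a ≤ β then f a else g a) +
      ∫ s in a..x, if s ≤ β then f' s else g' s := by
  have hfc : Continuous f := continuous_iff_continuousAt.2 fun x => (hf x).continuousAt
  have hgc : Continuous g := continuous_iff_continuousAt.2 fun x => (hg x).continuousAt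
  have hcont : Continuous fun x => if x ≤ β then f x else g x :=
    hfc.if_le hgc continuous_id continuous_const fun x hx => by rw [hx, hfg]
  have hint : IntervalIntegrable (fun s => if s ≤ β then f' s else g' s) volume a x := by
    rw [intervalIntegrable_iff]
    refine Integrable.piecewise (s := Iic β) measurableSet_Iic ?_ ?_
    · exact (intervalIntegrable_iff.1 (hf'.intervalIntegrable a x)).integrableOn
    · exact (intervalIntegrable_iff.1 (hg'.intervalIntegrable a x)).integrableOn
  have := integral_eq_of_hasDerivAt_off_countable (fun x => if x ≤ β then f x else g x)
    (fun s => if s ≤ β then f' s else g' s) (countable_singleton β) hcont.continuousOn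
    (a := a) (b := x) ?_ hint
  · rw [this]; ring
  · rintro s ⟨-, hs⟩
    rcases lt_or_gt_of_ne (show s ≠ β from hs) with h | h
    · simp only [if_pos h.le]
      refine (hf s).congr_of_eventuallyEq ?_
      filter_upwards [gt_mem_nhds h] with t ht using if_pos ht.le
    · simp only [if_neg (not_le.2 h)]
      refine (hg s).congr_of_eventuallyEq ?_
      filter_upwards [lt_mem_nhds h] with t ht using if_neg (not_le.2 ht)

lemma exists_shootSol_ne_zero (h : ℝ) (E : ℂ) {b : ℝ} (hb : -1 < b) :
    ∃ x ∈ Ioo (-1 : ℝ) b, shootSol h E x ≠ 0 := by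
  by_contra! hcon
  have h1 := (hasDerivAt_shootSol h E (-1)).hasDerivWithinAt (s := Ioo (-1) b)
  have h2 : HasDerivWithinAt (fun x : ℝ => shootSol h E x) 0 (Ioo (-1) b) (-1) := by
    refine (hasDerivWithinAt_const (-1 : ℝ) (Ioo (-1) b) (0 : ℂ)).congr (fun x hx => hcon x hx) ?_
    rw [shootSol]; push_cast; exact leftSol_neg_one _ _
  have huniq : UniqueDiffWithinAt ℝ (Ioo (-1) b) (-1) :=
    uniqueDiffWithinAt_convex (convex_Ioo _ _) (by rw [interior_Ioo]; exact nonempty_Ioo.2 hb)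
      (by rw [closure_Ioo hb.ne]; exact ⟨le_rfl, hb.le⟩)
  have := huniq.eq_deriv _ h1 h2
  rw [shootDeriv] at this
  push_cast at this
  rw [leftSolDeriv_neg_one] at this
  exact one_ne_zero this

/-- A vanishing Wronskian lets multiples of the two solutions be glued at β with matching value and
derivative; the glued function lies in the domain because its second derivative is bounded. -/
lemma eigenvalue_of_matching_eq_zero {h δ β : ℝ} (h0 : 0 < h) (hβ : β ∈ Ioo (-1 : ℝ) 1) {E : ℂ}
    (hm : matching h (E + δ * Complex.I) β (E - δ * Complex.I) ((-β : ℝ)) = 0) :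
    E ∈ dirichletEigenvalues (perturbedPotential δ β) h := by
  have hhc : (h : ℂ) ≠ 0 := by exact_mod_cast h0.ne'
  set El := E + δ * Complex.I with hEl
  set Er := E - δ * Complex.I with hEr
  rw [matching, Complex.ofReal_neg] at hm
  -- A nontrivial pair from proportional Cauchy data: normally the cross values, and the cross
  -- derivatives if both solutions vanish at β.
  have hcc : ∃ c₁ c₂ : ℂ, (c₁ ≠ 0 ∨ c₂ ≠ 0) ∧ c₁ * shootSol h El β = c₂ * shootSol h Er (-β) ∧
      c₁ * shootDeriv h El β = -(c₂ * shootDeriv h Er (-β)) := by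
    by_cases h1 : shootSol h El β = 0 ∧ shootSol h Er (-β) = 0
    · by_cases h2 : shootDeriv h El β = 0
      · exact ⟨1, 0, Or.inl one_ne_zero, by rw [h1.1]; ring, by rw [h2]; ring⟩
      · exact ⟨shootDeriv h Er (-β), -shootDeriv h El β, Or.inr (neg_ne_zero.2 h2),
          by rw [h1.1, h1.2]; ring, by ring⟩
    · refine ⟨shootSol h Er (-β), shootSol h El β, ?_, by ring, by linear_combination hm⟩
      by_contra! hcon
      exact h1 ⟨hcon.2, hcon.1⟩
  obtain ⟨c₁, c₂, hc, hm1, hm2⟩ := hcc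
  have cl : Continuous fun x : ℝ => shootSol h El x :=
    continuous_iff_continuousAt.2 fun x => (hasDerivAt_shootSol h El x).continuousAt
  have cl' : Continuous fun x : ℝ => shootDeriv h El x :=
    continuous_iff_continuousAt.2 fun x => (hasDerivAt_shootDeriv h El x).continuousAt
  have cr : Continuous fun x : ℝ => shootSol h Er (-x) :=
    continuous_iff_continuousAt.2 fun x => (hasDerivAt_shootSol_neg h Er x).continuousAt
  have cr' : Continuous fun x : ℝ => -shootDeriv h Er (-x) :=
    continuous_iff_continuousAt.2 fun x => (hasDerivAt_shootDeriv_neg h Er x).continuousAt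
  set wl : ℝ → ℂ := fun x => c₁ * ((Complex.I * (x : ℂ) ^ 2 - El) / (h : ℂ) ^ 2 * shootSol h El x)
    with hwl
  set wr : ℝ → ℂ := fun x => c₂ * ((Complex.I * (x : ℂ) ^ 2 - Er) / (h : ℂ) ^ 2 * shootSol h Er (-x))
    with hwr
  have cwl : Continuous wl := by fun_prop
  have cwr : Continuous wr := by fun_prop
  refine ⟨fun x => if x ≤ β then c₁ * shootSol h El x else c₂ * shootSol h Er (-x),
    fun x => if x ≤ β then c₁ * shootDeriv h El x else c₂ * -shootDeriv h Er (-x),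
    fun x => if x ≤ β then wl x else wr x, ⟨?_, ?_, ?_, ?_, ?_⟩, ?_, ?_⟩
  · obtain ⟨C1, hC1⟩ := isCompact_Icc.exists_bound_of_continuousOn (s := Icc (-1 : ℝ) 1) cwl.continuousOn
    obtain ⟨C2, hC2⟩ := isCompact_Icc.exists_bound_of_continuousOn (s := Icc (-1 : ℝ) 1) cwr.continuousOn
    refine MemLp.of_bound (Measurable.aestronglyMeasurable ?_) (max C1 C2) ?_
    · exact Measurable.ite measurableSet_Iic cwl.measurable cwr.measurable
    · rw [ae_restrict_iff' measurableSet_Icc]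
      refine Eventually.of_forall fun x hx => ?_
      split_ifs
      · exact (hC1 x hx).trans (le_max_left _ _)
      · exact (hC2 x hx).trans (le_max_right _ _)
  · intro x _
    exact ite_eq_add_integral (fun x => (hasDerivAt_shootDeriv h El x).const_mul c₁)
      (fun x => (hasDerivAt_shootDeriv_neg h Er x).const_mul c₂) cwl cwr
      (by rw [hm2]; ring) (-1) x
  · intro x _
    exact ite_eq_add_integral (fun x => (hasDerivAt_shootSol h El x).const_mul c₁)
      (fun x => (hasDerivAt_shootSol_neg h Er x).const_mul c₂) (cl'.const_mul c₁) (cr'.const_mul c₂)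
      hm1 (-1) x
  · simp only [if_pos hβ.1.le]
    rw [shootSol]; push_cast; rw [leftSol_neg_one]; ring
  · simp only [if_neg (not_le.2 hβ.2)]
    rw [shootSol]; push_cast; rw [leftSol_neg_one]; ring
  · rcases hc with hc | hc
    · obtain ⟨x, hx, hne⟩ := exists_shootSol_ne_zero h El hβ.1
      refine ⟨x, ⟨hx.1.le, hx.2.le.trans hβ.2.le⟩, ?_⟩
      simp only [if_pos hx.2.le]
      exact mul_ne_zero hc hne
    · obtain ⟨x, hx, hne⟩ := exists_shootSol_ne_zero h Er (b := -β) (by linarith [hβ.2])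
      refine ⟨-x, ⟨by linarith [hx.2, hβ.1], by linarith [hx.1]⟩, ?_⟩
      simp only [if_neg (not_le.2 (by linarith [hx.2] : β < -x))]
      rw [Complex.ofReal_neg, neg_neg]
      exact mul_ne_zero hc hne
  · refine Eventually.of_forall fun x => ?_
    by_cases hx : x ≤ β
    · simp only [if_pos hx, perturbedPotential, if_neg (not_lt.2 hx), quadPotential, hwl]
      field_simp
      rw [hEl]; ring
    · simp only [if_neg hx, perturbedPotential, if_pos (not_le.1 hx), quadPotential, hwr]
      field_simp
      rw [hEr]; ring

/-! ### The normalized matching function and its limit form. -/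

/-- The momentum `√(i b² - E)` at the endpoint. -/
noncomputable def endMomentum (b : ℝ) (E k : ℂ) : ℂ := Complex.I * k * momentum E b

/-- The junctions β and -β have the same square, so for the two parts p² - q² = -2iδ. This is where
the jump of the potential enters. -/
lemma endMomentum_sq {b : ℝ} {E k : ℂ} (hE : E ≠ 0) (hk : k ^ 2 = E) :
    endMomentum b E k ^ 2 = Complex.I * (b : ℂ) ^ 2 - E := by
  rw [endMomentum, mul_pow, mul_pow, momentum_sq, Complex.I_sq, hk, radicand]
  field_simp
  ring

lemma norm_endMomentum_le {b : ℝ} (hb : b ∈ Ioc (-1 : ℝ) 1) {E k : ℂ} (hE : 1000 ≤ ‖E‖)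
    (hk : k ^ 2 = E) : ‖endMomentum b E k‖ ≤ 2 * ‖E‖ := by
  have hkn : ‖k‖ ^ 2 = ‖E‖ := by rw [← norm_pow, hk]
  have hk1 : ‖k‖ ≤ ‖E‖ := by nlinarith [norm_nonneg k]
  have hr : ‖momentum E b‖ ≤ 2 := by
    have := norm_le_norm_sub_add (momentum E b) 1
    have h2 := norm_momentum_sub_one_le hE (norm_ofReal_le_eight hb right_mem_uIcc)
    rw [norm_one] at this; linarith
  rw [endMomentum, norm_mul, norm_mul, Complex.norm_I, one_mul]
  nlinarith [norm_nonneg k, norm_nonneg (momentum E b)]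

/-- With x = exp(-2l) and y = exp(-2r), the left side is q(1-x)(1+y) + p(1+x)(1-y). -/
lemma exp_matching_identity (p q l r : ℂ) :
    4 * Complex.exp (-l - r) * (Complex.sinh l * (q * Complex.cosh r) +
      p * Complex.cosh l * Complex.sinh r) =
    (p + q) * (1 - Complex.exp (-2 * l) * Complex.exp (-2 * r)) +
      (p - q) * (Complex.exp (-2 * l) - Complex.exp (-2 * r)) := by
  have e1 : Complex.exp (-l - r) = Complex.exp (-l) * Complex.exp (-r) := by
    rw [← Complex.exp_add]; ring_nf
  have e2 : ∀ z : ℂ, Complex.exp (-2 * z) = Complex.exp (-z) ^ 2 := fun z => by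
    rw [← Complex.exp_nat_mul]; ring_nf
  have e3 : ∀ z : ℂ, Complex.exp z * Complex.exp (-z) = 1 := fun z => by
    rw [← Complex.exp_add]; simp
  rw [e1, e2, e2, Complex.sinh, Complex.sinh, Complex.cosh, Complex.cosh]
  set X := Complex.exp l
  set Y := Complex.exp (-l)
  set Z := Complex.exp r
  set W := Complex.exp (-r)
  have hX : X * Y = 1 := e3 l
  have hZ : Z * W = 1 := e3 r
  linear_combination (q * (Z * W + W ^ 2) + p * (Z * W - W ^ 2)) * hX +
    (q * (1 - Y ^ 2) + p * (1 + Y ^ 2)) * hZ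

/-- The matching function, normalized so as to be of order one. -/
noncomputable def normMatching (h : ℝ) (b₁ : ℝ) (E₁ k₁ : ℂ) (b₂ : ℝ) (E₂ k₂ : ℂ) : ℂ :=
  4 * Complex.exp (-(Complex.I * k₁ * action b₁ E₁ / h) - Complex.I * k₂ * action b₂ E₂ / h) *
    (wkbNormal b₁ E₁ k₁ * wkbNormal b₂ E₂ k₂ * matching h E₁ b₁ E₂ b₂ / h)

/-- Insert the two WKB approximations into the Wronskian; every error term carries h exp(|Re l| +
|Re r|), and the normalizing exponential turns this into factors equal to 1 when Re l and Re r are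
nonnegative. -/
lemma norm_normMatching_sub_le {b₁ b₂ : ℝ} (hb₁ : b₁ ∈ Ioc (-1 : ℝ) 1) (hb₂ : b₂ ∈ Ioc (-1 : ℝ) 1) :
    ∃ C h₀ : ℝ, 0 < C ∧ 0 < h₀ ∧ ∀ h : ℝ, 0 < h → h ≤ h₀ → ∀ E₁ E₂ k₁ k₂ : ℂ, 1000 ≤ ‖E₁‖ →
      1000 ≤ ‖E₂‖ → k₁ ^ 2 = E₁ → k₂ ^ 2 = E₂ → ∀ l r p q : ℂ,
      l = Complex.I * k₁ * action b₁ E₁ / h → r = Complex.I * k₂ * action b₂ E₂ / h →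
      p = endMomentum b₁ E₁ k₁ → q = endMomentum b₂ E₂ k₂ →
      ‖normMatching h b₁ E₁ k₁ b₂ E₂ k₂ -
        ((p + q) * (1 - Complex.exp (-2 * l) * Complex.exp (-2 * r)) +
        (p - q) * (Complex.exp (-2 * l) - Complex.exp (-2 * r)))‖ ≤
      C * h * (1 + ‖p‖ + ‖q‖) * (Real.exp (|l.re| - l.re) * Real.exp (|r.re| - r.re)) := by
  have p1 : 0 < b₁ + 1 := by linarith [hb₁.1]
  have p2 : 0 < b₂ + 1 := by linarith [hb₂.1]
  set C := 8 / (b₁ + 1) + 8 / (b₂ + 1) with hC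
  have hC0 : 0 < C := by positivity
  refine ⟨4 * (2 * C + 2 * C ^ 2), min 1 (min ((b₁ + 1) / 4) ((b₂ + 1) / 4)), by positivity,
    by positivity, ?_⟩
  intro h h0 hh E₁ E₂ k₁ k₂ hE₁ hE₂ hk₁ hk₂ l r p q hl hr hp hq
  have hh1 : h ≤ 1 := hh.trans (min_le_left _ _)
  obtain ⟨u1, v1⟩ := wkb_estimate hE₁ hb₁ hk₁ h0
    (hh.trans ((min_le_right _ _).trans (min_le_left _ _)))
  obtain ⟨u2, v2⟩ := wkb_estimate hE₂ hb₂ hk₂ h0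
    (hh.trans ((min_le_right _ _).trans (min_le_right _ _)))
  rw [← hl] at u1 v1
  rw [← hr] at u2 v2
  change ‖_ - endMomentum b₁ E₁ k₁ * _‖ ≤ _ at v1
  change ‖_ - endMomentum b₂ E₂ k₂ * _‖ ≤ _ at v2
  rw [← hp] at v1
  rw [← hq] at v2
  have hhc : (h : ℂ) ≠ 0 := by exact_mod_cast h0.ne'
  have c1 : 4 / (b₁ + 1) ≤ C ∧ 8 / (b₁ + 1) ≤ C := by
    have : 0 < 8 / (b₂ + 1) := by positivity
    have e : 8 / (b₁ + 1) = 2 * (4 / (b₁ + 1)) := by ring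
    have : 0 < 4 / (b₁ + 1) := by positivity
    constructor <;> rw [hC] <;> linarith
  have c2 : 4 / (b₂ + 1) ≤ C ∧ 8 / (b₂ + 1) ≤ C := by
    have : 0 < 8 / (b₁ + 1) := by positivity
    have e : 8 / (b₂ + 1) = 2 * (4 / (b₂ + 1)) := by ring
    have : 0 < 4 / (b₂ + 1) := by positivity
    constructor <;> rw [hC] <;> linarith
  set el := Real.exp |l.re| with hel
  set er := Real.exp |r.re| with her
  have hel0 : 0 < el := Real.exp_pos _
  have her0 : 0 < er := Real.exp_pos _
  have sl : ‖Complex.sinh l‖ ≤ el := by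
    simpa using norm_sinh_mul_le (lam := l) (s := 1) zero_le_one
  have sr : ‖Complex.sinh r‖ ≤ er := by
    simpa using norm_sinh_mul_le (lam := r) (s := 1) zero_le_one
  have cl : ‖Complex.cosh l‖ ≤ el := by
    simpa using norm_cosh_mul_le (lam := l) (s := 1) zero_le_one
  have cr : ‖Complex.cosh r‖ ≤ er := by
    simpa using norm_cosh_mul_le (lam := r) (s := 1) zero_le_one
  set a1 := wkbNormal b₁ E₁ k₁ * shootSol h E₁ b₁ / h - Complex.sinh l with ha1
  set a2 := wkbNormal b₂ E₂ k₂ * shootSol h E₂ b₂ / h - Complex.sinh r with ha2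
  set d1 := wkbNormal b₁ E₁ k₁ * shootDeriv h E₁ b₁ - p * Complex.cosh l with hd1
  set d2 := wkbNormal b₂ E₂ k₂ * shootDeriv h E₂ b₂ - q * Complex.cosh r with hd2
  have A1 : ‖a1‖ ≤ C * h * el := u1.trans (by gcongr; exact c1.1)
  have A2 : ‖a2‖ ≤ C * h * er := u2.trans (by gcongr; exact c2.1)
  have D1 : ‖d1‖ ≤ C * h * el := v1.trans (by gcongr; exact c1.2)
  have D2 : ‖d2‖ ≤ C * h * er := v2.trans (by gcongr; exact c2.2)
  have hmain : wkbNormal b₁ E₁ k₁ * wkbNormal b₂ E₂ k₂ * matching h E₁ b₁ E₂ b₂ / h =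
      (Complex.sinh l * (q * Complex.cosh r) + p * Complex.cosh l * Complex.sinh r) +
      (Complex.sinh l * d2 + a1 * (q * Complex.cosh r) + a1 * d2 + p * Complex.cosh l * a2 +
        d1 * Complex.sinh r + d1 * a2) := by
    rw [hd1, hd2, ha1, ha2, matching]; field_simp; ring
  set err := Complex.sinh l * d2 + a1 * (q * Complex.cosh r) + a1 * d2 + p * Complex.cosh l * a2 +
        d1 * Complex.sinh r + d1 * a2 with herr
  have herrn : ‖err‖ ≤ (2 * C + 2 * C ^ 2) * h * (1 + ‖p‖ + ‖q‖) * (el * er) := by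
    have t1 : ‖Complex.sinh l * d2‖ ≤ C * h * (el * er) := by
      rw [norm_mul]
      calc _ ≤ el * (C * h * er) := by gcongr
        _ = _ := by ring
    have t2 : ‖a1 * (q * Complex.cosh r)‖ ≤ C * h * (el * er) * ‖q‖ := by
      rw [norm_mul, norm_mul]
      calc _ ≤ (C * h * el) * (‖q‖ * er) := by gcongr
        _ = _ := by ring
    have hsq : C * h * el * (C * h * er) ≤ C ^ 2 * h * (el * er) := by
      calc _ = C ^ 2 * h * (el * er) * h := by ring
        _ ≤ _ := mul_le_of_le_one_right (by positivity) hh1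
    have t3 : ‖a1 * d2‖ ≤ C ^ 2 * h * (el * er) := by
      rw [norm_mul]
      exact (mul_le_mul A1 D2 (norm_nonneg _) (by positivity)).trans hsq
    have t4 : ‖p * Complex.cosh l * a2‖ ≤ C * h * (el * er) * ‖p‖ := by
      rw [norm_mul, norm_mul]
      calc _ ≤ ‖p‖ * el * (C * h * er) := by gcongr
        _ = _ := by ring
    have t5 : ‖d1 * Complex.sinh r‖ ≤ C * h * (el * er) := by
      rw [norm_mul]
      calc _ ≤ (C * h * el) * er := by gcongr
        _ = _ := by ring
    have t6 : ‖d1 * a2‖ ≤ C ^ 2 * h * (el * er) := by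
      rw [norm_mul]
      exact (mul_le_mul D1 A2 (norm_nonneg _) (by positivity)).trans hsq
    have hsum : ‖err‖ ≤ C * h * (el * er) + C * h * (el * er) * ‖q‖ + C ^ 2 * h * (el * er) +
        C * h * (el * er) * ‖p‖ + C * h * (el * er) + C ^ 2 * h * (el * er) := by
      rw [herr]
      refine (norm_add_le _ _).trans (add_le_add ?_ t6)
      refine (norm_add_le _ _).trans (add_le_add ?_ t5)
      refine (norm_add_le _ _).trans (add_le_add ?_ t4)
      refine (norm_add_le _ _).trans (add_le_add ?_ t3)
      exact (norm_add_le _ _).trans (add_le_add t1 t2)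
    refine hsum.trans ?_
    have e1 : 0 ≤ C * h * (el * er) * ‖p‖ := by positivity
    have e2 : 0 ≤ C * h * (el * er) * ‖q‖ := by positivity
    have e3 : 0 ≤ C ^ 2 * h * (el * er) * ‖p‖ := by positivity
    have e4 : 0 ≤ C ^ 2 * h * (el * er) * ‖q‖ := by positivity
    have e5 : (2 * C + 2 * C ^ 2) * h * (1 + ‖p‖ + ‖q‖) * (el * er) =
        2 * (C * h * (el * er)) + 2 * (C ^ 2 * h * (el * er)) + 2 * (C * h * (el * er) * ‖p‖) +
        2 * (C * h * (el * er) * ‖q‖) + 2 * (C ^ 2 * h * (el * er) * ‖p‖) +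
        2 * (C ^ 2 * h * (el * er) * ‖q‖) := by ring
    rw [e5]; linarith
  rw [normMatching, ← hl, ← hr, hmain, mul_add, exp_matching_identity, add_sub_cancel_left, norm_mul,
    norm_mul, RCLike.norm_ofNat, Complex.norm_exp]
  have hexp : Real.exp (-l - r).re * (el * er) =
      Real.exp (|l.re| - l.re) * Real.exp (|r.re| - r.re) := by
    rw [hel, her, ← Real.exp_add, ← Real.exp_add, ← Real.exp_add]
    congr 1
    simp only [Complex.sub_re, Complex.neg_re]; ring
  calc _ ≤ 4 * Real.exp (-l - r).re * ((2 * C + 2 * C ^ 2) * h * (1 + ‖p‖ + ‖q‖) * (el * er)) := by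
        gcongr
    _ = 4 * (2 * C + 2 * C ^ 2) * h * (1 + ‖p‖ + ‖q‖) * (Real.exp (-l - r).re * (el * er)) := by ring
    _ = _ := by rw [hexp]

/-! ### No limit spectrum off the curves. -/

lemma exists_root_re_action_nonneg (b : ℝ) (E : ℂ) :
    ∃ k : ℂ, k ^ 2 = E ∧ 0 ≤ (Complex.I * k * action b E).re := by
  obtain ⟨k, hk⟩ := IsAlgClosed.exists_pow_nat_eq E (n := 2) (by norm_num)
  rcases le_total 0 (Complex.I * k * action b E).re with h | h
  · exact ⟨k, hk, h⟩
  · refine ⟨-k, by rw [neg_sq, hk], ?_⟩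
    rw [mul_neg, neg_mul, Complex.neg_re]; linarith

/-- The square of the real part of the action. -/
noncomputable def reActionSq (b : ℝ) (E : ℂ) : ℝ :=
  (b + 1) ^ 2 * (‖sqAction b E‖ - (sqAction b E).re) / 2

lemma re_action_sq {b : ℝ} (hb : b ∈ Ioc (-1 : ℝ) 1) {E k : ℂ} (hk : k ^ 2 = E) :
    (Complex.I * k * action b E).re ^ 2 = reActionSq b E := by
  have hb1 : 0 < b + 1 := by linarith [hb.1]
  have hbc : ((b : ℂ) + 1) ≠ 0 := by exact_mod_cast hb1.ne'
  set A := Complex.I * k * action b E with hA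
  have h1 : A ^ 2 = (((b + 1) ^ 2 : ℝ) : ℂ) * -sqAction b E := by
    rw [hA, mul_pow, mul_pow, Complex.I_sq, hk, sqAction]; push_cast; field_simp
  have h2 : (A ^ 2).re = -((b + 1) ^ 2 * (sqAction b E).re) := by
    rw [h1, Complex.re_ofReal_mul, Complex.neg_re]; ring
  have h3 : ‖A‖ ^ 2 = (b + 1) ^ 2 * ‖sqAction b E‖ := by
    rw [← norm_pow, h1, norm_mul, norm_neg, Complex.norm_real, Real.norm_of_nonneg (by positivity)]
  have h4 : ‖A‖ ^ 2 = A.re * A.re + A.im * A.im := by rw [Complex.sq_norm, Complex.normSq_apply]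
  have h5 : (A ^ 2).re = A.re * A.re - A.im * A.im := by rw [sq, Complex.mul_re]
  rw [reActionSq]
  nlinarith

lemma continuousAt_reActionSq {b : ℝ} (hb : b ∈ Ioc (-1 : ℝ) 1) {E : ℂ} (hE : 1000 < ‖E‖) :
    ContinuousAt (reActionSq b) E := by
  have h := (differentiableAt_sqAction hE hb).continuousAt
  exact ((continuousAt_const.mul (h.norm.sub (Complex.continuous_re.continuousAt.comp h))).div_const _)

lemma reActionSq_pos {b : ℝ} (hb : b ∈ Ioc (-1 : ℝ) 1) {E : ℂ} (hE : 1000 ≤ ‖E‖)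
    (h : E ∉ actionCurve quadPotential (-1) b) : 0 < reActionSq b E := by
  obtain ⟨k, hk⟩ := IsAlgClosed.exists_pow_nat_eq E (n := 2) (by norm_num)
  rw [mem_actionCurve_iff hE hb hk] at h
  rw [← re_action_sq hb hk]
  positivity

/-- The square of the real part does not depend on the root k and is continuous in E, so its
positivity at E₀ gives a uniform lower bound nearby. -/
lemma eventually_le_re_action {b : ℝ} (hb : b ∈ Ioc (-1 : ℝ) 1) {E₀ : ℂ} (hE : 1000 < ‖E₀‖)
    (h : E₀ ∉ actionCurve quadPotential (-1) b) : ∃ c > 0, ∀ᶠ E in 𝓝 E₀, ∀ k : ℂ, k ^ 2 = E →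
      0 ≤ (Complex.I * k * action b E).re → c ≤ (Complex.I * k * action b E).re := by
  have hpos := reActionSq_pos hb hE.le h
  refine ⟨Real.sqrt (reActionSq b E₀ / 2), by positivity, ?_⟩
  filter_upwards [(continuousAt_reActionSq hb hE).eventually_const_lt (half_lt_self hpos)] with E hE' k hk h0
  rw [← re_action_sq hb hk] at hE'
  exact Real.sqrt_le_iff.2 ⟨h0, hE'.le⟩

lemma exp_neg_div_le {c h : ℝ} (hc : 0 < c) (hh : 0 < h) : Real.exp (-(c / h)) ≤ h / c := by
  rw [Real.exp_neg, ← one_div, div_le_div_iff₀ (Real.exp_pos _) hc]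
  have := Real.add_one_le_exp (c / h)
  have e : c = h * (c / h) := by field_simp
  nlinarith

lemma norm_exp_neg_two_mul_le {c h : ℝ} (hc : 0 < c) (hh : 0 < h) {A : ℂ} (hA : c ≤ A.re) :
    ‖Complex.exp (-2 * (A / h))‖ ≤ h / c := by
  refine le_trans ?_ (exp_neg_div_le hc hh)
  rw [Complex.norm_exp, Real.exp_le_exp]
  have e : (-2 * (A / h)).re = -(2 * (A.re / h)) := by
    rw [show (-2 * (A / h) : ℂ) = ((-2 : ℝ) : ℂ) * (A / h) by push_cast; ring, Complex.re_ofReal_mul,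
      Complex.div_ofReal_re]; ring
  rw [e]
  have h1 : c / h ≤ A.re / h := by gcongr
  have h2 : 0 < c / h := by positivity
  linarith

/-- For the unperturbed operator the eigenvalue condition is vanishing of the solution at b = 1. Off
the curve |sinh(A/h)| is comparable to exp(Re A/h), while the WKB error is only O(h) times that. -/
lemma limitSpectrum_quadPotential_subset {E₀ : ℂ} (hE₀ : 1000 < ‖E₀‖)
    (h : E₀ ∈ limitSpectrum quadPotential) : E₀ ∈ actionCurve quadPotential (-1) (1 : ℝ) := by
  obtain ⟨h, E, h0, hlim, heig, hE⟩ := h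
  have hb : (1 : ℝ) ∈ Ioc (-1 : ℝ) 1 := by norm_num
  by_contra hcon
  obtain ⟨c, hc, hev⟩ := eventually_le_re_action hb hE₀ hcon
  have ev1 := hE.eventually hev
  have ev2 : ∀ᶠ j in atTop, 1000 < ‖E j‖ := hE.norm.eventually_const_lt hE₀
  have ev3 : ∀ᶠ j in atTop, h j < min (1 / 8) (c / 8) := hlim.eventually_lt_const (by positivity)
  obtain ⟨j, j1, j2, j3⟩ := (ev1.and (ev2.and ev3)).exists
  obtain ⟨k, hk, hk0⟩ := exists_root_re_action_nonneg 1 (E j)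
  have hre := j1 k hk hk0
  have hj := h0 j
  have h8 : h j < 1 / 8 := j3.trans_le (min_le_left _ _)
  have hc8 : h j < c / 8 := j3.trans_le (min_le_right _ _)
  have hw := (wkb_estimate j2.le hb hk hj (by linarith)).1
  rw [shootSol_eq_zero_of_eigenvalue hj (heig j), mul_zero, zero_div, zero_sub, norm_neg] at hw
  set A := Complex.I * k * action 1 (E j) with hA
  have hy := norm_exp_neg_two_mul_le hc hj hre
  have hre2 : (A / h j).re = A.re / h j := Complex.div_ofReal_re _ _
  have hpos : 0 ≤ (A / h j).re := by rw [hre2]; positivity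
  rw [abs_of_nonneg hpos] at hw
  have hsinh : 2 * Complex.sinh (A / h j) =
      Complex.exp (A / h j) * (1 - Complex.exp (-2 * (A / h j))) := by
    rw [Complex.sinh, mul_sub, ← Complex.exp_add]; ring_nf
  have hn : ‖Complex.exp (A / h j)‖ = Real.exp (A / h j).re := Complex.norm_exp _
  have h1 : Real.exp (A / h j).re * (1 - h j / c) ≤ 2 * ‖Complex.sinh (A / h j)‖ := by
    have : 2 * ‖Complex.sinh (A / h j)‖ = ‖2 * Complex.sinh (A / h j)‖ := by
      rw [norm_mul, RCLike.norm_ofNat]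
    rw [this, hsinh, norm_mul, hn]
    gcongr
    have := norm_sub_norm_le (1 : ℂ) (Complex.exp (-2 * (A / h j)))
    rw [norm_one] at this
    linarith
  have hX := Real.exp_pos (A / h j).re
  have h2 : h j / c < 1 / 8 := by rw [div_lt_iff₀ hc]; linarith
  have h3 : 2 * ‖Complex.sinh (A / h j)‖ ≤ Real.exp (A / h j).re * (1 / 2) := by
    calc _ ≤ 2 * (4 / (1 + 1) * h j * Real.exp (A / h j).re) := by linarith
      _ = Real.exp (A / h j).re * (4 * h j) := by ring
      _ ≤ _ := by gcongr; linarith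
  have := le_of_mul_le_mul_left (h1.trans h3) hX
  linarith

/-- Off both curves x and y are O(h), so a zero of the Wronskian forces p + q = O(h). This
contradicts |p+q||p-q| = 2|δ| with p and q bounded. -/
lemma limitSpectrum_perturbed_subset {δ β : ℝ} (hδ : δ ≠ 0) (hβ : β ∈ Ioo (-1 : ℝ) 1) {E₀ : ℂ}
    (hE₁ : 1000 < ‖E₀ + δ * Complex.I‖) (hE₂ : 1000 < ‖E₀ - δ * Complex.I‖)
    (h : E₀ ∈ limitSpectrum (perturbedPotential δ β)) :
    E₀ + δ * Complex.I ∈ actionCurve quadPotential (-1) β ∨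
      E₀ - δ * Complex.I ∈ actionCurve quadPotential (-1) ((-β : ℝ)) := by
  obtain ⟨h, E, h0, hlim, heig, hE⟩ := h
  have hb₁ : β ∈ Ioc (-1 : ℝ) 1 := ⟨hβ.1, hβ.2.le⟩
  have hb₂ : -β ∈ Ioc (-1 : ℝ) 1 := ⟨by linarith [hβ.2], by linarith [hβ.1]⟩
  by_contra! hcon
  obtain ⟨c₁, hc₁, hev₁⟩ := eventually_le_re_action hb₁ hE₁ hcon.1
  obtain ⟨c₂, hc₂, hev₂⟩ := eventually_le_re_action hb₂ hE₂ hcon.2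
  have t₁ : Tendsto (fun j => E j + δ * Complex.I) atTop (𝓝 (E₀ + δ * Complex.I)) := hE.add_const _
  have t₂ : Tendsto (fun j => E j - δ * Complex.I) atTop (𝓝 (E₀ - δ * Complex.I)) := hE.sub_const _
  obtain ⟨C, h₀, hC, hh₀, hest⟩ := norm_normMatching_sub_le hb₁ hb₂
  set B := ‖E₀ + δ * Complex.I‖ + ‖E₀ - δ * Complex.I‖ + 2 with hB
  have hB0 : 0 < B := by positivity
  set K := C * (1 + 4 * B) + 4 * B * (1 / c₁ + 1 / c₂) + 4 * B * (1 / c₁) with hK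
  have hK0 : 0 < K := by positivity
  have ev : ∀ᶠ j in atTop, h j < min h₀ (min c₂ (|δ| / (4 * B * K))) := by
    refine hlim.eventually_lt_const ?_
    have : 0 < |δ| := abs_pos.2 hδ
    positivity
  have ev₁ : ∀ᶠ j in atTop, 1000 < ‖E j + δ * Complex.I‖ := t₁.norm.eventually_const_lt hE₁
  have ev₂ : ∀ᶠ j in atTop, 1000 < ‖E j - δ * Complex.I‖ := t₂.norm.eventually_const_lt hE₂
  have ev₃ : ∀ᶠ j in atTop, ‖E j + δ * Complex.I‖ < ‖E₀ + δ * Complex.I‖ + 1 :=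
    t₁.norm.eventually_lt_const (by linarith)
  have ev₄ : ∀ᶠ j in atTop, ‖E j - δ * Complex.I‖ < ‖E₀ - δ * Complex.I‖ + 1 :=
    t₂.norm.eventually_lt_const (by linarith)
  obtain ⟨j, i1, i2, i3, i4, i5, i6, i7⟩ := ((t₁.eventually hev₁).and ((t₂.eventually hev₂).and
    (ev.and (ev₁.and (ev₂.and (ev₃.and ev₄)))))).exists
  obtain ⟨k₁, hk₁, hk₁0⟩ := exists_root_re_action_nonneg β (E j + δ * Complex.I)
  obtain ⟨k₂, hk₂, hk₂0⟩ := exists_root_re_action_nonneg (-β) (E j - δ * Complex.I)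
  have hre₁ := i1 k₁ hk₁ hk₁0
  have hre₂ := i2 k₂ hk₂ hk₂0
  have hj := h0 j
  have hy₁ := norm_exp_neg_two_mul_le hc₁ hj hre₁
  have hy₂ := norm_exp_neg_two_mul_le hc₂ hj hre₂
  have hest' := hest (h j) hj (i3.le.trans (min_le_left _ _)) _ _ k₁ k₂ i4.le i5.le hk₁ hk₂ _ _ _ _
    rfl rfl rfl rfl
  rw [normMatching, matching_eq_zero_of_eigenvalue hj hβ (heig j), mul_zero, zero_div, mul_zero,
    zero_sub, norm_neg] at hest'
  have hpn := norm_endMomentum_le hb₁ i4.le hk₁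
  have hqn := norm_endMomentum_le hb₂ i5.le hk₂
  have hE₁0 : E j + δ * Complex.I ≠ 0 := norm_pos_iff.1 (by linarith)
  have hE₂0 : E j - δ * Complex.I ≠ 0 := norm_pos_iff.1 (by linarith)
  have hpq := endMomentum_sq (b := β) hE₁0 hk₁
  have hqq := endMomentum_sq (b := -β) hE₂0 hk₂
  set p := endMomentum β (E j + δ * Complex.I) k₁
  set q := endMomentum (-β) (E j - δ * Complex.I) k₂
  set l := Complex.I * k₁ * action β (E j + δ * Complex.I) / h j with hl
  set r := Complex.I * k₂ * action (-β) (E j - δ * Complex.I) / h j with hr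
  have hlre : 0 ≤ l.re := by rw [hl, Complex.div_ofReal_re]; positivity
  have hrre : 0 ≤ r.re := by rw [hr, Complex.div_ofReal_re]; positivity
  rw [abs_of_nonneg hlre, abs_of_nonneg hrre, sub_self, sub_self, Real.exp_zero, mul_one, mul_one] at hest'
  set x := Complex.exp (-2 * l)
  set y := Complex.exp (-2 * r)
  have hy1 : ‖y‖ ≤ 1 := hy₂.trans (by
    rw [div_le_one hc₂]; exact i3.le.trans ((min_le_right _ _).trans (min_le_left _ _)))
  have hpB : ‖p‖ ≤ 2 * B := hpn.trans (by linarith [norm_nonneg (E₀ - δ * Complex.I)])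
  have hqB : ‖q‖ ≤ 2 * B := hqn.trans (by linarith [norm_nonneg (E₀ + δ * Complex.I)])
  have hsum : ‖p + q‖ ≤ 4 * B := (norm_add_le _ _).trans (by linarith)
  have hdif : ‖p - q‖ ≤ 4 * B := (norm_sub_le _ _).trans (by linarith)
  have hsmall : ‖p + q‖ ≤ K * h j := by
    have e : p + q = ((p + q) * (1 - x * y) + (p - q) * (x - y)) - (p - q) * (x - y) +
        (p + q) * (x * y) := by ring
    have n1 : ‖(p - q) * (x - y)‖ ≤ 4 * B * (h j / c₁ + h j / c₂) := by
      rw [norm_mul]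
      gcongr
      exact (norm_sub_le _ _).trans (add_le_add hy₁ hy₂)
    have n2 : ‖(p + q) * (x * y)‖ ≤ 4 * B * (h j / c₁ * 1) := by
      rw [norm_mul, norm_mul]
      gcongr
    have n3 : C * h j * (1 + ‖p‖ + ‖q‖) ≤ C * h j * (1 + 4 * B) := by
      gcongr ?_ * ?_
      linarith
    rw [e]
    refine (norm_add_le _ _).trans ((add_le_add ((norm_sub_le _ _).trans
      (add_le_add (hest'.trans n3) n1)) n2).trans (le_of_eq ?_))
    rw [hK]; ring
  have hprod : (p + q) * (p - q) = -2 * δ * Complex.I := by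
    push_cast at hqq
    linear_combination hpq - hqq
  have hprodn : ‖p + q‖ * ‖p - q‖ = 2 * |δ| := by
    rw [← norm_mul, hprod, norm_mul, norm_mul, norm_neg, RCLike.norm_ofNat, Complex.norm_I,
      Complex.norm_real, Real.norm_eq_abs, mul_one]
  have hjb : h j < |δ| / (4 * B * K) := i3.trans_le ((min_le_right _ _).trans (min_le_right _ _))
  rw [lt_div_iff₀ (by positivity)] at hjb
  have : ‖p + q‖ * ‖p - q‖ ≤ K * h j * (4 * B) := by gcongr
  have hδp : 0 < |δ| := abs_pos.2 hδ
  nlinarith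

/-! ### Existence of eigenvalues near each point of a single curve. -/

/-- A weak form of Rouché's theorem. -/
lemma exists_zero_of_norm_lt {f : ℂ → ℂ} {c : ℂ} {r m : ℝ} (hr : 0 < r)
    (hf : DiffContOnCl ℂ f (Metric.ball c r)) (hc : ‖f c‖ < m)
    (hs : ∀ z ∈ Metric.sphere c r, m ≤ ‖f z‖) : ∃ z ∈ Metric.closedBall c r, f z = 0 := by
  by_contra! hne
  have hm : 0 < m := (norm_nonneg _).trans_lt hc
  have hinv : DiffContOnCl ℂ f⁻¹ (Metric.ball c r) := hf.inv fun z hz => by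
    rw [closure_ball _ hr.ne'] at hz
    exact hne z hz
  have := Complex.norm_le_of_forall_mem_frontier_norm_le Metric.isBounded_ball hinv (C := m⁻¹)
    (fun z hz => by
      rw [frontier_ball _ hr.ne'] at hz
      rw [Pi.inv_apply, norm_inv]
      exact inv_anti₀ hm (hs z hz)) (subset_closure (Metric.mem_ball_self hr))
  rw [Pi.inv_apply, norm_inv] at this
  have h0 : 0 < ‖f c‖ := norm_pos_iff.2 (hne c (Metric.mem_closedBall_self hr.le))
  exact absurd ((inv_le_inv₀ h0 hm).1 this) (not_le.2 hc)

lemma differentiable_shootSol (h : ℝ) (z : ℂ) : Differentiable ℂ fun E => shootSol h E z :=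
  (differentiable_leftSol _ z).comp (differentiable_neg.div_const _)

lemma differentiable_shootDeriv (h : ℝ) (z : ℂ) : Differentiable ℂ fun E => shootDeriv h E z :=
  (differentiable_leftSolDeriv _ z).comp (differentiable_neg.div_const _)

/-- A holomorphic square root. -/
noncomputable def rootOf (σ E : ℂ) : ℂ := σ * E ^ (1 / 2 : ℂ)

lemma rootOf_sq {σ : ℂ} (hσ : σ ^ 2 = 1) (E : ℂ) : rootOf σ E ^ 2 = E := by
  rw [rootOf, mul_pow, hσ, ← Complex.cpow_nat_mul]; simp

lemma differentiableAt_rootOf (σ : ℂ) {E : ℂ} (hE : 0 < E.re) : DifferentiableAt ℂ (rootOf σ) E :=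
  ((hasDerivAt_id E).cpow_const (Or.inl hE)).differentiableAt.const_mul σ

lemma differentiableAt_energy_comp {σ : ℂ} {b : ℝ} (hb : b ∈ Ioc (-1 : ℝ) 1) {E : ℂ}
    (hE : 4000 ≤ E.re) :
    DifferentiableAt ℂ (fun E => Complex.I * rootOf σ E * action b E) E ∧
    DifferentiableAt ℂ (fun E => wkbNormal b E (rootOf σ E)) E ∧
    DifferentiableAt ℂ (fun E => endMomentum b E (rootOf σ E)) E := by
  have hn := le_norm_of_le_re hE
  have hk := differentiableAt_rootOf σ (by linarith : 0 < E.re)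
  have h8 := norm_ofReal_le_eight hb (right_mem_uIcc (a := -1) (b := b))
  have hA := differentiableAt_action (by linarith : 1000 < ‖E‖) hb
  have h1 := differentiableAt_amplitude_energy (by linarith : 1000 ≤ ‖E‖) (z := -1) (by norm_num)
  have h2 := differentiableAt_amplitude_energy (by linarith : 1000 ≤ ‖E‖) h8
  have h3 := (hasDerivAt_momentum_energy (by linarith : 1000 ≤ ‖E‖) h8).differentiableAt
  unfold wkbNormal endMomentum
  exact ⟨(hk.const_mul _).mul hA, ((hk.const_mul _).mul h1).mul h2, (hk.const_mul _).mul h3⟩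

/-- A critical point of the action would be one of its square, so the error `sqActionError` would
have derivative -1 there, against the bound 1/2. -/
lemma deriv_action_ne_zero {σ : ℂ} (hσ : σ ^ 2 = 1) {b : ℝ} (hb : b ∈ Ioc (-1 : ℝ) 1) {E : ℂ}
    (hE : 4000 ≤ E.re) : deriv (fun E => Complex.I * rootOf σ E * action b E) E ≠ 0 := by
  have hb1 : 0 < b + 1 := by linarith [hb.1]
  have hbc : ((b : ℂ) + 1) ≠ 0 := by exact_mod_cast hb1.ne'
  have hn := le_norm_of_le_re hE
  intro h0
  have hd := (differentiableAt_energy_comp (σ := σ) hb hE).1.hasDerivAt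
  rw [h0] at hd
  have hsq : HasDerivAt (sqAction b) 0 E := by
    have h1 := (hd.pow 2).const_mul (-1 / ((b : ℂ) + 1) ^ 2)
    simp only [mul_zero] at h1
    refine h1.congr_of_eventuallyEq (Eventually.of_forall fun z => ?_)
    simp only [Pi.pow_apply, mul_pow, rootOf_sq hσ, Complex.I_sq, sqAction]
    field_simp
  have herr : HasDerivAt (sqActionError b) (0 - 1) E :=
    hsq.sub ((hasDerivAt_id E).sub_const (Complex.I * moment₁ b))
  have := norm_deriv_sqActionError_le (by linarith : 4000 ≤ ‖E‖) hb
  rw [herr.deriv] at this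
  norm_num at this

lemma norm_exp_sub_one_bounds {X : ℂ} (hX : ‖X‖ ≤ 5 / 8) :
    ‖X‖ * (1 - ‖X‖) ≤ ‖Complex.exp X - 1‖ ∧ ‖Complex.exp X - 1‖ ≤ 2 * ‖X‖ := by
  have h := Complex.norm_exp_sub_one_sub_id_le (by linarith : ‖X‖ ≤ 1)
  have h1 := norm_sub_norm_le X (-(Complex.exp X - 1 - X))
  rw [norm_neg, sub_neg_eq_add, add_sub_cancel] at h1
  have h2 := norm_le_norm_sub_add (Complex.exp X - 1) X
  constructor <;> nlinarith [norm_nonneg X]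

lemma exists_int_near (α : ℝ) {h : ℝ} (h0 : 0 < h) :
    ∃ n : ℤ, |α + h * Real.pi * n| ≤ h * Real.pi := by
  have hp : 0 < h * Real.pi := mul_pos h0 Real.pi_pos
  refine ⟨⌊-α / (h * Real.pi)⌋, ?_⟩
  have h1 := Int.floor_le (-α / (h * Real.pi))
  have h2 := (Int.lt_floor_add_one (-α / (h * Real.pi))).le
  rw [le_div_iff₀ hp] at h1
  rw [div_le_iff₀ hp] at h2
  rw [abs_le]
  constructor <;> nlinarith

/-- Near a point where the action of one part is imaginary and nondegenerate, while the other part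
is elliptic, the equation `p + q + (p - q) exp (-2 A / h) ≈ 0` has solutions for all small `h`. -/
lemma exists_zero_near {A : ℂ → ℂ} {E₀ ρ : ℂ} (hρ : ρ ≠ 0) {a : ℂ} (ha : a ≠ 0)
    (hA : HasStrictDerivAt A a E₀) (hre : (A E₀).re = 0) {V : Set ℂ} (hV : V ∈ 𝓝 E₀) :
    ∃ h₀ > 0, ∀ h : ℝ, 0 < h → h < h₀ → ∃ Ec : ℂ,
      Metric.closedBall Ec (h / (4 * ‖a‖)) ⊆ V ∧
      (∀ E ∈ Metric.closedBall Ec (h / (4 * ‖a‖)), ‖Complex.exp (-2 * (A E / h))‖ ≤ 3 * ‖ρ‖) ∧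
      Complex.exp (-2 * (A Ec / h)) = ρ ∧
      ∀ E ∈ Metric.sphere Ec (h / (4 * ‖a‖)), ‖ρ‖ / 8 ≤ ‖Complex.exp (-2 * (A E / h)) - ρ‖ := by
  have hap : 0 < ‖a‖ := norm_pos_iff.2 ha
  have hρp : 0 < ‖ρ‖ := norm_pos_iff.2 hρ
  have hlin : ∀ᶠ P in 𝓝 (E₀, E₀), ‖A P.1 - A P.2 - a * (P.1 - P.2)‖ ≤ ‖a‖ / 4 * ‖P.1 - P.2‖ := by
    have := hA.isLittleO.def (show 0 < ‖a‖ / 4 by positivity)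
    filter_upwards [this] with P hP
    simpa [mul_comm] using hP
  rw [nhds_prod_eq] at hlin
  obtain ⟨U, hU, hU2⟩ := (eventually_prod_self_iff (r := fun x y => ‖A x - A y - a * (x - y)‖ ≤ ‖a‖ / 4 * ‖x - y‖)).1 hlin
  obtain ⟨η, hη, hηU⟩ := Metric.mem_nhds_iff.1 (inter_mem hU hV)
  -- Since A'(E₀) ≠ 0, A is open at E₀, so values close to A(E₀) are attained close to E₀.
  have himg : A '' Metric.ball E₀ (η / 2) ∈ 𝓝 (A E₀) := by
    rw [← hA.map_nhds_eq ha]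
    exact image_mem_map (Metric.ball_mem_nhds _ (by positivity))
  obtain ⟨ε, hε, hεA⟩ := Metric.mem_nhds_iff.1 himg
  set L := ‖Complex.log ρ‖ / 2 + Real.pi + 1 with hL
  have hL0 : 0 < L := by have := Real.pi_pos; positivity
  refine ⟨min (ε / L) (η * ‖a‖), by positivity, fun h h0 hh => ?_⟩
  obtain ⟨n, hn⟩ := exists_int_near (A E₀).im h0
  have hhc : (h : ℂ) ≠ 0 := by exact_mod_cast h0.ne'
  -- The values T with exp(-2T/h) = ρ form a lattice of step iπh; as A(E₀) is imaginary, a suitable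
  -- n puts T within h(|log ρ|/2 + π) of it.
  set T : ℂ := -(h * (Complex.log ρ + n * (2 * Real.pi * Complex.I)) / 2) with hT
  have hTmem : T ∈ Metric.ball (A E₀) ε := by
    rw [mem_ball_iff_norm]
    have e : T - A E₀ = -(h * Complex.log ρ / 2) -
        (((A E₀).im + h * Real.pi * n : ℝ) : ℂ) * Complex.I := by
      have : A E₀ = (A E₀).im * Complex.I := by
        apply Complex.ext <;> simp [hre]
      nth_rw 1 [this]
      rw [hT]; push_cast; ring
    have h1 : h < ε / L := hh.trans_le (min_le_left _ _)
    rw [lt_div_iff₀ hL0] at h1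
    have h2 : ‖-(h * Complex.log ρ / 2)‖ = h * (‖Complex.log ρ‖ / 2) := by
      rw [norm_neg, norm_div, norm_mul, Complex.norm_real, Real.norm_of_nonneg h0.le, RCLike.norm_ofNat]
      ring
    have h3 : ‖(((A E₀).im + h * Real.pi * n : ℝ) : ℂ) * Complex.I‖ ≤ h * Real.pi := by
      rw [norm_mul, Complex.norm_I, mul_one, Complex.norm_real]; exact hn
    rw [e]
    calc _ ≤ h * (‖Complex.log ρ‖ / 2) + h * Real.pi := (norm_sub_le _ _).trans (add_le_add h2.le h3)
      _ ≤ h * L := by rw [hL]; nlinarith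
      _ < ε := h1
  obtain ⟨Ec, hEc, hAEc⟩ := hεA hTmem
  have hexpc : Complex.exp (-2 * (A Ec / h)) = ρ := by
    have : -2 * (A Ec / h) = Complex.log ρ + n * (2 * Real.pi * Complex.I) := by
      rw [hAEc, hT]; field_simp
    rw [this, Complex.exp_add, Complex.exp_log hρ, Complex.exp_int_mul_two_pi_mul_I, mul_one]
  have hsub : Metric.closedBall Ec (h / (4 * ‖a‖)) ⊆ U ∩ V := by
    refine Subset.trans (fun z hz => ?_) hηU
    rw [Metric.mem_ball]
    rw [Metric.mem_closedBall] at hz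
    rw [Metric.mem_ball] at hEc
    have h1 : h / (4 * ‖a‖) < η / 2 := by
      rw [div_lt_div_iff₀ (by positivity) (by norm_num)]
      have : h < η * ‖a‖ := hh.trans_le (min_le_right _ _)
      nlinarith
    linarith [dist_triangle z Ec E₀]
  have hpos : 0 ≤ h / (4 * ‖a‖) := by positivity
  have hcU : Ec ∈ U := (hsub (Metric.mem_closedBall_self hpos)).1
  have hX : ∀ E ∈ Metric.closedBall Ec (h / (4 * ‖a‖)),
      Complex.exp (-2 * (A E / h)) = ρ * Complex.exp (-2 * ((A E - A Ec) / h)) ∧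
      ‖-2 * ((A E - A Ec) / h)‖ ≤ 5 / 2 * (‖a‖ * ‖E - Ec‖ / h) ∧
      3 / 2 * (‖a‖ * ‖E - Ec‖ / h) ≤ ‖-2 * ((A E - A Ec) / h)‖ := by
    intro E hE
    refine ⟨by rw [← hexpc, ← Complex.exp_add]; ring_nf, ?_⟩
    have hl : ‖A E - A Ec - a * (E - Ec)‖ ≤ ‖a‖ / 4 * ‖E - Ec‖ := hU2 _ (hsub hE).1 _ hcU
    have e : ‖-2 * ((A E - A Ec) / h)‖ = 2 * (‖A E - A Ec‖ / h) := by
      rw [norm_mul, norm_neg, RCLike.norm_ofNat, norm_div, Complex.norm_real, Real.norm_of_nonneg h0.le]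
    have h1 := norm_le_norm_sub_add (A E - A Ec) (a * (E - Ec))
    have h2 := norm_sub_norm_le (a * (E - Ec)) (A E - A Ec)
    rw [norm_sub_rev (a * (E - Ec)) (A E - A Ec)] at h2
    rw [norm_mul] at h1 h2
    rw [e]
    constructor
    · rw [show 5 / 2 * (‖a‖ * ‖E - Ec‖ / h) = 2 * (5 / 4 * (‖a‖ * ‖E - Ec‖) / h) by ring]
      gcongr
      linarith
    · rw [show 3 / 2 * (‖a‖ * ‖E - Ec‖ / h) = 2 * (3 / 4 * (‖a‖ * ‖E - Ec‖) / h) by ring]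
      gcongr
      linarith
  have hq : ∀ t : ℝ, t ≤ h / (4 * ‖a‖) → ‖a‖ * t / h ≤ 1 / 4 := fun t ht => by
    rw [div_le_iff₀ h0]
    rw [le_div_iff₀ (by positivity)] at ht
    linarith
  refine ⟨Ec, fun z hz => (hsub hz).2, fun E hE => ?_, hexpc, fun E hE => ?_⟩
  · obtain ⟨h1, h2, -⟩ := hX E hE
    have h3 := hq _ (mem_closedBall_iff_norm.1 hE)
    have h4 : ‖-2 * ((A E - A Ec) / h)‖ ≤ 5 / 8 := h2.trans (by linarith)
    have h5 := (norm_exp_sub_one_bounds h4).2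
    have h6 := norm_le_norm_sub_add (Complex.exp (-2 * ((A E - A Ec) / h))) 1
    rw [norm_one] at h6
    rw [h1, norm_mul, mul_comm]
    gcongr
    linarith
  · obtain ⟨h1, h2, h2'⟩ := hX E (Metric.sphere_subset_closedBall hE)
    rw [mem_sphere_iff_norm] at hE
    -- On this circle the exponent X = -2(A(E) - A(Ec))/h has modulus between 3/8 and 5/8, where
    -- |X|(1-|X|) > 1/8.
    have h3 : ‖a‖ * ‖E - Ec‖ / h = 1 / 4 := by rw [hE]; field_simp
    rw [h3] at h2 h2'
    have h4 : ‖-2 * ((A E - A Ec) / h)‖ ≤ 5 / 8 := h2.trans (by norm_num)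
    have h5 := (norm_exp_sub_one_bounds h4).1
    rw [h1, show ρ * Complex.exp (-2 * ((A E - A Ec) / h)) - ρ =
      ρ * (Complex.exp (-2 * ((A E - A Ec) / h)) - 1) by ring, norm_mul, div_eq_mul_one_div]
    gcongr
    refine le_trans ?_ h5
    nlinarith

lemma wkbNormal_ne_zero {b : ℝ} (hb : b ∈ Ioc (-1 : ℝ) 1) {E k : ℂ} (hE : 1000 ≤ ‖E‖)
    (hk : k ^ 2 = E) : wkbNormal b E k ≠ 0 := by
  have hE0 : E ≠ 0 := norm_pos_iff.1 (by linarith)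
  have hk0 : k ≠ 0 := by rintro rfl; simp at hk; exact hE0 hk.symm
  exact mul_ne_zero (mul_ne_zero (mul_ne_zero Complex.I_ne_zero hk0)
    (amplitude_ne_zero hE (by norm_num))) (amplitude_ne_zero hE (norm_ofReal_le_eight hb right_mem_uIcc))

lemma exp_abs_sub_le (t : ℝ) : Real.exp (|t| - t) ≤ 1 + Real.exp (-2 * t) := by
  rcases abs_cases t with ⟨h, _⟩ | ⟨h, _⟩
  · rw [h, sub_self, Real.exp_zero]; linarith [Real.exp_pos (-2 * t)]
  · rw [h, show -t - t = -2 * t by ring]; linarith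

/-- Here Re A₂ > 0, so y is O(h) and the normalized Wronskian is close to (p-q)(x-ρ), with p, q
frozen at E₀ and ρ = -(p+q)/(p-q), finite and nonzero because s ≠ 0. The two curves are treated by
one statement, applied to (b, s) and to (-b, -s). -/
lemma exists_matching_eq_zero_near {b s : ℝ} (hb : b ∈ Ioo (-1 : ℝ) 1) (hs : s ≠ 0) {E₀ : ℂ}
    (hE₀ : 4000 < E₀.re) (hmem : E₀ + s * Complex.I ∈ actionCurve quadPotential (-1) b)
    (hnmem : E₀ - s * Complex.I ∉ actionCurve quadPotential (-1) ((-b : ℝ))) {ε : ℝ} (hε : 0 < ε) :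
    ∃ h : ℝ, 0 < h ∧ h < ε ∧ ∃ E : ℂ, ‖E - E₀‖ < ε ∧
      matching h (E + s * Complex.I) b (E - s * Complex.I) ((-b : ℝ)) = 0 := by
  have hb₁ : b ∈ Ioc (-1 : ℝ) 1 := ⟨hb.1, hb.2.le⟩
  have hb₂ : -b ∈ Ioc (-1 : ℝ) 1 := ⟨by linarith [hb.2], by linarith [hb.1]⟩
  have re₁ : ∀ E : ℂ, (E + s * Complex.I).re = E.re := fun E => by simp
  have re₂ : ∀ E : ℂ, (E - s * Complex.I).re = E.re := fun E => by simp
  have n₁ : ∀ E : ℂ, 4000 < E.re → 1000 ≤ ‖E + s * Complex.I‖ := fun E hE => by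
    have := le_norm_of_le_re (a := 4000) (E := E + s * Complex.I) (by rw [re₁]; exact hE.le)
    linarith
  have n₂ : ∀ E : ℂ, 4000 < E.re → 1000 ≤ ‖E - s * Complex.I‖ := fun E hE => by
    have := le_norm_of_le_re (a := 4000) (E := E - s * Complex.I) (by rw [re₂]; exact hE.le)
    linarith
  have hone : (1 : ℂ) ^ 2 = 1 := one_pow 2
  obtain ⟨σ, hσ, hσre⟩ : ∃ σ : ℂ, σ ^ 2 = 1 ∧ 0 ≤ (Complex.I * rootOf σ (E₀ - s * Complex.I) *
      action (-b) (E₀ - s * Complex.I)).re := by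
    rcases le_total 0 (Complex.I * rootOf 1 (E₀ - s * Complex.I) *
      action (-b) (E₀ - s * Complex.I)).re with h | h
    · exact ⟨1, hone, h⟩
    · refine ⟨-1, by ring, ?_⟩
      have : rootOf (-1) (E₀ - s * Complex.I) = -rootOf 1 (E₀ - s * Complex.I) := by
        rw [rootOf, rootOf]; ring
      rw [this, mul_neg, neg_mul, Complex.neg_re]
      linarith
  set A₁ : ℂ → ℂ := fun E => Complex.I * rootOf 1 (E + s * Complex.I) *
    action b (E + s * Complex.I) with hA₁
  set A₂ : ℂ → ℂ := fun E => Complex.I * rootOf σ (E - s * Complex.I) *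
    action (-b) (E - s * Complex.I) with hA₂
  set p : ℂ → ℂ := fun E => endMomentum b (E + s * Complex.I) (rootOf 1 (E + s * Complex.I)) with hp
  set q : ℂ → ℂ := fun E => endMomentum (-b) (E - s * Complex.I) (rootOf σ (E - s * Complex.I)) with hq
  have hadd : ∀ E : ℂ, DifferentiableAt ℂ (fun E => E + s * Complex.I) E := fun E =>
    differentiableAt_id.add_const _
  have hsub : ∀ E : ℂ, DifferentiableAt ℂ (fun E => E - s * Complex.I) E := fun E =>
    differentiableAt_id.sub_const _
  have D₁ := fun (E : ℂ) (hE : 4000 < E.re) =>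
    differentiableAt_energy_comp (σ := 1) hb₁ (E := E + s * Complex.I) (by rw [re₁]; exact hE.le)
  have D₂ := fun (E : ℂ) (hE : 4000 < E.re) =>
    differentiableAt_energy_comp (σ := σ) hb₂ (E := E - s * Complex.I) (by rw [re₂]; exact hE.le)
  have comp₁ : ∀ (g : ℂ → ℂ) (E : ℂ), DifferentiableAt ℂ g (E + s * Complex.I) →
      DifferentiableAt ℂ (fun E => g (E + s * Complex.I)) E := fun _ E hg => hg.comp E (hadd E)
  have comp₂ : ∀ (g : ℂ → ℂ) (E : ℂ), DifferentiableAt ℂ g (E - s * Complex.I) →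
      DifferentiableAt ℂ (fun E => g (E - s * Complex.I)) E := fun _ E hg => hg.comp E (hsub E)
  have dA₁ : ∀ E : ℂ, 4000 < E.re → DifferentiableAt ℂ A₁ E := fun E hE =>
    (comp₁ _ E (D₁ E hE).1 :)
  have dA₂ : ∀ E : ℂ, 4000 < E.re → DifferentiableAt ℂ A₂ E := fun E hE =>
    (comp₂ _ E (D₂ E hE).1 :)
  have dp : DifferentiableAt ℂ p E₀ := (comp₁ _ E₀ (D₁ E₀ hE₀).2.2 :)
  have dq : DifferentiableAt ℂ q E₀ := (comp₂ _ E₀ (D₂ E₀ hE₀).2.2 :)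
  have hre₁ : (A₁ E₀).re = 0 :=
    (mem_actionCurve_iff (n₁ E₀ hE₀) hb₁ (rootOf_sq hone _)).1 hmem
  have hre₂ : 0 < (A₂ E₀).re := by
    refine lt_of_le_of_ne hσre (Ne.symm fun h0 => hnmem ?_)
    exact (mem_actionCurve_iff (n₂ E₀ hE₀) hb₂ (rootOf_sq hσ _)).2 h0
  have hopen : IsOpen {E : ℂ | 4000 < E.re} := isOpen_lt continuous_const Complex.continuous_re
  have hstrict : HasStrictDerivAt A₁ (deriv A₁ E₀) E₀ :=
    ((show DifferentiableOn ℂ A₁ {E : ℂ | 4000 < E.re} from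
      fun E hE => (dA₁ E hE).differentiableWithinAt).analyticAt (hopen.mem_nhds hE₀)).hasStrictDerivAt
  have hderiv : deriv A₁ E₀ ≠ 0 := by
    have := deriv_action_ne_zero hone hb₁ (E := E₀ + s * Complex.I) (by rw [re₁]; exact hE₀.le)
    rwa [← deriv_comp_add_const] at this
  have hne₁ : E₀ + s * Complex.I ≠ 0 := norm_pos_iff.1 (by linarith [n₁ E₀ hE₀])
  have hne₂ : E₀ - s * Complex.I ≠ 0 := norm_pos_iff.1 (by linarith [n₂ E₀ hE₀])
  have hprod : (p E₀ + q E₀) * (p E₀ - q E₀) = -2 * s * Complex.I := by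
    have h1 : p E₀ ^ 2 = _ := endMomentum_sq hne₁ (rootOf_sq hone _)
    have h2 : q E₀ ^ 2 = _ := endMomentum_sq hne₂ (rootOf_sq hσ _)
    push_cast at h2
    linear_combination h1 - h2
  have hprod0 : (p E₀ + q E₀) * (p E₀ - q E₀) ≠ 0 := by
    rw [hprod]
    exact mul_ne_zero (mul_ne_zero (by norm_num) (by exact_mod_cast hs)) Complex.I_ne_zero
  have hsum0 := left_ne_zero_of_mul hprod0
  have hdif0 := right_ne_zero_of_mul hprod0
  set ρ : ℂ := -((p E₀ + q E₀) / (p E₀ - q E₀)) with hρ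
  have hρ0 : ρ ≠ 0 := neg_ne_zero.2 (div_ne_zero hsum0 hdif0)
  set m := ‖p E₀ + q E₀‖ with hm
  have hm0 : 0 < m := norm_pos_iff.2 hsum0
  have hmρ : ‖p E₀ - q E₀‖ * ‖ρ‖ = m := by
    rw [hρ, norm_neg, norm_div, hm]
    field_simp
  set X := 1 + 3 * ‖ρ‖ with hX
  have hX0 : 1 ≤ X := by have := norm_nonneg ρ; linarith
  set e := min 1 (m / (100 * X)) with he
  have he0 : 0 < e := by positivity
  set c := (A₂ E₀).re / 2 with hc
  have hc0 : 0 < c := by positivity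
  set B := 3 + ‖p E₀‖ + ‖q E₀‖ with hB
  have hB0 : 0 < B := by positivity
  set V : Set ℂ := {E | ‖E - E₀‖ < ε ∧ 4000 < E.re ∧ ‖p E - p E₀‖ < e ∧ ‖q E - q E₀‖ < e ∧
    c < (A₂ E).re} with hV
  have hVmem : V ∈ 𝓝 E₀ := by
    have v1 : ∀ᶠ E in 𝓝 E₀, ‖E - E₀‖ < ε := by
      filter_upwards [Metric.ball_mem_nhds E₀ hε] with E hE using mem_ball_iff_norm.1 hE
    have v3 : ∀ᶠ E in 𝓝 E₀, ‖p E - p E₀‖ < e := by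
      filter_upwards [dp.continuousAt (Metric.ball_mem_nhds (p E₀) he0)] with E hE
        using mem_ball_iff_norm.1 hE
    have v4 : ∀ᶠ E in 𝓝 E₀, ‖q E - q E₀‖ < e := by
      filter_upwards [dq.continuousAt (Metric.ball_mem_nhds (q E₀) he0)] with E hE
        using mem_ball_iff_norm.1 hE
    have v5 : ∀ᶠ E in 𝓝 E₀, c < (A₂ E).re :=
      (Complex.continuous_re.continuousAt.comp (dA₂ E₀ hE₀).continuousAt).eventually_const_lt
        (half_lt_self hre₂)
    filter_upwards [v1, hopen.mem_nhds hE₀, v3, v4, v5] with E w1 w2 w3 w4 w5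
      using ⟨w1, w2, w3, w4, w5⟩
  obtain ⟨h₁, hh₁, hzero⟩ := exists_zero_near hρ0 hderiv hstrict hre₁ hVmem
  obtain ⟨C, h₀, hC, hh₀, hest⟩ := norm_normMatching_sub_le hb₁ hb₂
  set h := min (min (ε / 2) (h₁ / 2)) (min h₀ (min c (m / (100 * (X * B * (C + 1 / c)))))) with hh
  have h0 : 0 < h := by positivity
  have hε' : h < ε := by
    have : h ≤ ε / 2 := (min_le_left _ _).trans (min_le_left _ _)
    linarith
  have hh₁' : h < h₁ := by
    have : h ≤ h₁ / 2 := (min_le_left _ _).trans (min_le_right _ _)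
    linarith
  have hh₀' : h ≤ h₀ := (min_le_right _ _).trans (min_le_left _ _)
  have hhc : h ≤ c := (min_le_right _ _).trans ((min_le_right _ _).trans (min_le_left _ _))
  have hhm : h * (X * B * (C + 1 / c)) ≤ m / 100 := by
    have : h ≤ m / (100 * (X * B * (C + 1 / c))) :=
      (min_le_right _ _).trans ((min_le_right _ _).trans (min_le_right _ _))
    rw [le_div_iff₀ (by positivity)] at this
    linarith
  have hhC : (h : ℂ) ≠ 0 := by exact_mod_cast h0.ne'
  obtain ⟨Ec, hEcV, hxb, hxc, hxs⟩ := hzero h h0 hh₁'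
  set f : ℂ → ℂ := fun E => normMatching h b (E + s * Complex.I) (rootOf 1 (E + s * Complex.I)) (-b)
    (E - s * Complex.I) (rootOf σ (E - s * Complex.I)) with hf
  have hap : ∀ E ∈ Metric.closedBall Ec (h / (4 * ‖deriv A₁ E₀‖)),
      ‖f E - (p E₀ - q E₀) * (Complex.exp (-2 * (A₁ E / h)) - ρ)‖ ≤ m / 20 := by
    intro E hE
    obtain ⟨-, hEre, hpE, hqE, hA₂E⟩ := hEcV hE
    have hx := hxb E hE
    have hy := norm_exp_neg_two_mul_le hc0 h0 hA₂E.le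
    have hmain := hest h h0 hh₀' _ _ _ _ (n₁ E hEre) (n₂ E hEre) (rootOf_sq hone _) (rootOf_sq hσ _)
      (A₁ E / h) (A₂ E / h) (p E) (q E) rfl rfl rfl rfl
    have hlx : Real.exp (|(A₁ E / h).re| - (A₁ E / h).re) ≤ X := by
      refine (exp_abs_sub_le _).trans ?_
      rw [Complex.norm_exp] at hx
      have : (-2 * (A₁ E / h)).re = -2 * (A₁ E / h).re := by
        rw [show (-2 * (A₁ E / h) : ℂ) = ((-2 : ℝ) : ℂ) * (A₁ E / h) by push_cast; ring,
          Complex.re_ofReal_mul]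
      rw [this] at hx
      linarith
    have hry : Real.exp (|(A₂ E / h).re| - (A₂ E / h).re) = 1 := by
      have : 0 ≤ (A₂ E / h).re := by
        rw [Complex.div_ofReal_re]; exact div_nonneg (hc0.le.trans hA₂E.le) h0.le
      rw [abs_of_nonneg this, sub_self, Real.exp_zero]
    rw [hry, mul_one] at hmain
    set x := Complex.exp (-2 * (A₁ E / h))
    set y := Complex.exp (-2 * (A₂ E / h))
    have he1 : e ≤ 1 := min_le_left _ _
    have heX : e * X ≤ m / 100 := by
      have : e ≤ m / (100 * X) := min_le_right _ _
      rw [le_div_iff₀ (by positivity)] at this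
      linarith
    have hpB : ‖p E‖ ≤ ‖p E₀‖ + 1 := by
      have := norm_le_norm_sub_add (p E) (p E₀); linarith
    have hqB : ‖q E‖ ≤ ‖q E₀‖ + 1 := by
      have := norm_le_norm_sub_add (q E) (q E₀); linarith
    have hy1 : ‖y‖ ≤ 1 := hy.trans (by rw [div_le_one hc0]; exact hhc)
    have hxX : 1 + ‖x‖ ≤ X := by linarith
    have hρe : (p E₀ - q E₀) * ρ = -(p E₀ + q E₀) := by rw [hρ]; field_simp
    -- The terms are the WKB error, the variation of p and of q from E₀, and the terms with y. The
    -- first and last total at most m/100 by the choice of h, the middle two at most 4m/100 by that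
    -- of e.
    have key : f E - (p E₀ - q E₀) * (x - ρ) = (f E - ((p E + q E) * (1 - x * y) +
        (p E - q E) * (x - y))) + (p E - p E₀) * ((1 + x) * (1 - y)) +
        (q E - q E₀) * ((1 - x) * (1 + y)) - ((p E₀ + q E₀) * x + (p E₀ - q E₀)) * y := by
      linear_combination hρe
    have m1 : ‖f E - ((p E + q E) * (1 - x * y) + (p E - q E) * (x - y))‖ ≤ C * h * B * X := by
      refine hmain.trans ?_
      gcongr ?_ * ?_ * ?_
      linarith
    have hx1 : ‖1 + x‖ ≤ X := (norm_add_le _ _).trans (by rw [norm_one]; exact hxX)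
    have hx2 : ‖1 - x‖ ≤ X := (norm_sub_le _ _).trans (by rw [norm_one]; exact hxX)
    have hy3 : ‖1 - y‖ ≤ 2 := (norm_sub_le _ _).trans (by rw [norm_one]; linarith)
    have hy4 : ‖1 + y‖ ≤ 2 := (norm_add_le _ _).trans (by rw [norm_one]; linarith)
    have m2 : ‖(p E - p E₀) * ((1 + x) * (1 - y))‖ ≤ e * (X * 2) := by
      rw [norm_mul, norm_mul]; gcongr
    have m3 : ‖(q E - q E₀) * ((1 - x) * (1 + y))‖ ≤ e * (X * 2) := by
      rw [norm_mul, norm_mul]; gcongr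
    have m4 : ‖((p E₀ + q E₀) * x + (p E₀ - q E₀)) * y‖ ≤ B * X * (h / c) := by
      rw [norm_mul]
      gcongr
      have k1 : ‖p E₀ + q E₀‖ ≤ B := (norm_add_le _ _).trans (by linarith)
      have k2 : ‖p E₀ - q E₀‖ ≤ B := (norm_sub_le _ _).trans (by linarith)
      calc _ ≤ ‖p E₀ + q E₀‖ * ‖x‖ + ‖p E₀ - q E₀‖ := (norm_add_le _ _).trans (by rw [norm_mul])
        _ ≤ B * ‖x‖ + B := by gcongr
        _ = B * (1 + ‖x‖) := by ring
        _ ≤ B * X := by gcongr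
    rw [key]
    refine (norm_sub_le _ _).trans ((add_le_add (norm_add₃_le.trans
      (add_le_add (add_le_add m1 m2) m3)) m4).trans ?_)
    have : C * h * B * X + B * X * (h / c) = h * (X * B * (C + 1 / c)) := by ring
    linarith
  have hrad : 0 < h / (4 * ‖deriv A₁ E₀‖) := by
    have : 0 < ‖deriv A₁ E₀‖ := norm_pos_iff.2 hderiv
    positivity
  have hfd : ∀ E : ℂ, 4000 < E.re → DifferentiableAt ℂ f E := by
    intro E hE
    have w1 : DifferentiableAt ℂ (fun E => wkbNormal b (E + s * Complex.I)
        (rootOf 1 (E + s * Complex.I))) E := (comp₁ _ E (D₁ E hE).2.1 :)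
    have w2 : DifferentiableAt ℂ (fun E => wkbNormal (-b) (E - s * Complex.I)
        (rootOf σ (E - s * Complex.I))) E := (comp₂ _ E (D₂ E hE).2.1 :)
    have u1 : DifferentiableAt ℂ (fun E => shootSol h (E + s * Complex.I) b) E :=
      (differentiable_shootSol h b _).comp E (hadd E)
    have u2 : DifferentiableAt ℂ (fun E => shootDeriv h (E + s * Complex.I) b) E :=
      (differentiable_shootDeriv h b _).comp E (hadd E)
    have u3 : DifferentiableAt ℂ (fun E => shootSol h (E - s * Complex.I) ((-b : ℝ))) E :=
      (differentiable_shootSol h _ _).comp E (hsub E)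
    have u4 : DifferentiableAt ℂ (fun E => shootDeriv h (E - s * Complex.I) ((-b : ℝ))) E :=
      (differentiable_shootDeriv h _ _).comp E (hsub E)
    exact ((((dA₁ E hE).div_const _).neg.sub ((dA₂ E hE).div_const _)).cexp.const_mul 4).mul
      (((w1.mul w2).mul ((u1.mul u4).add (u2.mul u3))).div_const _)
  -- At the centre |f| ≤ m/20; on the circle |f| ≥ m/8 - m/20. The level m/15 lies strictly between
  -- these two bounds.
  obtain ⟨E, hE, hfE⟩ := exists_zero_of_norm_lt (f := f) (c := Ec) (m := m / 15) hrad
    (DifferentiableOn.diffContOnCl fun z hz => by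
      rw [closure_ball _ hrad.ne'] at hz
      exact (hfd z (hEcV hz).2.1).differentiableWithinAt)
    (by
      have := hap Ec (Metric.mem_closedBall_self hrad.le)
      rw [hxc, sub_self, mul_zero, sub_zero] at this
      linarith)
    (fun z hz => by
      have h1 := hap z (Metric.sphere_subset_closedBall hz)
      have h2 := hxs z hz
      have h3 := norm_le_norm_sub_add ((p E₀ - q E₀) * (Complex.exp (-2 * (A₁ z / h)) - ρ)) (f z)
      rw [norm_sub_rev, norm_mul] at h3
      have h4 : ‖p E₀ - q E₀‖ * (‖ρ‖ / 8) ≤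
        ‖p E₀ - q E₀‖ * ‖Complex.exp (-2 * (A₁ z / h)) - ρ‖ := by gcongr
      linarith)
  obtain ⟨hEε, hEre, -⟩ := hEcV hE
  refine ⟨h, h0, hε', E, hEε, ?_⟩
  have h1 := (mul_eq_zero.1 hfE).resolve_left
    (mul_ne_zero (by norm_num) (Complex.exp_ne_zero _))
  have h2 := (div_eq_zero_iff.1 h1).resolve_right hhC
  exact (mul_eq_zero.1 h2).resolve_left (mul_ne_zero (wkbNormal_ne_zero hb₁ (n₁ E hEre) (rootOf_sq hone _))
    (wkbNormal_ne_zero hb₂ (n₂ E hEre) (rootOf_sq hσ _)))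

/-! ### Reduction to the unperturbed action curves, and conclusion. -/

lemma mem_leftCurve_iff {δ β : ℝ} {E : ℂ} :
    E ∈ leftCurve δ β ↔ E + δ * Complex.I ∈ actionCurve quadPotential (-1) β := by
  have e : ∀ t : ℝ, quadPotential t - Complex.I * δ - E = quadPotential t - (E + δ * Complex.I) :=
    fun t => by ring
  simp only [leftCurve, actionCurve, mem_ofPred_eq, e]

/-- Substitute t ↦ -t: the potential is even, so [β, 1] becomes [-1, -β]. -/
lemma mem_rightCurve_iff {δ β : ℝ} {E : ℂ} :
    E ∈ rightCurve δ β ↔ E - δ * Complex.I ∈ actionCurve quadPotential (-1) ((-β : ℝ)) := by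
  have e : ∀ t : ℝ, quadPotential t + Complex.I * δ - E = quadPotential t - (E - δ * Complex.I) :=
    fun t => by ring
  have hq : ∀ t : ℝ, quadPotential (-t) = quadPotential t := fun t => by simp [quadPotential]
  have hneg : ∀ t : ℝ, t ∈ uIcc β 1 ↔ -t ∈ uIcc (-1 : ℝ) (-β) := fun t => by
    simp only [mem_uIcc]; constructor <;> rintro (⟨h1, h2⟩ | ⟨h1, h2⟩)
    · left; constructor <;> linarith
    · right; constructor <;> linarith
    · left; constructor <;> linarith
    · right; constructor <;> linarith
  simp only [rightCurve, actionCurve, mem_ofPred_eq, e]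
  constructor
  · rintro ⟨f, hc, hsq, hre⟩
    refine ⟨fun t => f (-t), hc.comp continuousOn_neg fun t ht => ?_, fun t ht => ?_, ?_⟩
    · exact (hneg _).2 (by rwa [neg_neg])
    · rw [hsq (-t) ((hneg _).2 (by rwa [neg_neg])), hq]
    · rw [intervalIntegral.integral_comp_neg f, neg_neg, neg_neg]; exact hre
  · rintro ⟨f, hc, hsq, hre⟩
    refine ⟨fun t => f (-t), hc.comp continuousOn_neg fun t ht => (hneg t).1 ht, fun t ht => ?_, ?_⟩
    · rw [hsq (-t) ((hneg t).1 ht), hq]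
    · rw [intervalIntegral.integral_comp_neg f]; exact hre

lemma mem_limitSpectrum_of_forall {W : ℝ → ℂ} {E₀ : ℂ}
    (H : ∀ ε > 0, ∃ h : ℝ, 0 < h ∧ h < ε ∧ ∃ E : ℂ, ‖E - E₀‖ < ε ∧ E ∈ dirichletEigenvalues W h) :
    E₀ ∈ limitSpectrum W := by
  have hpos : ∀ n : ℕ, (0 : ℝ) < 1 / ((n : ℝ) + 1) := fun n => by positivity
  choose h h0 hlt E hE heig using fun n : ℕ => H _ (hpos n)
  refine ⟨h, E, h0, ?_, heig, ?_⟩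
  · exact squeeze_zero (fun n => (h0 n).le) (fun n => (hlt n).le) tendsto_one_div_add_atTop_nhds_zero_nat
  · rw [tendsto_iff_norm_sub_tendsto_zero]
    exact squeeze_zero (fun n => norm_nonneg _) (fun n => (hE n).le)
      tendsto_one_div_add_atTop_nhds_zero_nat

lemma norm_sub_abs_le_norm_add (s : ℝ) (E : ℂ) : ‖E‖ - |s| ≤ ‖E + s * Complex.I‖ := by
  have := norm_sub_norm_le E (-(s * Complex.I))
  rwa [norm_neg, norm_mul, Complex.norm_I, mul_one, Complex.norm_real, Real.norm_eq_abs,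
    sub_neg_eq_add] at this

lemma norm_sub_abs_le_norm_sub (s : ℝ) (E : ℂ) : ‖E‖ - |s| ≤ ‖E - s * Complex.I‖ := by
  have := norm_sub_abs_le_norm_add (-s) E
  rw [abs_neg] at this
  convert this using 2
  push_cast; ring

/-- The radius includes the one from `disjoint_actionCurve_shift`: a point of one curve is then off
the other, which the existence lemma requires. -/
lemma mem_limitSpectrum_perturbed_iff {δ β : ℝ} (hβ : β ∈ Ioo (-1 : ℝ) 1) (hδ : δ ≠ 0) :
    ∃ R : ℝ, ∀ E : ℂ, R ≤ ‖E‖ → (E ∈ limitSpectrum (perturbedPotential δ β) ↔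
      E + δ * Complex.I ∈ actionCurve quadPotential (-1) β ∨
      E - δ * Complex.I ∈ actionCurve quadPotential (-1) ((-β : ℝ))) := by
  have hb₁ : β ∈ Ioc (-1 : ℝ) 1 := ⟨hβ.1, hβ.2.le⟩
  have hβ' : -β ∈ Ioo (-1 : ℝ) 1 := ⟨by linarith [hβ.2], by linarith [hβ.1]⟩
  have hb₂ : -β ∈ Ioc (-1 : ℝ) 1 := ⟨hβ'.1, hβ'.2.le⟩
  obtain ⟨R, hR⟩ := disjoint_actionCurve_shift hβ (Or.inr hδ)
  refine ⟨max R (4003 + |δ|), fun E hE => ?_⟩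
  have hE1 := (le_max_left _ _).trans hE
  have hE2 := (le_max_right _ _).trans hE
  have n1 := norm_sub_abs_le_norm_add δ E
  have n2 := norm_sub_abs_le_norm_sub δ E
  refine ⟨limitSpectrum_perturbed_subset hδ hβ (by linarith) (by linarith), fun h => ?_⟩
  refine mem_limitSpectrum_of_forall fun ε hε => ?_
  rcases h with h | h
  · have hre := le_re_of_mem_actionCurve hb₁ (R := 4001) (by norm_num) (by linarith) h
    have hre' : 4000 < E.re := by
      simp only [Complex.add_re, Complex.re_ofReal_mul, Complex.I_re, mul_zero, add_zero] at hre
      linarith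
    obtain ⟨η, h0, hlt, E', hE', hm⟩ := exists_matching_eq_zero_near hβ hδ hre' h
      (fun h' => hR E hE1 ⟨h, h'⟩) hε
    exact ⟨η, h0, hlt, E', hE', eigenvalue_of_matching_eq_zero h0 hβ hm⟩
  · have hre := le_re_of_mem_actionCurve hb₂ (R := 4001) (by norm_num) (by linarith) h
    have hre' : 4000 < E.re := by
      simp only [Complex.sub_re, Complex.re_ofReal_mul, Complex.I_re, mul_zero, sub_zero] at hre
      linarith
    have e1 : ∀ E : ℂ, E + ((-δ : ℝ) : ℂ) * Complex.I = E - δ * Complex.I := fun E => by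
      push_cast; ring
    have e2 : ∀ E : ℂ, E - ((-δ : ℝ) : ℂ) * Complex.I = E + δ * Complex.I := fun E => by
      push_cast; ring
    obtain ⟨η, h0, hlt, E', hE', hm⟩ := exists_matching_eq_zero_near hβ' (neg_ne_zero.2 hδ) hre'
      (by rwa [e1]) (fun h' => hR E hE1 ⟨by rwa [e2, neg_neg] at h', h⟩) hε
    rw [e1, e2, neg_neg, matching_comm] at hm
    exact ⟨η, h0, hlt, E', hE', eigenvalue_of_matching_eq_zero h0 hβ hm⟩

/-- Near infinity both limit spectra hug horizontal lines: heights m₁(β) - δ or m₁(-β) + δ for the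
perturbed operator, and m₁(1) for the unperturbed one. -/
lemma limitSpectrum_unstable {β : ℝ} (hβ : β ∈ Ioo (-1 : ℝ) 1) (hβ0 : β ≠ 0) :
    ∃ c > (0 : ℝ), ∃ δ₀ > (0 : ℝ), ∀ δ : ℝ, 0 < δ → δ < δ₀ → ∃ R : ℝ,
      ∀ E ∈ limitSpectrum (perturbedPotential δ β), ∀ E' ∈ limitSpectrum quadPotential,
        R ≤ ‖E‖ → c ≤ ‖E - E'‖ := by
  have hb₁ : β ∈ Ioc (-1 : ℝ) 1 := ⟨hβ.1, hβ.2.le⟩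
  have hb₂ : -β ∈ Ioc (-1 : ℝ) 1 := ⟨by linarith [hβ.2], by linarith [hβ.1]⟩
  have hb₃ : (1 : ℝ) ∈ Ioc (-1 : ℝ) 1 := by norm_num
  have hd₁ : 0 < |moment₁ β - moment₁ 1| := by
    have : moment₁ β - moment₁ 1 = β * (β - 1) / 3 := by simp only [moment₁]; ring
    rw [this, abs_pos]
    exact div_ne_zero (mul_ne_zero hβ0 (by linarith [hβ.2])) (by norm_num)
  have hd₂ : 0 < |moment₁ (-β) - moment₁ 1| := by
    have : moment₁ (-β) - moment₁ 1 = β * (β + 1) / 3 := by simp only [moment₁]; ring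
    rw [this, abs_pos]
    exact div_ne_zero (mul_ne_zero hβ0 (by linarith [hβ.1])) (by norm_num)
  -- Two points at distance below d/4 would give heights with |m₁(±β) - m₁(1)| < d/4 + d/4 + d/8 +
  -- d/8 < d: distance, shift by δ, and two asymptotic errors. The radius also keeps E' large.
  set d := min |moment₁ β - moment₁ 1| |moment₁ (-β) - moment₁ 1| with hd
  have hd0 : 0 < d := by positivity
  refine ⟨d / 4, by positivity, d / 4, by positivity, fun δ hδ hδd => ?_⟩
  refine ⟨1001 + 8 / d + d + |δ|, fun E hE E' hE' hn => ?_⟩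
  have h8 : 0 < 8 / d := by positivity
  by_contra! hlt
  have n1 := norm_sub_abs_le_norm_add δ E
  have n2 := norm_sub_abs_le_norm_sub δ E
  have n3 : 1000 + 8 / d < ‖E'‖ := by
    have := norm_sub_norm_le E E'
    linarith [abs_nonneg δ]
  have hinv : ∀ x : ℝ, 8 / d ≤ x → 1 / x ≤ d / 8 := fun x hx => by
    have := one_div_le_one_div_of_le h8 hx
    rwa [one_div_div] at this
  have k3 := (abs_im_sub_moment_le hb₃ (by linarith)
    (limitSpectrum_quadPotential_subset (by linarith) hE')).trans (hinv _ (by linarith))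
  have him : |E.im - E'.im| < d / 4 := by
    rw [← Complex.sub_im]; exact (Complex.abs_im_le_norm _).trans_lt hlt
  have a3 := abs_le.1 k3
  have a4 := abs_lt.1 him
  rcases limitSpectrum_perturbed_subset hδ.ne' hβ (by linarith) (by linarith) hE with h | h
  · have k1 := (abs_im_sub_moment_le hb₁ (by linarith) h).trans (hinv _ (by linarith))
    simp only [Complex.add_im, Complex.im_ofReal_mul, Complex.I_im, mul_one] at k1
    have a1 := abs_le.1 k1
    have : |moment₁ β - moment₁ 1| < d := abs_lt.2 ⟨by linarith [a1.1, a1.2, a3.1, a3.2, a4.1, a4.2],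
      by linarith [a1.1, a1.2, a3.1, a3.2, a4.1, a4.2]⟩
    exact absurd this (not_lt.2 (min_le_left _ _))
  · have k1 := (abs_im_sub_moment_le hb₂ (by linarith) h).trans (hinv _ (by linarith))
    simp only [Complex.sub_im, Complex.im_ofReal_mul, Complex.I_im, mul_one] at k1
    have a1 := abs_le.1 k1
    have : |moment₁ (-β) - moment₁ 1| < d := abs_lt.2 ⟨by linarith [a1.1, a1.2, a3.1, a3.2, a4.1, a4.2],
      by linarith [a1.1, a1.2, a3.1, a3.2, a4.1, a4.2]⟩
    exact absurd this (not_lt.2 (min_le_right _ _))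

theorem theorem6p5 (β : ℝ) (hβ : β ∈ Ioo (-1 : ℝ) 1) :
    (∀ δ : ℝ, 0 ≤ δ →
      (0 < δ → ∃ R : ℝ, ∀ E : ℂ, R ≤ ‖E‖ →
        (E ∈ limitSpectrum (perturbedPotential δ β) ↔ E ∈ leftCurve δ β ∪ rightCurve δ β)) ∧
      IsAsymptoticToLine (leftCurve δ β) ((β ^ 2 - β + 1) / 3 - δ) ∧
      IsAsymptoticToLine (rightCurve δ β) ((β ^ 2 + β + 1) / 3 + δ) ∧
      (β ≠ 0 → ∃ R : ℝ, ∀ E : ℂ, R ≤ ‖E‖ → ¬ (E ∈ leftCurve δ β ∧ E ∈ rightCurve δ β))) ∧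
    (β ≠ 0 → ∃ c > (0 : ℝ), ∃ δ₀ > (0 : ℝ), ∀ δ : ℝ, 0 < δ → δ < δ₀ → ∃ R : ℝ,
      ∀ E ∈ limitSpectrum (perturbedPotential δ β), ∀ E' ∈ limitSpectrum quadPotential,
        R ≤ ‖E‖ → c ≤ ‖E - E'‖) := by
  have hb₁ : β ∈ Ioc (-1 : ℝ) 1 := ⟨hβ.1, hβ.2.le⟩
  have hb₂ : -β ∈ Ioc (-1 : ℝ) 1 := ⟨by linarith [hβ.2], by linarith [hβ.1]⟩
  refine ⟨fun δ _ => ⟨fun hδ => ?_, ?_, ?_, fun hβ0 => ?_⟩, limitSpectrum_unstable hβ⟩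
  · obtain ⟨R, hR⟩ := mem_limitSpectrum_perturbed_iff hβ hδ.ne'
    refine ⟨R, fun E hE => ?_⟩
    rw [hR E hE, mem_union, mem_leftCurve_iff, mem_rightCurve_iff]
  · have e : leftCurve δ β = {E | E + δ * Complex.I ∈ actionCurve quadPotential (-1) β} :=
      Set.ext fun _ => mem_leftCurve_iff
    rw [e]
    exact isAsymptoticToLine_actionCurve_shift hb₁ δ
  · have e : rightCurve δ β =
        {E | E + ((-δ : ℝ) : ℂ) * Complex.I ∈ actionCurve quadPotential (-1) ((-β : ℝ))} := by
      refine Set.ext fun E => mem_rightCurve_iff.trans ?_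
      rw [mem_ofPred_eq, Complex.ofReal_neg, neg_mul, sub_eq_add_neg]
    have e2 : (β ^ 2 + β + 1) / 3 + δ = moment₁ (-β) - -δ := by simp only [moment₁]; ring
    rw [e, e2]
    exact isAsymptoticToLine_actionCurve_shift hb₂ (-δ)
  · obtain ⟨R, hR⟩ := disjoint_actionCurve_shift hβ (s := δ) (Or.inl hβ0)
    refine ⟨R, fun E hE => ?_⟩
    rw [mem_leftCurve_iff, mem_rightCurve_iff]
    exact hR E hE
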